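/- Let $R\subset\mathbb H^4$ be the ideal hyperbolic rectified 4-simplex: fix a regular 4-simplex $\Delta\subset\mathbb R^4$ with vertices $v_1,\dots,v_5$ and interpret the open ball bounded by the sphere through the midpoints of the edges of $\Delta$ as the projective model of $\mathbb H^4$; then $R$ is the part in $\mathbb H^4$ of the convex hull of these midpoints. Let $F_i$ be the facet of $R$ contained in the facet of $\Delta$ opposite to $v_i$, and let $F_i'$ be the facet of $R$ in the hyperplane through the midpoints of the four edges of $\Delta$ at $v_i$. Let the edges of the complete graph $K_6$ be labelled by $1,\dots,5$ so that adjacent edges have distinct labels. Take a copy of $R$ for each vertex of $K_6$ and, whenever two vertices are joined by an edge with label $i$, glue the facets $F_i$ of the two corresponding copies by the identity; call the result $B$, and let $\partial_i\subset B$ be the union of the facets $F_i'$ of the six copies of $R$. Now take a copy of $B$ for each vertex of $K_6$ and, whenever two vertices are joined by an edge with label $i$, glue the subsets $\partial_i$ of the two corresponding copies by the identity; call the result $M'$. Thus $M'$ is a gluing of 36 copies of $R$. Then, with the hyperbolic structure induced from the copies of $R$, $M'$ is a connected, complete, non-orientable hyperbolic 4-manifold (without boundary). Its orientation double cover $M$,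 with the lifted structure, is a two-sheeted covering of $M'$ and a connected, complete, orientable hyperbolic 4-manifold. The manifold $M$ has exactly 10 cusps, each with section diffeomorphic to the 3-torus: there are 10 pairwise disjoint open subsets of $M$ whose union has compact complement in $M$, each of them isometric to the quotient of an open horoball of $\mathbb H^4$ by a group of isometries fixing its centre and preserving each of its concentric horospheres, and the image in $M$ of each horosphere in the interior of the horoball and concentric with it is a smooth submanifold diffeomorphic to $\mathbb R^3/\mathbb Z^3$. -/

import Mathlib

open Set Filter Topology
open scoped ContDiff

namespace Rectified

/-! ### Hyperbolic 4-space

`ℝ⁵` carries the coordinates `x₁, …, x₅` that are, up to scale, the barycentric coordinates of a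
regular 4-simplex with vertices `e₁, …, e₅`.  Its Lorentzian form is chosen so that the ball of
the projective (Klein) model is bounded by the sphere through the midpoints `e i + e j` of the
edges of the simplex.  Points are normalised to lie on the hyperboloid. -/

/-- The ambient space `ℝ⁵`. -/
abbrev E5 : Type := Fin 5 → ℝ

/-- The symmetric bilinear form `⟨x, y⟩ = ∑ xᵢ yᵢ - (∑ xᵢ) (∑ yᵢ) / 2`, of signature `(4, 1)`. -/
noncomputable def lor (x y : E5) : ℝ :=
  (∑ i, x i * y i) - (∑ i, x i) * (∑ i, y i) / 2

/-- The form in diagonal shape: positive definite on `∑ xᵢ = 0`, negative on the line through the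
barycentre `(1, …, 1)`, and these are orthogonal. -/
theorem lor_self (x : E5) :
    lor x x = (∑ i, (x i - (∑ j, x j) / 5) ^ 2) - 3 / 10 * (∑ i, x i) ^ 2 := by
  simp only [lor, Fin.sum_univ_five]
  ring

/-- The midpoints of the edges of the simplex lie on the sphere at infinity. -/
theorem lor_midpoint (i j : Fin 5) (hij : i ≠ j) :
    lor (Pi.single i 1 + Pi.single j 1) (Pi.single i 1 + Pi.single j 1) = 0 := by
  fin_cases i <;> fin_cases j <;>
    first
    | exact absurd rfl hij
    | (simp [lor, Fin.sum_univ_five, Pi.single_apply]; try norm_num)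

/-- The upper sheet of the hyperboloid. -/
def hyperboloid : Set E5 := {x | lor x x = -1 ∧ 0 < ∑ i, x i}

/-- Hyperbolic 4-space (hyperboloid model). -/
abbrev H4 : Type := hyperboloid

/-- The isometries of `H4`: linear maps that preserve the form and the upper sheet. -/
def IsHypIso (g : E5 ≃ₗ[ℝ] E5) : Prop :=
  (∀ x y, lor (g x) (g y) = lor x y) ∧ ∀ x, g x ∈ hyperboloid ↔ x ∈ hyperboloid

/-! ### Hyperbolic manifolds

A hyperbolic structure on a space `N` is given by an atlas of charts with values in `H4` whose
coordinate changes are locally restrictions of isometries of `H4`. -/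

section Manifolds

variable {N : Type*} [TopologicalSpace N]

/-- Near `x`, the chart `ψ` is the chart `φ` followed by an isometry of `H4`. -/
def AgreeAt (φ ψ : OpenPartialHomeomorph N H4) (x : N) : Prop :=
  ∃ g : E5 ≃ₗ[ℝ] E5, IsHypIso g ∧ ∀ᶠ y in 𝓝 x, (ψ y : E5) = g (φ y : E5)

/-- Near `x`, the chart `ψ` is the chart `φ` followed by an orientation preserving isometry of
`H4`. -/
def OrientAgreeAt (φ ψ : OpenPartialHomeomorph N H4) (x : N) : Prop :=
  ∃ g : E5 ≃ₗ[ℝ] E5, IsHypIso g ∧ 0 < LinearMap.det (g : E5 →ₗ[ℝ] E5) ∧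
    ∀ᶠ y in 𝓝 x, (ψ y : E5) = g (φ y : E5)

/-- The charts in `A` cover `N`, and coordinate changes are locally isometries of `H4`. -/
def IsHyperbolicAtlas (A : Set (OpenPartialHomeomorph N H4)) : Prop :=
  (∀ x, ∃ φ ∈ A, x ∈ φ.source) ∧
    ∀ φ ∈ A, ∀ ψ ∈ A, ∀ x ∈ φ.source ∩ ψ.source, AgreeAt φ ψ x

/-- In the chart `φ`, the curve `γ` is, near time `t`, the unit speed geodesic of `H4` with
velocity `w` at time `t`. -/
def IsGeodesicAt (φ : OpenPartialHomeomorph N H4) (γ : ℝ → N) (t : ℝ) (w : E5) : Prop :=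
  lor (φ (γ t) : E5) w = 0 ∧ lor w w = 1 ∧
    ∀ᶠ s in 𝓝 t, γ s ∈ φ.source ∧
      (φ (γ s) : E5) = Real.cosh (s - t) • (φ (γ t) : E5) + Real.sinh (s - t) • w

/-- Geodesic completeness: through every point, in every direction, there is a geodesic that is
defined for all times. -/
def IsGeodesicallyComplete (A : Set (OpenPartialHomeomorph N H4)) : Prop :=
  ∀ φ ∈ A, ∀ x ∈ φ.source, ∀ w : E5, lor (φ x : E5) w = 0 → lor w w = 1 →
    ∃ γ : ℝ → N, γ 0 = x ∧ IsGeodesicAt φ γ 0 w ∧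
      ∀ t, ∃ ψ ∈ A, ∃ w', IsGeodesicAt ψ γ t w'

/-- `N`, with the hyperbolic structure `A`, is a connected complete hyperbolic 4-manifold. -/
def IsCompleteHyperbolicManifold (A : Set (OpenPartialHomeomorph N H4)) : Prop :=
  T2Space N ∧ SecondCountableTopology N ∧ ConnectedSpace N ∧
    IsHyperbolicAtlas A ∧ IsGeodesicallyComplete A

/-- There is a subatlas with orientation preserving coordinate changes. -/
def IsOrientable (A : Set (OpenPartialHomeomorph N H4)) : Prop :=
  ∃ A₀ ⊆ A, (∀ x, ∃ φ ∈ A₀, x ∈ φ.source) ∧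
    ∀ φ ∈ A₀, ∀ ψ ∈ A₀, ∀ x ∈ φ.source ∩ ψ.source, OrientAgreeAt φ ψ x

/-! ### The orientation double cover -/

/-- A point of the orientation double cover: a point of `N` with an orientation of `N` at that
point, given by the set `pos` of the charts around the point that are positively oriented. -/
@[ext]
structure OrientationCover (A : Set (OpenPartialHomeomorph N H4)) where
  point : N
  pos : Set (OpenPartialHomeomorph N H4)
  pos_sub : ∀ φ ∈ pos, φ ∈ A ∧ point ∈ φ.source
  coherent : ∀ φ ∈ A, ∀ ψ ∈ A, point ∈ φ.source → point ∈ ψ.source →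
    ((φ ∈ pos ↔ ψ ∈ pos) ↔ OrientAgreeAt φ ψ point)

/-- The topology for which the projection to `N` is continuous and, over the domain of a chart,
the points where that chart is positive (or negative) form an open set. -/
instance (A : Set (OpenPartialHomeomorph N H4)) : TopologicalSpace (OrientationCover A) :=
  TopologicalSpace.induced OrientationCover.point inferInstance ⊓
    TopologicalSpace.generateFrom
      {U | ∃ φ ∈ A, U = {z | z.point ∈ φ.source ∧ φ ∈ z.pos} ∨
        U = {z | z.point ∈ φ.source ∧ φ ∉ z.pos}}

/-- The hyperbolic structure of the orientation double cover, lifted from `N`: its charts are,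
locally, charts of `N` composed with the projection. -/
def liftedAtlas (A : Set (OpenPartialHomeomorph N H4)) :
    Set (OpenPartialHomeomorph (OrientationCover A) H4) :=
  {ψ | ∀ z ∈ ψ.source, ∃ φ ∈ A, z.point ∈ φ.source ∧ ∀ᶠ z' in 𝓝 z, ψ z' = φ z'.point}

/-! ### Cusps -/

/-- The open horoball `{x | -⟨x, v⟩ < 1}` centred at the null vector `v`. -/
def horoball (v : E5) : Set H4 := {x | -lor (x : E5) v < 1}

/-- The horosphere `{x | -⟨x, v⟩ = t}` centred at the null vector `v`. -/
def horosphere (v : E5) (t : ℝ) : Set H4 := {x | -lor (x : E5) v = t}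

/-- A cusp of the hyperbolic manifold `N`: an isometric copy in `N` of the quotient of an open
horoball by a group `Γ` of isometries that fix its centre.  The map `param` restricted to the
horoball is the corresponding local isometry onto an open subset of `N`, with the orbits of `Γ`
as fibres; the quotients of the horospheres are compact. -/
structure Cusp (A : Set (OpenPartialHomeomorph N H4)) where
  centre : E5
  null : lor centre centre = 0
  future : 0 < ∑ i, centre i
  Γ : Subgroup (E5 ≃ₗ[ℝ] E5)
  isHypIso : ∀ g ∈ Γ, IsHypIso g
  fixes : ∀ g ∈ Γ, g centre = centre
  param : H4 → N
  localIsometry : ∀ x ∈ horoball centre, ∃ φ ∈ A, ∃ g : E5 ≃ₗ[ℝ] E5, IsHypIso g ∧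
    ∀ᶠ y in 𝓝 x, param y ∈ φ.source ∧ (φ (param y) : E5) = g (y : E5)
  fibres : ∀ x ∈ horoball centre, ∀ y ∈ horoball centre,
    (param x = param y ↔ ∃ g ∈ Γ, g (x : E5) = (y : E5))
  compactSections : ∀ t ∈ Ioo (0 : ℝ) 1, IsCompact (param '' horosphere centre t)

/-- The part of `N` that the cusp occupies. -/
def Cusp.region {A : Set (OpenPartialHomeomorph N H4)} (C : Cusp A) : Set N :=
  C.param '' horoball C.centre

/-- The cusp section at level `t ∈ (0, 1)`: the image of a horosphere. -/
def Cusp.crossSection {A : Set (OpenPartialHomeomorph N H4)} (C : Cusp A) (t : ℝ) : Set N :=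
  C.param '' horosphere C.centre t

/-- `S ⊆ N` is a smooth submanifold diffeomorphic to the 3-torus `ℝ³ / ℤ³`: it is the image of an
injective immersion `ℝ³ / ℤ³ → N`, written as a `ℤ³`-periodic map `e` on `ℝ³`. -/
def IsSmoothThreeTorus (A : Set (OpenPartialHomeomorph N H4)) (S : Set N) : Prop :=
  ∃ e : (Fin 3 → ℝ) → N, range e = S ∧
    (∀ x y, e x = e y ↔ ∃ n : Fin 3 → ℤ, ∀ i, y i = x i + n i) ∧
    ∀ x, ∃ φ ∈ A, (∀ᶠ y in 𝓝 x, e y ∈ φ.source) ∧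
      ContDiffAt ℝ ∞ (fun y => (φ (e y) : E5)) x ∧
      Function.Injective (fderiv ℝ (fun y => (φ (e y) : E5)) x)

/-- `N` has exactly `n` cusps, and all their sections are diffeomorphic to the 3-torus: the
complement of `n` pairwise disjoint cusps is compact. -/
def HasExactlyTorusCusps (A : Set (OpenPartialHomeomorph N H4)) (n : ℕ) : Prop :=
  ∃ C : Fin n → Cusp A,
    (∀ k l, k ≠ l → Disjoint (C k).region (C l).region) ∧
    IsCompact (⋃ k, (C k).region)ᶜ ∧
    ∀ k, ∀ t ∈ Ioo (0 : ℝ) 1, IsSmoothThreeTorus A ((C k).crossSection t)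

end Manifolds

/-! ### The ideal rectified 4-simplex -/

/-- The ideal hyperbolic rectified 4-simplex.  In barycentric coordinates, `0 ≤ x i` is the
half-space of the simplex bounded by the facet opposite to the vertex `e i`, and
`x i ≤ (∑ x j) / 2` cuts off `e i` by the hyperplane through the midpoints of the edges at `e i`. -/
def polytope : Set H4 :=
  {x | ∀ i, 0 ≤ (x : E5) i ∧ (x : E5) i ≤ (∑ j, (x : E5) j) / 2}

/-- The octahedral facet `F i`. -/
def facet (i : Fin 5) : Set polytope := {x | ((x : H4) : E5) i = 0}

/-- The tetrahedral facet `F' i`. -/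
def facet' (i : Fin 5) : Set polytope :=
  {x | ((x : H4) : E5) i = (∑ j, ((x : H4) : E5) j) / 2}

/-! ### Gluing along an edge-labelled complete graph -/

/-- A labelling of the edges of the complete graph `K₆` by five labels such that adjacent edges
have distinct labels (the value on loops is irrelevant). -/
def IsProperLabelling (lab : Sym2 (Fin 6) → Fin 5) : Prop :=
  ∀ u v w, u ≠ v → u ≠ w → v ≠ w → lab s(u, v) ≠ lab s(u, w)

/-- Such labellings exist. -/
theorem exists_properLabelling : ∃ lab, IsProperLabelling lab := by
  let m : Fin 6 → Fin 6 → Fin 5 :=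
    ![![0, 0, 4, 3, 2, 1],
      ![0, 0, 1, 2, 4, 3],
      ![4, 1, 0, 0, 3, 2],
      ![3, 2, 0, 0, 1, 4],
      ![2, 4, 3, 1, 0, 0],
      ![1, 3, 2, 4, 0, 0]]
  have hm : ∀ u v, m u v = m v u := by decide
  refine ⟨Sym2.lift ⟨m, hm⟩, ?_⟩
  have h : ∀ u v w, u ≠ v → u ≠ w → v ≠ w → m u v ≠ m u w := by decide
  intro u v w h1 h2 h3
  simpa using h u v w h1 h2 h3

/-- In the copies of `Y` indexed by the vertices of `K₆`, the subsets `F i` of the copies at the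
ends of an edge with label `i` are identified by the identity. -/
inductive GlueRel {Y : Type*} (lab : Sym2 (Fin 6) → Fin 5) (F : Fin 5 → Set Y) :
    Fin 6 × Y → Fin 6 × Y → Prop
  | glue (u v : Fin 6) (y : Y) : u ≠ v → y ∈ F (lab s(u, v)) → GlueRel lab F (u, y) (v, y)

/-- The space glued from six copies of `Y` along the labelled graph `K₆`. -/
def Glue {Y : Type*} (lab : Sym2 (Fin 6) → Fin 5) (F : Fin 5 → Set Y) : Type _ :=
  Quot (GlueRel lab F)

/-- The quotient topology. -/
instance {Y : Type*} [TopologicalSpace Y] (lab : Sym2 (Fin 6) → Fin 5) (F : Fin 5 → Set Y) :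
    TopologicalSpace (Glue lab F) :=
  inferInstanceAs (TopologicalSpace (Quot (GlueRel lab F)))

/-- The image of a point of the copy of `Y` at the vertex `u`. -/
def Glue.mk {Y : Type*} (lab : Sym2 (Fin 6) → Fin 5) (F : Fin 5 → Set Y) (u : Fin 6) (y : Y) :
    Glue lab F := Quot.mk _ (u, y)

/-- The building block: six copies of the polytope, glued along the facets `F i`. -/
abbrev Block (lab : Sym2 (Fin 6) → Fin 5) : Type := Glue lab facet

/-- The boundary component `∂ i` of the building block, tessellated by the facets `F' i`. -/
def Block.bdry (lab : Sym2 (Fin 6) → Fin 5) (i : Fin 5) : Set (Block lab) :=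
  {b | ∃ u, ∃ x ∈ facet' i, b = Glue.mk lab facet u x}

/-- The space `M'`: six copies of the building block, glued along the boundary components. -/
abbrev MPrime (lab : Sym2 (Fin 6) → Fin 5) : Type := Glue lab (Block.bdry lab)

/-- The inclusion in `M'` of the 36 copies of the polytope. -/
def MPrime.tile (lab : Sym2 (Fin 6) → Fin 5) (w u : Fin 6) (x : polytope) : MPrime lab :=
  Glue.mk lab (Block.bdry lab) w (Glue.mk lab facet u x)

/-- The hyperbolic structure of `M'`: its charts are the homeomorphisms from open subsets of `M'`
to open subsets of `H4` that on each copy of the polytope are locally isometries of `H4`. -/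
def MPrime.atlas (lab : Sym2 (Fin 6) → Fin 5) : Set (OpenPartialHomeomorph (MPrime lab) H4) :=
  {φ | ∀ w u, ∀ x, MPrime.tile lab w u x ∈ φ.source →
    ∃ g : E5 ≃ₗ[ℝ] E5, IsHypIso g ∧
      ∀ᶠ y in 𝓝 x, (φ (MPrime.tile lab w u y) : E5) = g ((y : H4) : E5)}

/-- The manifold `M`: the orientation double cover of `M'`. -/
abbrev MCover (lab : Sym2 (Fin 6) → Fin 5) : Type := OrientationCover (MPrime.atlas lab)

/-- The hyperbolic structure of `M`. -/
def MCover.atlas (lab : Sym2 (Fin 6) → Fin 5) : Set (OpenPartialHomeomorph (MCover lab) H4) :=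
  liftedAtlas (MPrime.atlas lab)

end Rectified

namespace Rectified

/-! ### The Lorentzian form -/

/-! The polytope R is a Coxeter polytope. For i ≠ j the facets F_i and F_j meet at the angle π/3,
and F_i is orthogonal to F'_j; the pairs F_i, F'_i and F'_i, F'_j do not meet in hyperbolic space.
Two perfect matchings of K₆ without common edge form a hexagon, so that six tiles close up around
F_i ∩ F_j, and four around F_i ∩ F'_j. Algebraically, each reflection is paired with the permutation
of the 36 tiles that crosses the facet. In the group `tileGroup` generated by these pairs, both
factors satisfy the braid or commutation relation of any two facets that meet.

The developing map `dev` reflects a point of H⁴ step by step into the polytope and keeps track of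
the tile. The reflections preserve ℤ⁵, so a count of integral vectors makes this terminate
(`depth_refl_lt`), and the relations make the result independent of the choices (`dev_of_neg`). Its
fibres are the orbits of the group (`dev_eq_iff`); integrality gives proper discontinuity, and the
action on pairs of a tile and a point is free (`eq_one_of_fixed`). Hence M' is the quotient of H⁴ by
`deckGroup`, the stabiliser of the base tile. The charts of M' are exactly the local inverses of
`dev` followed by isometries: two tiles that share a facet cannot be unfolded to the same side
(`chart_cross`). Completeness is inherited from H⁴.

Three matchings of K₆ always contain a triangle (`exists_triangle`). Walking around it is a product
of three reflections that preserves a tile, so the deck group reverses orientation somewhere. M' is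
therefore non-orientable, and M is the quotient of H⁴ by the orientation preserving deck
transformations (`isDeveloping_lift`).

The cusps come from the ten ideal vertices of R. By integrality, suitable horoballs at distinct
vertices of the tessellation are disjoint (`IsPrimitiveNull.eq_of_mem_horoball`). The stabiliser of
an ideal vertex is transitive on the tiles together with a sign of orientation
(`exists_parabolic_cuspLetters`), so each ideal vertex of R gives only one cusp of M. The link of an
ideal vertex is an equilateral triangle times an interval. An orientation preserving deck
transformation that fixes the vertex is a translation, since any other candidate would yield a
forbidden fixed point (`exists_isTranslation`). These translations form a lattice, so the sections
are 3-tori; what remains is covered by finitely many truncated copies of R. -/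

theorem lor_comm (x y : E5) : lor x y = lor y x := by
  simp only [lor, mul_comm]

theorem lor_add_left (x y z : E5) : lor (x + y) z = lor x z + lor y z := by
  simp only [lor, Fin.sum_univ_five, Pi.add_apply]; ring

theorem lor_smul_left (c : ℝ) (x y : E5) : lor (c • x) y = c * lor x y := by
  simp only [lor, Fin.sum_univ_five, Pi.smul_apply, smul_eq_mul]; ring

theorem lor_add_right (x y z : E5) : lor x (y + z) = lor x y + lor x z := by
  simp only [lor_comm x, lor_add_left]

theorem lor_smul_right (c : ℝ) (x y : E5) : lor x (c • y) = c * lor x y := by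
  simp only [lor_comm x, lor_smul_left]

theorem lor_sub_right (x y z : E5) : lor x (y - z) = lor x y - lor x z := by
  simp only [lor, Fin.sum_univ_five, Pi.sub_apply]; ring

theorem lor_sub_left (x y z : E5) : lor (x - y) z = lor x z - lor y z := by
  simp only [lor_comm _ z, lor_sub_right]

theorem lor_nondegenerate {x : E5} (h : ∀ y, lor x y = 0) : x = 0 := by
  have h0 : ∑ i, x i = 0 := by
    have := h (fun _ => 1)
    simp only [lor, Fin.sum_univ_five] at this ⊢
    linarith
  ext i
  have := h (Pi.single i 1)
  simpa [lor, h0, Pi.single_apply] using this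

theorem continuous_lor {X : Type*} [TopologicalSpace X] {f g : X → E5} (hf : Continuous f)
    (hg : Continuous g) : Continuous fun x => lor (f x) (g x) := by
  unfold lor
  fun_prop

/-- The sum of the coordinates, a multiple of the time coordinate. -/
def ht : E5 →ₗ[ℝ] ℝ := ∑ i, LinearMap.proj i

theorem ht_apply (x : E5) : ht x = ∑ i, x i := by simp [ht]

theorem lor_eq_sum (x y : E5) :
    lor x y = (∑ i, (x i - ht x / 5) * (y i - ht y / 5)) - 3 / 10 * (ht x * ht y) := by
  simp only [lor, ht_apply, Fin.sum_univ_five]; ring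

/-- Cauchy–Schwarz for the components orthogonal to the barycentre, whose norms `lor_self` expresses
by the form and the height. The reversed inequalities for causal vectors below come from it. -/
theorem spatial_sq_le (x y : E5) :
    (∑ i, (x i - ht x / 5) * (y i - ht y / 5)) ^ 2 ≤
      (lor x x + 3 / 10 * ht x ^ 2) * (lor y y + 3 / 10 * ht y ^ 2) := by
  have := Finset.sum_mul_sq_le_sq_mul_sq Finset.univ (fun i => x i - ht x / 5)
    (fun i => y i - ht y / 5)
  refine this.trans (le_of_eq ?_)
  rw [lor_self, lor_self, ht_apply, ht_apply]
  ring

theorem lor_self_ge (x : E5) : 0 ≤ lor x x + 3 / 10 * ht x ^ 2 := by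
  rw [lor_self, ht_apply]
  have : 0 ≤ ∑ i, (x i - (∑ j, x j) / 5) ^ 2 := Finset.sum_nonneg fun i _ => sq_nonneg _
  linarith

/-- The open cone of future timelike vectors. -/
def timeCone : Set E5 := {x | lor x x < 0 ∧ 0 < ht x}

theorem hyperboloid_subset_timeCone : hyperboloid ⊆ timeCone := fun x hx =>
  ⟨by rw [hx.1]; norm_num, by rw [ht_apply]; exact hx.2⟩

theorem ht_pos (x : H4) : 0 < ht x := (hyperboloid_subset_timeCone x.2).2

theorem lor_coe_self (x : H4) : lor (x : E5) x = -1 := x.2.1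

theorem neg_lor_le {x y : E5} (hx : lor x x ≤ 0) (hx' : 0 ≤ ht x) (hy : lor y y ≤ 0)
    (hy' : 0 ≤ ht y) : -lor x y ≤ 3 / 5 * (ht x * ht y) := by
  have h := spatial_sq_le x y
  have h1 : (∑ i, (x i - ht x / 5) * (y i - ht y / 5)) ^ 2 ≤ (3 / 10 * (ht x * ht y)) ^ 2 := by
    refine h.trans ?_
    have := mul_le_mul (show lor x x + 3 / 10 * ht x ^ 2 ≤ 3 / 10 * ht x ^ 2 by linarith)
      (show lor y y + 3 / 10 * ht y ^ 2 ≤ 3 / 10 * ht y ^ 2 by linarith) (lor_self_ge y)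
      (by positivity)
    linarith
  have h2 := abs_le_of_sq_le_sq' h1 (by positivity)
  rw [lor_eq_sum]
  linarith [h2.1]

/-- For future causal vectors the time parts dominate the space parts, strictly so when one vector
is timelike. This sign serves throughout to tell the future cone from the past one. -/
theorem lor_neg_of_mem_timeCone {x y : E5} (hx : lor x x ≤ 0) (hx' : 0 < ht x)
    (hy : y ∈ timeCone) : lor x y < 0 := by
  have h := spatial_sq_le x y
  have hy1 := hy.1
  have hy2 := hy.2
  have h1 : (∑ i, (x i - ht x / 5) * (y i - ht y / 5)) ^ 2 < (3 / 10 * (ht x * ht y)) ^ 2 := by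
    refine h.trans_lt ?_
    have := mul_lt_mul' (show lor x x + 3 / 10 * ht x ^ 2 ≤ 3 / 10 * ht x ^ 2 by linarith)
      (show lor y y + 3 / 10 * ht y ^ 2 < 3 / 10 * ht y ^ 2 by linarith) (lor_self_ge y)
      (by positivity)
    linarith
  have h2 := abs_lt_of_sq_lt_sq' h1 (by positivity)
  rw [lor_eq_sum]
  linarith [h2.2]

/-- A causal vector whose product with y is bounded has bounded height, hence bounded coordinates by
`abs_coord_le`. For integral vectors this leaves finitely many, the source of all finiteness below.
-/
theorem ht_le_of_causal {x : E5} (hx : lor x x ≤ 0) (hx' : 0 ≤ ht x) (y : H4) :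
    ht x ≤ 2 * ht y * -lor x y := by
  have h := spatial_sq_le x y
  have hy := ht_pos y
  have hyy := lor_self_ge (y : E5)
  rw [lor_coe_self] at h hyy
  have hxx := lor_self_ge x
  set s := ht x
  set r := ht (y : E5)
  -- The bound completes a square: 3/10 · s² · (3/10 · r² - 1) falls short of (s(3/10 · r -
  -- 1/(2r)))² by s²/(4r²).
  have key : (∑ i, (x i - s / 5) * ((y : E5) i - r / 5)) ≤ s * (3 / 10 * r - 1 / (2 * r)) := by
    have hr : 0 ≤ 3 / 10 * r - 1 / (2 * r) := by
      rw [sub_nonneg, div_le_iff₀ (by positivity)]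
      nlinarith
    refine abs_le_of_sq_le_sq' ?_ (by positivity) |>.2
    refine h.trans ?_
    have e : (s * (3 / 10 * r - 1 / (2 * r))) ^ 2
        = s ^ 2 * (9 / 100 * r ^ 2 - 3 / 10) + s ^ 2 * (1 / (2 * r)) ^ 2 := by
      field_simp
      ring
    rw [e]
    have h3 : (lor x x + 3 / 10 * s ^ 2) * (-1 + 3 / 10 * r ^ 2)
        ≤ (3 / 10 * s ^ 2) * (-1 + 3 / 10 * r ^ 2) :=
      mul_le_mul_of_nonneg_right (by linarith) hyy
    have h4 : 0 ≤ s ^ 2 * (1 / (2 * r)) ^ 2 := by positivity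
    linarith
  rw [lor_eq_sum]
  have h5 : s * (3 / 10 * r - 1 / (2 * r)) = 3 / 10 * (s * r) - s / (2 * r) := by
    field_simp
  rw [h5] at key
  have h6 : s / (2 * r) ≤ -(∑ i, (x i - s / 5) * ((y : E5) i - r / 5) - 3 / 10 * (s * r)) := by
    linarith
  rw [div_le_iff₀ (by positivity)] at h6
  linarith

theorem abs_coord_le {x : E5} (hx : lor x x ≤ 0) (hx' : 0 ≤ ht x) (i : Fin 5) :
    |x i| ≤ ht x := by
  refine abs_le_of_sq_le_sq ?_ hx'
  have h1 : x i ^ 2 ≤ ∑ j, x j ^ 2 :=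
    Finset.single_le_sum (f := fun j => x j ^ 2) (fun j _ => sq_nonneg _) (Finset.mem_univ i)
  have h2 : lor x x = (∑ j, x j ^ 2) - ht x ^ 2 / 2 := by
    simp only [lor, ht_apply, pow_two]
  nlinarith [sq_nonneg (ht x)]

/-! ### Normalisation and the topology of hyperbolic space -/

/-- Radial projection of this convex cone shows that the hyperboloid is connected. -/
theorem convex_timeCone : Convex ℝ timeCone := by
  intro x hx y hy a b ha hb hab
  have hxy := lor_neg_of_mem_timeCone hx.1.le hx.2 hy
  obtain ⟨hx1, hx2⟩ := hx
  obtain ⟨hy1, hy2⟩ := hy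
  have hyx : lor y x < 0 := by rwa [lor_comm]
  simp only [timeCone, mem_ofPred_eq, lor_add_left, lor_add_right, lor_smul_left, lor_smul_right,
    map_add, map_smul, smul_eq_mul]
  rcases ha.eq_or_lt with rfl | ha'
  · obtain rfl : b = 1 := by linarith
    simpa using ⟨hy1, hy2⟩
  · constructor
    · have h1 : a * (a * lor x x) < 0 := by
        have := mul_pos ha' ha'
        nlinarith
      have h2 : a * (b * lor x y) ≤ 0 := by
        have := mul_nonneg ha hb
        nlinarith
      have h3 : b * (b * lor y y) ≤ 0 := by
        have := mul_nonneg hb hb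
        nlinarith
      rw [lor_comm y x]
      linarith
    · have := mul_pos ha' hx2
      have := mul_nonneg hb hy2.le
      linarith

theorem isOpen_timeCone : IsOpen timeCone :=
  (isOpen_lt (continuous_lor continuous_id continuous_id) continuous_const).inter
    (isOpen_lt continuous_const ht.continuous_of_finiteDimensional)

/-- Radial projection of the cone of future timelike vectors onto the hyperboloid. -/
noncomputable def normalize (x : E5) : E5 := (√(-lor x x))⁻¹ • x

theorem normalize_mem {x : E5} (hx : x ∈ timeCone) : normalize x ∈ hyperboloid := by
  have h1 : 0 < -lor x x := by linarith [hx.1]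
  have h2 : 0 < √(-lor x x) := Real.sqrt_pos.2 h1
  refine ⟨?_, ?_⟩
  · rw [normalize, lor_smul_left, lor_smul_right, ← mul_assoc, ← mul_inv, Real.mul_self_sqrt h1.le]
    have := hx.1.ne
    field_simp
  · have : ht (normalize x) = (√(-lor x x))⁻¹ * ht x := by simp [normalize]
    rw [← ht_apply, this]
    exact mul_pos (inv_pos.2 h2) hx.2

theorem normalize_of_mem {x : E5} (hx : x ∈ hyperboloid) : normalize x = x := by
  rw [normalize, hx.1]; simp

theorem continuousOn_normalize : ContinuousOn normalize timeCone := by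
  intro x hx
  have h1 : 0 < -lor x x := by linarith [hx.1]
  refine ContinuousAt.continuousWithinAt ?_
  refine ContinuousAt.smul (f := fun x : E5 => (√(-lor x x))⁻¹) (g := id)
    (ContinuousAt.inv₀ ?_ (Real.sqrt_pos.2 h1).ne') continuousAt_id
  exact (Real.continuous_sqrt.comp
    (continuous_lor continuous_id continuous_id).neg).continuousAt

theorem isPreconnected_hyperboloid : IsPreconnected hyperboloid := by
  have h := convex_timeCone.isPreconnected.image normalize continuousOn_normalize
  convert h
  ext x
  constructor
  · exact fun hx => ⟨x, hyperboloid_subset_timeCone hx, normalize_of_mem hx⟩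
  · rintro ⟨y, hy, rfl⟩
    exact normalize_mem hy

theorem ones_mem_timeCone : (fun _ => 1 : E5) ∈ timeCone := by
  simp [timeCone, lor, ht_apply]; norm_num

instance : ConnectedSpace H4 where
  toPreconnectedSpace := Subtype.preconnectedSpace isPreconnected_hyperboloid
  toNonempty := ⟨⟨_, normalize_mem ones_mem_timeCone⟩⟩

theorem isClosed_hyperboloid : IsClosed hyperboloid := by
  have : hyperboloid = {x : E5 | lor x x = -1} ∩ {x | 0 ≤ ht x} := by
    ext x
    refine ⟨fun h => ⟨h.1, by simpa [ht_apply] using h.2.le⟩, fun h => ⟨h.1, ?_⟩⟩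
    have h1 := lor_self_ge x
    have h2 : lor x x = -1 := h.1
    have h3 : 0 ≤ ht x := h.2
    rw [← ht_apply]
    rcases h3.eq_or_lt with h4 | h4
    · rw [h2, ← h4] at h1; norm_num at h1
    · exact h4
  rw [this]
  exact (isClosed_eq (continuous_lor continuous_id continuous_id) continuous_const).inter
    (isClosed_le continuous_const ht.continuous_of_finiteDimensional)

/-- Properties that hold near a point of `H4` hold, after normalisation, at small displacements of
the point in any direction. -/
theorem eventually_displace {x : H4} {P : H4 → Prop} (hP : ∀ᶠ z in 𝓝 x, P z) (d : E5) :
    ∀ᶠ δ : ℝ in 𝓝 0, ∃ z : H4, P z ∧ ∃ c : ℝ, 0 < c ∧ (z : E5) = c • ((x : E5) + δ • d) := by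
  have hline : Tendsto (fun δ : ℝ => (x : E5) + δ • d) (𝓝 0) (𝓝 (x : E5)) := by
    have : Continuous fun δ : ℝ => (x : E5) + δ • d := by fun_prop
    simpa using this.tendsto 0
  have hcone : ∀ᶠ δ : ℝ in 𝓝 0, (x : E5) + δ • d ∈ timeCone :=
    hline.eventually (isOpen_timeCone.mem_nhds (hyperboloid_subset_timeCone x.2))
  rw [nhds_subtype_eq_comap, eventually_comap] at hP
  have hnorm : Tendsto (fun δ : ℝ => normalize ((x : E5) + δ • d)) (𝓝 0) (𝓝 (x : E5)) := by
    have h1 := (continuousOn_normalize.continuousAt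
      (isOpen_timeCone.mem_nhds (hyperboloid_subset_timeCone x.2))).tendsto
    rw [normalize_of_mem x.2] at h1
    exact h1.comp hline
  filter_upwards [hcone, hnorm.eventually hP] with δ h1 h2
  exact ⟨⟨_, normalize_mem h1⟩, h2 _ rfl, _, inv_pos.2 (Real.sqrt_pos.2 (by linarith [h1.1])), rfl⟩

/-- Near a point the hyperboloid contains, up to positive factors, small displacements in every
direction of ℝ⁵, and a linear map is determined by its values there. So an isometry is determined by
its germ. -/
theorem linearMap_eq_of_eventually_eq {x : H4} {f g : E5 →ₗ[ℝ] E5}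
    (h : ∀ᶠ z : H4 in 𝓝 x, f z = g z) : f = g := by
  ext1 d
  ext1
  simp only [LinearMap.comp_apply]
  generalize LinearMap.single ℝ (fun _ : Fin 5 => ℝ) d 1 = w
  have h1 := (eventually_displace h w).filter_mono (nhdsWithin_le_nhds (s := {0}ᶜ))
  obtain ⟨δ, ⟨z, hz, c, hc, hzc⟩, hδ⟩ := (h1.and self_mem_nhdsWithin).exists
  have h2 := h.self_of_nhds
  rw [hzc, map_smul, map_smul] at hz
  have h3 := smul_right_injective _ hc.ne' hz
  simp only [map_add, map_smul, h2] at h3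
  exact smul_right_injective _ hδ (add_left_cancel h3)

/-! ### The isometry group -/

/-- The isometry group of `H4`. -/
def hypIso : Subgroup (E5 ≃ₗ[ℝ] E5) where
  carrier := {g | IsHypIso g}
  mul_mem' {a b} ha hb :=
    ⟨fun x y => by simp only [LinearEquiv.mul_apply, ha.1, hb.1],
      fun x => by simp only [LinearEquiv.mul_apply, ha.2, hb.2]⟩
  one_mem' := ⟨fun _ _ => rfl, fun _ => Iff.rfl⟩
  inv_mem' {a} ha :=
    ⟨fun x y => by
        rw [← ha.1]; simp,
      fun x => by
        rw [← ha.2]; simp⟩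

instance : MulAction hypIso H4 where
  smul g x := ⟨g.1 x, (g.2.2 x).2 x.2⟩
  one_smul _ := rfl
  mul_smul _ _ _ := rfl

@[simp] theorem coe_smul (g : hypIso) (x : H4) : ((g • x : H4) : E5) = g.1 x := rfl

theorem lor_map (g : hypIso) (x y : E5) : lor (g.1 x) (g.1 y) = lor x y := g.2.1 x y

instance : ContinuousConstSMul hypIso H4 where
  continuous_const_smul g := by
    refine Continuous.subtype_mk ?_ _
    exact (LinearMap.continuous_of_finiteDimensional (g.1 : E5 →ₗ[ℝ] E5)).comp
      continuous_subtype_val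

theorem hypIso_eq_of_eventually_eq {x : H4} {g h : hypIso}
    (H : ∀ᶠ z : H4 in 𝓝 x, g • z = h • z) : g = h := by
  apply Subtype.ext
  apply LinearEquiv.toLinearMap_injective
  exact linearMap_eq_of_eventually_eq (H.mono fun z hz => congrArg Subtype.val hz)

/-- The definition of an isometry controls only the sheet of the hyperboloid; this extends it to
nonzero future causal vectors. The image still has negative product with a future timelike vector,
which rules out a nonpositive height. -/
theorem ht_map_pos (g : hypIso) {x : E5} (hx : lor x x ≤ 0) (hx' : 0 < ht x) :
    0 < ht (g.1 x) := by
  have h1 : lor (g.1 x) (g.1 (normalize fun _ => 1)) < 0 := by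
    rw [lor_map]
    exact lor_neg_of_mem_timeCone hx hx'
      (hyperboloid_subset_timeCone (normalize_mem ones_mem_timeCone))
  by_contra! h0
  rcases h0.eq_or_lt with h0 | h0
  · have h2 := spatial_sq_le (g.1 x) (g.1 (normalize fun _ => 1))
    rw [lor_map] at h2
    rw [lor_eq_sum] at h1
    simp only [h0] at h1 h2
    have h3 := lor_self_ge (g.1 x)
    rw [h0, lor_map] at h3
    have h4 : lor x x = 0 := by linarith
    rw [h4] at h2
    simp only [ne_eq, OfNat.ofNat_ne_zero, not_false_eq_true, zero_pow, mul_zero, add_zero,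
      zero_mul] at h2
    have h5 := pow_eq_zero_iff (n := 2) (by norm_num) |>.1 (le_antisymm h2 (sq_nonneg _))
    rw [h5] at h1
    simp at h1
  · have h2 : lor (-g.1 x) (g.1 (normalize fun _ => 1)) < 0 := by
      refine lor_neg_of_mem_timeCone ?_ ?_ (hyperboloid_subset_timeCone
        ((g.2.2 _).2 (normalize_mem ones_mem_timeCone)))
      · rw [← map_neg, lor_map]
        have : -x = (-1 : ℝ) • x := by simp
        rw [this, lor_smul_left, lor_smul_right]
        linarith
      · rw [map_neg]; linarith
    have : -g.1 x = (-1 : ℝ) • g.1 x := by simp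
    rw [this, lor_smul_left] at h2
    linarith

/-! ### The reflections in the facets -/

/-- The facets of the polytope: `inl i` stands for `F i` and `inr i` for `F' i`. -/
abbrev Letter : Type := Fin 5 ⊕ Fin 5

/-- The linear functional that is nonnegative on the polytope and vanishes on a facet. -/
def wall : Letter → E5 →ₗ[ℝ] ℝ
  | .inl i => LinearMap.proj (φ := fun _ : Fin 5 => ℝ) i
  | .inr i => ht - (2 : ℝ) • LinearMap.proj (φ := fun _ : Fin 5 => ℝ) i

/-- The normal vector of a facet. -/
def root : Letter → E5
  | .inl i => (3 : ℝ) • (Pi.single i 1 : E5) - (fun _ => 1 : E5)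
  | .inr i => (-2 : ℝ) • (Pi.single i 1 : E5)

/-- The ratio between a normal vector and the corresponding functional. -/
def rootScale : Letter → ℝ
  | .inl _ => 3
  | .inr _ => 1

@[simp] theorem wall_inl (i : Fin 5) (x : E5) : wall (.inl i) x = x i := rfl

@[simp] theorem wall_inr (i : Fin 5) (x : E5) : wall (.inr i) x = ht x - 2 * x i := rfl

theorem rootScale_pos (a : Letter) : 0 < rootScale a := by
  rcases a with i | i <;> simp [rootScale]

@[simp] theorem ht_single (i : Fin 5) : ht (Pi.single i 1 : E5) = 1 := by simp [ht_apply]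

@[simp] theorem ht_ones : ht (fun _ => 1) = 5 := by simp [ht_apply]

theorem ht_root (a : Letter) : ht (root a) = -2 := by
  rcases a with i | i <;> simp [root]
  norm_num

theorem wall_root (a : Letter) : wall a (root a) = 2 := by
  rcases a with i | i
  · simp [root]; norm_num
  · rw [wall_inr, ht_root]; simp [root]; norm_num

/-- Both mixed entries are -1, with product 4 cos²(π/3): the facets meet at the angle π/3 and the
reflections satisfy the braid relation. The vanishing entries in the next two lemmas mean
orthogonality. -/
theorem wall_inl_root_inl {i j : Fin 5} (h : i ≠ j) : wall (.inl i) (root (.inl j)) = -1 := by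
  simp [root, h]

theorem wall_inl_root_inr {i j : Fin 5} (h : i ≠ j) : wall (.inl i) (root (.inr j)) = 0 := by
  simp [root, h]

theorem wall_inr_root_inl {i j : Fin 5} (h : i ≠ j) : wall (.inr i) (root (.inl j)) = 0 := by
  rw [wall_inr, ht_root]; simp [root, h]

theorem lor_single (x : E5) (i : Fin 5) : lor x (Pi.single i 1) = x i - ht x / 2 := by
  simp [lor, ht_apply, Pi.single_apply]

theorem lor_ones (x : E5) : lor x (fun _ => 1) = -(3 / 2) * ht x := by
  simp only [lor, ht_apply, Fin.sum_univ_five]; ring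

/-- Asking for `wall a (root a) = 2`, as reflections require, gives the two kinds of normal vectors
the norms 6 and 2; `rootScale` absorbs the difference. -/
theorem lor_root (a : Letter) (x : E5) : lor x (root a) = rootScale a * wall a x := by
  rcases a with i | i
  · rw [root, lor_sub_right, lor_smul_right, lor_single, lor_ones, wall_inl, rootScale]; ring
  · rw [root, lor_smul_right, lor_single, wall_inr, rootScale]; ring

theorem reflection_lor (a : Letter) (x y : E5) :
    lor (Module.reflection (wall_root a) x) (Module.reflection (wall_root a) y) = lor x y := by
  simp only [Module.reflection_apply, lor_sub_left, lor_sub_right, lor_smul_left, lor_smul_right,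
    lor_root, lor_comm (root a), map_sub, map_smul, smul_eq_mul, wall_root]
  ring

theorem reflection_ones_mem (a : Letter) :
    Module.reflection (wall_root a) (fun _ => 1) ∈ timeCone := by
  refine ⟨by rw [reflection_lor]; exact ones_mem_timeCone.1, ?_⟩
  rw [Module.reflection_apply, map_sub, map_smul, ht_root, ht_ones]
  rcases a with i | i <;> simp <;> norm_num

/-- The height is a negative multiple of the product with the barycentre. By invariance that product
equals the one of x with the reflected barycentre, which is again future timelike. -/
theorem reflection_mem (a : Letter) {x : E5} (hx : x ∈ hyperboloid) :
    Module.reflection (wall_root a) x ∈ hyperboloid := by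
  refine ⟨by rw [reflection_lor]; exact hx.1, ?_⟩
  have h := lor_neg_of_mem_timeCone (hyperboloid_subset_timeCone hx).1.le
    (hyperboloid_subset_timeCone hx).2 (reflection_ones_mem a)
  rw [← reflection_lor a, Module.involutive_reflection (wall_root a), lor_ones] at h
  rw [← ht_apply]
  linarith

/-- The reflection in a facet. -/
def refl (a : Letter) : hypIso :=
  ⟨Module.reflection (wall_root a), reflection_lor a, fun x =>
    ⟨fun h => by simpa [Module.involutive_reflection (wall_root a) x] using reflection_mem a h,
      reflection_mem a⟩⟩

theorem refl_apply (a : Letter) (x : E5) : (refl a).1 x = x - wall a x • root a :=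
  Module.reflection_apply x (wall_root a)

theorem wall_refl (a b : Letter) (x : E5) :
    wall b ((refl a).1 x) = wall b x - wall a x * wall b (root a) := by
  rw [refl_apply, map_sub, map_smul, smul_eq_mul]

theorem wall_refl_self (a : Letter) (x : E5) : wall a ((refl a).1 x) = -wall a x := by
  rw [wall_refl, wall_root]; ring

theorem ht_refl (a : Letter) (x : E5) : ht ((refl a).1 x) = ht x + 2 * wall a x := by
  rw [refl_apply, map_sub, map_smul, ht_root, smul_eq_mul]; ring

theorem refl_apply_of_wall_eq_zero {a : Letter} {x : E5} (h : wall a x = 0) :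
    (refl a).1 x = x := by
  rw [refl_apply, h, zero_smul, sub_zero]

theorem refl_smul_of_wall_eq_zero {a : Letter} {x : H4} (h : wall a x = 0) : refl a • x = x :=
  Subtype.ext (refl_apply_of_wall_eq_zero h)

theorem refl_mul_self (a : Letter) : refl a * refl a = 1 :=
  Subtype.ext (LinearEquiv.ext fun x => Module.involutive_reflection (wall_root a) x)

theorem hypIso_ext {g h : hypIso} (H : ∀ x, g.1 x = h.1 x) : g = h :=
  Subtype.ext (LinearEquiv.ext H)

theorem refl_comm {a b : Letter} (hab : wall a (root b) = 0) (hba : wall b (root a) = 0) :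
    refl a * refl b = refl b * refl a := by
  refine hypIso_ext fun x => ?_
  change (refl a).1 ((refl b).1 x) = (refl b).1 ((refl a).1 x)
  simp only [refl_apply, map_sub, map_smul, hab, hba]
  module

theorem refl_braid {a b : Letter} (hab : wall a (root b) = -1) (hba : wall b (root a) = -1) :
    refl a * refl b * refl a = refl b * refl a * refl b := by
  refine hypIso_ext fun x => ?_
  change (refl a).1 ((refl b).1 ((refl a).1 x)) = (refl b).1 ((refl a).1 ((refl b).1 x))
  simp only [refl_apply, map_sub, map_smul, hab, hba, wall_root]
  module

/-- A reflection is a transvection with determinant 1 + `wall a (-root a)` = 1 - 2. -/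
theorem det_refl (a : Letter) : LinearMap.det ((refl a).1 : E5 →ₗ[ℝ] E5) = -1 := by
  have : ((refl a).1 : E5 →ₗ[ℝ] E5) = LinearMap.transvection (wall a) (-root a) := by
    ext1 i
    ext1
    simp [refl_apply, LinearMap.transvection.apply, sub_eq_add_neg]
  rw [this, LinearMap.transvection.det, map_neg, wall_root]
  norm_num

/-! ### The relative position of the facets -/

theorem mem_polytope {x : H4} : x ∈ polytope ↔ ∀ a, 0 ≤ wall a (x : E5) := by
  simp only [polytope, mem_ofPred_eq, ← ht_apply, Sum.forall, wall_inl, wall_inr, ← forall_and]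
  refine forall_congr' fun i => and_congr_right fun _ => ?_
  constructor <;> intro <;> linarith

theorem mem_facet' {i : Fin 5} {x : polytope} : x ∈ facet' i ↔ wall (.inr i) (x : H4) = 0 := by
  rw [facet', mem_ofPred_eq, ← ht_apply, wall_inr]
  constructor <;> intro <;> linarith

theorem sum_sq_eq (x : H4) : ∑ i, (x : E5) i ^ 2 = ht (x : E5) ^ 2 / 2 - 1 := by
  have := lor_coe_self x
  simp only [lor, ← pow_two] at this
  rw [ht_apply]
  linarith

theorem not_wall_inl_inr_nonpos (x : H4) (i : Fin 5) (h : wall (.inl i) (x : E5) ≤ 0)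
    (h' : wall (.inr i) (x : E5) ≤ 0) : False := by
  have := ht_pos x
  rw [wall_inl] at h
  rw [wall_inr] at h'
  linarith

/-- Two coordinates of size at least `ht x / 2` would make the sum of squares at least `ht x ^ 2 /
2`, which on the hyperboloid it misses by 1. The two hyperplanes touch only at infinity. -/
theorem not_wall_inr_inr_nonpos (x : H4) {i j : Fin 5} (hij : i ≠ j)
    (h : wall (.inr i) (x : E5) ≤ 0) (h' : wall (.inr j) (x : E5) ≤ 0) : False := by
  have h1 := ht_pos x
  have h2 := sum_sq_eq x
  rw [wall_inr] at h h'
  have h3 : (x : E5) i ^ 2 + (x : E5) j ^ 2 ≤ ∑ k, (x : E5) k ^ 2 := by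
    rw [← Finset.sum_pair (f := fun k => (x : E5) k ^ 2) hij]
    exact Finset.sum_le_sum_of_subset_of_nonneg (Finset.subset_univ _) fun _ _ _ => sq_nonneg _
  nlinarith

/-- Cauchy–Schwarz for the two remaining coordinates gives `ht x ^ 2` ≤ 2 ∑ xᵢ² = `ht x ^ 2` - 2. -/
theorem not_three_wall_inl_eq_zero (x : H4) {i j k : Fin 5} (hij : i ≠ j) (hik : i ≠ k)
    (hjk : j ≠ k) (hi : (x : E5) i = 0) (hj : (x : E5) j = 0) (hk : (x : E5) k = 0) : False := by
  have h2 := sum_sq_eq x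
  have h3 : (∑ l, (x : E5) l) ^ 2 ≤ 2 * ∑ l, (x : E5) l ^ 2 := by
    have hs : ∀ f : Fin 5 → ℝ, f i = 0 → f j = 0 → f k = 0 →
        ∑ l, f l = ∑ l ∈ ({i, j, k} : Finset (Fin 5))ᶜ, f l := by
      intro f h1 h2 h3
      symm
      refine Finset.sum_subset (Finset.subset_univ _) fun l _ hl => ?_
      simp only [Finset.mem_compl, not_not, Finset.mem_insert, Finset.mem_singleton] at hl
      rcases hl with rfl | rfl | rfl <;> assumption
    rw [hs _ hi hj hk, hs (fun l => (x : E5) l ^ 2) (by simp [hi]) (by simp [hj]) (by simp [hk])]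
    have hc : (({i, j, k} : Finset (Fin 5))ᶜ).card = 2 := by
      rw [Finset.card_compl, Finset.card_eq_three.2 ⟨i, j, k, hij, hik, hjk, rfl⟩]; rfl
    have := sq_sum_le_card_mul_sum_sq (s := ({i, j, k} : Finset (Fin 5))ᶜ) (f := (x : E5))
    rwa [hc] at this
  rw [← ht_apply] at h3
  linarith

/-! ### Integrality -/

/-- The vectors with integral coordinates. -/
def intLattice : Set E5 := {v | ∃ z : Fin 5 → ℤ, ∀ i, v i = z i}

theorem ht_intLattice {v : E5} (hv : v ∈ intLattice) : ∃ n : ℤ, ht v = n := by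
  obtain ⟨z, hz⟩ := hv
  exact ⟨∑ i, z i, by simp [ht_apply, hz]⟩

/-- Walls and roots are integral. The reflection group is thus arithmetic, which yields its
discreteness, the termination of the descent into the polytope, and the disjointness of the
horoballs. -/
theorem refl_mem_intLattice (a : Letter) {v : E5} (hv : v ∈ intLattice) :
    (refl a).1 v ∈ intLattice := by
  obtain ⟨n, hn⟩ := ht_intLattice hv
  obtain ⟨z, hz⟩ := hv
  rcases a with i | i
  · refine ⟨fun j => z j - z i * (3 * (if j = i then 1 else 0) - 1), fun j => ?_⟩
    simp [refl_apply, root, hz, Pi.single_apply]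
  · refine ⟨fun j => z j - (n - 2 * z i) * (-2 * (if j = i then 1 else 0)), fun j => ?_⟩
    simp only [refl_apply, wall_inr, root, hz, hn, Pi.single_apply, Pi.sub_apply, Pi.smul_apply,
      smul_eq_mul]
    push_cast
    rfl

theorem ones_mem_intLattice : (fun _ => 1 : E5) ∈ intLattice := ⟨fun _ => 1, by simp⟩

theorem finite_intLattice_bounded (C : ℝ) : {v ∈ intLattice | ∀ i, |v i| ≤ C}.Finite := by
  have h := (Set.finite_Icc (fun _ : Fin 5 => -⌈C⌉) (fun _ => ⌈C⌉)).image
    (fun z : Fin 5 → ℤ => (fun i => (z i : ℝ) : E5))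
  refine h.subset ?_
  rintro v ⟨⟨z, hz⟩, hv⟩
  refine ⟨z, ⟨fun i => ?_, fun i => ?_⟩, funext fun i => (hz i).symm⟩
  · have := (abs_le.1 (hv i)).1
    rw [hz] at this
    have h2 : (-⌈C⌉ : ℝ) ≤ z i := by linarith [Int.le_ceil C]
    exact_mod_cast h2
  · have := (abs_le.1 (hv i)).2
    rw [hz] at this
    have h2 : (z i : ℝ) ≤ ⌈C⌉ := by linarith [Int.le_ceil C]
    exact_mod_cast h2

theorem finite_causal_intLattice (C : ℝ) :
    {v ∈ intLattice | lor v v ≤ 0 ∧ 0 ≤ ht v ∧ ht v ≤ C}.Finite :=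
  (finite_intLattice_bounded C).subset fun _ hv =>
    ⟨hv.1, fun i => (abs_coord_le hv.2.1 hv.2.2.1 i).trans hv.2.2.2⟩

/-! ### The descent into the polytope -/

/-- The integral vectors of the orbit type of `(1, …, 1)` that are closer to `y` than `(1, …, 1)`. -/
def closerVectors (y : H4) : Set E5 :=
  {v ∈ intLattice | lor v v = -15 / 2 ∧ 0 < ht v ∧ -lor v y < -lor (fun _ => 1) y}

theorem finite_closerVectors (y : H4) : (closerVectors y).Finite := by
  refine (finite_causal_intLattice (2 * ht y * -lor (fun _ => 1) y)).subset ?_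
  rintro v ⟨h1, h2, h3, h4⟩
  have h5 : lor v v ≤ 0 := by rw [h2]; norm_num
  refine ⟨h1, h5, h3.le, (ht_le_of_causal h5 h3.le y).trans ?_⟩
  have := ht_pos y
  exact mul_le_mul_of_nonneg_left h4.le (by linarith)

/-- A measure of the distance from `y` to the polytope. -/
noncomputable def depth (y : H4) : ℕ := (closerVectors y).ncard

/-- If y lies behind the wall, then (1, …, 1) is closer to the reflection of y than to y. The
reflection therefore maps the closer vectors of the reflected point injectively to closer vectors of
y, and misses the image of (1, …, 1), which is itself a closer vector of y. -/
theorem depth_refl_lt {a : Letter} {y : H4} (h : wall a (y : E5) < 0) :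
    depth (refl a • y) < depth y := by
  have hinv : ∀ x, (refl a).1 ((refl a).1 x) = x := Module.involutive_reflection (wall_root a)
  have hlor : lor (fun _ => 1) ((refl a).1 y) > lor (fun _ => 1) (y : E5) := by
    rw [lor_comm, lor_ones, lor_comm, lor_ones, ht_refl]
    linarith
  have h1 : (refl a).1 '' closerVectors (refl a • y) ⊆ closerVectors y := by
    rintro _ ⟨v, ⟨h1, h2, h3, h4⟩, rfl⟩
    refine ⟨refl_mem_intLattice a h1, by rw [lor_map, h2], ht_map_pos _ (by rw [h2]; norm_num) h3, ?_⟩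
    rw [← lor_map (refl a), hinv]
    rw [coe_smul] at h4
    linarith
  have h2 : (refl a).1 (fun _ => 1) ∈ closerVectors y := by
    refine ⟨refl_mem_intLattice a ones_mem_intLattice, ?_,
      ht_map_pos _ ones_mem_timeCone.1.le ones_mem_timeCone.2, ?_⟩
    · rw [lor_map, lor_ones, ht_ones]; norm_num
    · rw [← lor_map (refl a), hinv]; linarith
  have h3 : (refl a).1 (fun _ => 1) ∉ (refl a).1 '' closerVectors (refl a • y) := by
    rintro ⟨v, hv, hv'⟩
    rw [(refl a).1.injective hv'] at hv
    exact lt_irrefl _ hv.2.2.2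
  rw [depth, ← Set.ncard_image_of_injective _ (refl a).1.injective]
  exact Set.ncard_lt_ncard ⟨h1, fun h => h3 (h h2)⟩ (finite_closerVectors y)

/-! ### The matchings of a proper labelling -/

/-- The five edges at a vertex carry distinct labels, and there are five labels. -/
theorem exists_partner {lab : Sym2 (Fin 6) → Fin 5} (hlab : IsProperLabelling lab) (i : Fin 5)
    (u : Fin 6) : ∃ v, v ≠ u ∧ lab s(u, v) = i := by
  let f : {v // v ≠ u} → Fin 5 := fun v => lab s(u, v.1)
  have hf : Function.Injective f := by
    intro v w h
    by_contra hvw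
    exact hlab u v.1 w.1 v.2.symm w.2.symm (fun h => hvw (Subtype.ext h)) h
  have hb := (Fintype.bijective_iff_injective_and_card f).2 ⟨hf, by simp⟩
  obtain ⟨v, hv⟩ := hb.2 i
  exact ⟨v.1, v.2, hv⟩

theorem partner_unique {lab : Sym2 (Fin 6) → Fin 5} (hlab : IsProperLabelling lab) {u v w : Fin 6}
    (hv : v ≠ u) (hw : w ≠ u) (h : lab s(u, v) = lab s(u, w)) : v = w := by
  by_contra hvw
  exact hlab u v w hv.symm hw.symm hvw h

/-- The perfect matching of `K₆` formed by the edges with label `i`. -/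
noncomputable def matching {lab : Sym2 (Fin 6) → Fin 5} (hlab : IsProperLabelling lab)
    (i : Fin 5) : Equiv.Perm (Fin 6) :=
  Function.Involutive.toPerm (fun u => (exists_partner hlab i u).choose) fun u => by
    have h1 := (exists_partner hlab i u).choose_spec
    have h2 := (exists_partner hlab i (exists_partner hlab i u).choose).choose_spec
    exact partner_unique hlab h2.1 h1.1.symm (by rw [h2.2, Sym2.eq_swap, h1.2])

section Matching

variable {lab : Sym2 (Fin 6) → Fin 5} (hlab : IsProperLabelling lab)

theorem matching_ne (i : Fin 5) (u : Fin 6) : matching hlab i u ≠ u :=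
  (exists_partner hlab i u).choose_spec.1

theorem lab_matching (i : Fin 5) (u : Fin 6) : lab s(u, matching hlab i u) = i :=
  (exists_partner hlab i u).choose_spec.2

theorem matching_matching (i : Fin 5) (u : Fin 6) : matching hlab i (matching hlab i u) = u :=
  Function.Involutive.toPerm_involutive _ u

theorem matching_lab {u v : Fin 6} (h : u ≠ v) : matching hlab (lab s(u, v)) u = v :=
  partner_unique hlab (matching_ne hlab _ u) h.symm (lab_matching hlab _ u)

theorem matching_ne_matching {i j : Fin 5} (hij : i ≠ j) (u : Fin 6) :
    matching hlab i u ≠ matching hlab j u := fun h => hij <| by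
  rw [← lab_matching hlab i u, h, lab_matching hlab]

end Matching

/-- Two perfect matchings of `K₆` without common edge form a hexagon. -/
theorem fixedPointFree_involutions_hexagon {m n : Fin 6 → Fin 6} (hm : ∀ x, m (m x) = x)
    (hn : ∀ x, n (n x) = x) (hm' : ∀ x, m x ≠ x) (hn' : ∀ x, n x ≠ x) (hmn : ∀ x, m x ≠ n x)
    (u : Fin 6) : ∃ p, m (n (m u)) = p ∧ n (m (n u)) = p ∧
      ∀ x, x = u ∨ x = m u ∨ x = n u ∨ x = n (m u) ∨ x = m (n u) ∨ x = p := by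
  have h1 := hm' u
  have h2 := hn' u
  have h3 := hmn u
  have h4 : n (m u) ≠ u := fun h => by have := hn (m u); grind
  have h5 := hn' (m u)
  have h6 : n (m u) ≠ n u := fun h' => h1 (by rw [← hn (m u), h', hn])
  -- Otherwise the four vertices reached so far form a square, and both matchings must join the two
  -- remaining vertices to each other.
  have h : n (m u) ≠ m (n u) := by
    intro h
    have hc : ({u, m u, n u, n (m u)} : Finset (Fin 6)).card = 4 := by grind
    have hc2 : (({u, m u, n u, n (m u)} : Finset (Fin 6))ᶜ).card = 2 := by
      rw [Finset.card_compl, hc]; rfl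
    obtain ⟨p, q, hpq, hC⟩ := Finset.card_eq_two.1 hc2
    have hp : p ∈ ({u, m u, n u, n (m u)} : Finset (Fin 6))ᶜ := by simp [hC]
    have key : ∀ x, x ∈ ({u, m u, n u, n (m u)} : Finset (Fin 6))ᶜ → x = p ∨ x = q := by
      intro x hx; simpa [hC] using hx
    have e1 : m p = q := by
      refine (key (m p) ?_).resolve_left (hm' p)
      simp only [Finset.mem_compl, Finset.mem_insert, Finset.mem_singleton, not_or] at hp ⊢
      grind
    have e2 : n p = q := by
      refine (key (n p) ?_).resolve_left (hn' p)
      simp only [Finset.mem_compl, Finset.mem_insert, Finset.mem_singleton, not_or] at hp ⊢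
      grind
    exact hmn p (e1.trans e2.symm)
  have hc : ({u, m u, n u, n (m u), m (n u)} : Finset (Fin 6)).card = 5 := by
    have h7 : m (n u) ≠ u := fun h => by have := hm (n u); grind
    have h8 := hm' (n u)
    have h9 : m (n u) ≠ m u := fun h' => h2 (by rw [← hm (n u), h', hm])
    grind
  have hc2 : (({u, m u, n u, n (m u), m (n u)} : Finset (Fin 6))ᶜ).card = 1 := by
    rw [Finset.card_compl, hc]; rfl
  obtain ⟨p, hC⟩ := Finset.card_eq_one.1 hc2
  have key : ∀ x, x ∈ ({u, m u, n u, n (m u), m (n u)} : Finset (Fin 6))ᶜ → x = p := by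
    intro x hx; simpa [hC] using hx
  -- Only one vertex remains after the first five, so both walks of length three end there.
  refine ⟨p, key _ ?_, key _ ?_, fun x => ?_⟩
  · simp only [Finset.mem_compl, Finset.mem_insert, Finset.mem_singleton, not_or]
    grind
  · simp only [Finset.mem_compl, Finset.mem_insert, Finset.mem_singleton, not_or]
    grind
  · have := key x
    simp only [Finset.mem_compl, Finset.mem_insert, Finset.mem_singleton, not_or] at this
    tauto

theorem matching_hexagon {lab : Sym2 (Fin 6) → Fin 5} (hlab : IsProperLabelling lab) {i j : Fin 5}
    (hij : i ≠ j) (u : Fin 6) :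
    ∃ p, matching hlab i (matching hlab j (matching hlab i u)) = p ∧
      matching hlab j (matching hlab i (matching hlab j u)) = p ∧
      ∀ x, x = u ∨ x = matching hlab i u ∨ x = matching hlab j u ∨
        x = matching hlab j (matching hlab i u) ∨ x = matching hlab i (matching hlab j u) ∨ x = p :=
  fixedPointFree_involutions_hexagon (matching_matching hlab i) (matching_matching hlab j)
    (matching_ne hlab i) (matching_ne hlab j) (matching_ne_matching hlab hij) u

/-- The two walks of length three around the hexagon end at the opposite vertex. This is the tile
counterpart of `refl_braid`. -/
theorem matching_braid {lab : Sym2 (Fin 6) → Fin 5} (hlab : IsProperLabelling lab) {i j : Fin 5}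
    (hij : i ≠ j) (u : Fin 6) :
    matching hlab i (matching hlab j (matching hlab i u)) =
      matching hlab j (matching hlab i (matching hlab j u)) := by
  obtain ⟨p, h1, h2, -⟩ := matching_hexagon hlab hij u
  rw [h1, h2]

/-! ### The reflection group and its action on the tiles -/

/-- The index set of the 36 copies of the polytope. -/
abbrev Tile : Type := Fin 6 × Fin 6

/-- Passing from a tile to the adjacent tile across a facet. -/
noncomputable def cross {lab : Sym2 (Fin 6) → Fin 5} (hlab : IsProperLabelling lab) :
    Letter → Equiv.Perm Tile
  | .inl i => Equiv.prodCongr (Equiv.refl _) (matching hlab i)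
  | .inr i => Equiv.prodCongr (matching hlab i) (Equiv.refl _)

/-- The reflection in a facet, acting on `H4` and on the tiles. -/
noncomputable def gen {lab : Sym2 (Fin 6) → Fin 5} (hlab : IsProperLabelling lab) (a : Letter) :
    hypIso × Equiv.Perm Tile :=
  (refl a, cross hlab a)

/-- The group generated by the reflections, acting on `H4` and on the tiles. -/
noncomputable def tileGroup {lab : Sym2 (Fin 6) → Fin 5} (hlab : IsProperLabelling lab) :
    Subgroup (hypIso × Equiv.Perm Tile) :=
  Subgroup.closure (range (gen hlab))

section

variable {lab : Sym2 (Fin 6) → Fin 5} (hlab : IsProperLabelling lab)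

@[simp] theorem cross_inl (i : Fin 5) (t : Tile) :
    cross hlab (.inl i) t = (t.1, matching hlab i t.2) := rfl

@[simp] theorem cross_inr (i : Fin 5) (t : Tile) :
    cross hlab (.inr i) t = (matching hlab i t.1, t.2) := rfl

theorem cross_cross (a : Letter) (t : Tile) : cross hlab a (cross hlab a t) = t := by
  rcases a with i | i <;> simp [matching_matching]

theorem cross_ne (a : Letter) (t : Tile) : cross hlab a t ≠ t := by
  rcases a with i | i <;> intro h
  · exact matching_ne hlab i t.2 (congrArg Prod.snd h)
  · exact matching_ne hlab i t.1 (congrArg Prod.fst h)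

theorem gen_mem (a : Letter) : gen hlab a ∈ tileGroup hlab := Subgroup.subset_closure ⟨a, rfl⟩

theorem gen_mul_self (a : Letter) : gen hlab a * gen hlab a = 1 :=
  Prod.ext (refl_mul_self a) (Equiv.ext fun t => cross_cross hlab a t)

theorem gen_inv (a : Letter) : (gen hlab a)⁻¹ = gen hlab a :=
  inv_eq_of_mul_eq_one_left (gen_mul_self hlab a)

theorem gen_inl_braid {i j : Fin 5} (hij : i ≠ j) :
    gen hlab (.inl i) * gen hlab (.inl j) * gen hlab (.inl i) =
      gen hlab (.inl j) * gen hlab (.inl i) * gen hlab (.inl j) := by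
  refine Prod.ext (refl_braid (wall_inl_root_inl hij) (wall_inl_root_inl hij.symm)) ?_
  refine Equiv.ext fun t => Prod.ext rfl ?_
  exact matching_braid hlab hij t.2

theorem gen_inl_inr_comm {i k : Fin 5} (hik : i ≠ k) :
    gen hlab (.inl i) * gen hlab (.inr k) = gen hlab (.inr k) * gen hlab (.inl i) :=
  Prod.ext (refl_comm (wall_inl_root_inr hik) (wall_inr_root_inl hik.symm)) rfl

/-- Two facets whose reflections are both needed at some point generate a finite dihedral group. -/
theorem gen_pair {a b : Letter} (hab : a ≠ b) {y : H4} (ha : wall a (y : E5) ≤ 0)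
    (hb : wall b (y : E5) ≤ 0) :
    (wall a (root b) = -1 ∧ wall b (root a) = -1 ∧
      gen hlab a * gen hlab b * gen hlab a = gen hlab b * gen hlab a * gen hlab b) ∨
    (wall a (root b) = 0 ∧ wall b (root a) = 0 ∧
      gen hlab a * gen hlab b = gen hlab b * gen hlab a) := by
  rcases a with i | i <;> rcases b with j | j
  · have hij : i ≠ j := fun h => hab (h ▸ rfl)
    exact .inl ⟨wall_inl_root_inl hij, wall_inl_root_inl hij.symm, gen_inl_braid hlab hij⟩
  · rcases eq_or_ne i j with rfl | hij
    · exact (not_wall_inl_inr_nonpos y i ha hb).elim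
    · exact .inr ⟨wall_inl_root_inr hij, wall_inr_root_inl hij.symm, gen_inl_inr_comm hlab hij⟩
  · rcases eq_or_ne i j with rfl | hij
    · exact (not_wall_inl_inr_nonpos y i hb ha).elim
    · exact .inr ⟨wall_inr_root_inl hij, wall_inl_root_inr hij.symm,
        (gen_inl_inr_comm hlab hij.symm).symm⟩
  · have hij : i ≠ j := fun h => hab (h ▸ rfl)
    exact (not_wall_inr_inr_nonpos y hij ha hb).elim

end

/-! ### The developing map -/

/-- The copy of the polytope with index `t`. -/
def tile (lab : Sym2 (Fin 6) → Fin 5) (t : Tile) (x : polytope) : MPrime lab :=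
  MPrime.tile lab t.1 t.2 x

section

variable {lab : Sym2 (Fin 6) → Fin 5} (hlab : IsProperLabelling lab)

theorem tile_cross {a : Letter} {x : polytope} (h : wall a (x : H4) = 0) (t : Tile) :
    tile lab (cross hlab a t) x = tile lab t x := by
  obtain ⟨w, u⟩ := t
  rcases a with i | i
  · have : Glue.mk lab facet (matching hlab i u) x = Glue.mk lab facet u x := by
      refine (Quot.sound (GlueRel.glue u _ x (matching_ne hlab i u).symm ?_)).symm
      rw [lab_matching hlab]
      exact h
    exact congrArg (Glue.mk lab (Block.bdry lab) w) this
  · refine (Quot.sound (GlueRel.glue w _ _ (matching_ne hlab i w).symm ?_)).symm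
    rw [lab_matching hlab]
    exact ⟨u, x, mem_facet'.2 h, rfl⟩

theorem tile_surjective (z : MPrime lab) : ∃ t x, tile lab t x = z := by
  obtain ⟨⟨w, b⟩, rfl⟩ := Quot.exists_rep z
  obtain ⟨⟨u, x⟩, rfl⟩ := Quot.exists_rep b
  exact ⟨(w, u), x, rfl⟩

include hlab in
/-- Maps out of `M'` are compatible families of maps on the tiles. -/
theorem exists_desc {Y : Type*} (f : Tile → polytope → Y)
    (hf : ∀ a t (x : polytope), wall a (x : H4) = 0 → f (cross hlab a t) x = f t x) :
    ∃ F : MPrime lab → Y, ∀ t x, F (tile lab t x) = f t x := by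
  let F1 : Fin 6 → Block lab → Y := fun w => Quot.lift (fun ux => f (w, ux.1) ux.2) <| by
    rintro _ _ ⟨u, v, x, huv, hx⟩
    have := hf (.inl (lab s(u, v))) (w, u) x hx
    rw [cross_inl, matching_lab hlab huv] at this
    exact this.symm
  refine ⟨Quot.lift (fun wb => F1 wb.1 wb.2) ?_, fun t x => rfl⟩
  rintro _ _ ⟨w, w', b, hw, u, x, hx, rfl⟩
  have := hf (.inr (lab s(w, w'))) (w, u) x (mem_facet'.1 hx)
  rw [cross_inr, matching_lab hlab hw] at this
  exact this.symm

open Classical in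
/-- The developing map of `M'` that is the identity on the tile `t`: a point outside the polytope
is reflected towards it, and the tile is changed accordingly. -/
noncomputable def dev (t : Tile) (y : H4) : MPrime lab :=
  -- The wall is an arbitrary choice; `dev_of_neg` shows that any other one gives the same result.
  if h : ∃ a, wall a (y : E5) < 0 then
    dev (cross hlab h.choose t) (refl h.choose • y)
  else tile lab t ⟨y, mem_polytope.2 fun a => not_lt.1 fun h' => h ⟨a, h'⟩⟩
termination_by depth y
decreasing_by exact depth_refl_lt h.choose_spec

theorem dev_coe (t : Tile) (x : polytope) : dev hlab t x = tile lab t x := by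
  rw [dev, dif_neg]
  rintro ⟨a, ha⟩
  exact absurd (mem_polytope.1 x.2 a) (not_le.2 ha)

theorem exists_dev_eq {y : H4} (h : ∃ a, wall a (y : E5) < 0) :
    ∃ a, wall a (y : E5) < 0 ∧ ∀ t, dev hlab t y = dev hlab (cross hlab a t) (refl a • y) :=
  ⟨h.choose, h.choose_spec, fun t => by rw [dev, dif_pos h]⟩

/-- A diamond argument by induction on the depth. If y is behind the walls a and b, the two routes
can be prolonged to the two words of the relation aba = bab or ab = ba. Since the mixed entries are
-1 or 0, each further reflection is again in a wall that the point is behind, so the induction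
hypothesis applies. -/
theorem dev_of_neg {a : Letter} {y : H4} (h : wall a (y : E5) < 0) (t : Tile) :
    dev hlab t y = dev hlab (cross hlab a t) (refl a • y) := by
  induction hn : depth y using Nat.strong_induction_on generalizing y t a with
  | _ n ih =>
  subst hn
  obtain ⟨b, hb, hdev⟩ := exists_dev_eq hlab ⟨a, h⟩
  rcases eq_or_ne a b with rfl | hab
  · exact hdev t
  rw [hdev]
  have da := depth_refl_lt h
  have db := depth_refl_lt hb
  rcases gen_pair hlab hab h.le hb.le with ⟨h1, h2, h3⟩ | ⟨h1, h2, h3⟩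
  · have w1 : wall b ((refl a • y : H4) : E5) < 0 := by
      rw [coe_smul, wall_refl, h2]; linarith
    have w2 : wall a ((refl b • y : H4) : E5) < 0 := by
      rw [coe_smul, wall_refl, h1]; linarith
    have w3 : wall a ((refl b • refl a • y : H4) : E5) < 0 := by
      rw [coe_smul, wall_refl, coe_smul, wall_refl, wall_refl, wall_root, h1, h2]; linarith
    have w4 : wall b ((refl a • refl b • y : H4) : E5) < 0 := by
      rw [coe_smul, wall_refl, coe_smul, wall_refl, wall_refl, wall_root, h1, h2]; linarith
    rw [ih _ da w1 _ rfl, ih _ db w2 _ rfl, ih _ ((depth_refl_lt w1).trans da) w3 _ rfl,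
      ih _ ((depth_refl_lt w2).trans db) w4 _ rfl]
    congr 1
    · exact (Equiv.ext_iff.1 (Prod.ext_iff.1 h3).2 t).symm
    · simp only [smul_smul, ← mul_assoc]
      exact congrArg (· • y) (Prod.ext_iff.1 h3).1.symm
  · have w1 : wall b ((refl a • y : H4) : E5) < 0 := by
      rw [coe_smul, wall_refl, h2]; linarith
    have w2 : wall a ((refl b • y : H4) : E5) < 0 := by
      rw [coe_smul, wall_refl, h1]; linarith
    rw [ih _ da w1 _ rfl, ih _ db w2 _ rfl]
    congr 1
    · exact Equiv.ext_iff.1 (Prod.ext_iff.1 h3).2 t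
    · simp only [smul_smul]
      exact congrArg (· • y) (Prod.ext_iff.1 h3).1

/-- Inside the polytope this is the gluing. Outside it, a reflection towards the polytope is moved
past the crossing by the same relations; in the braid case, aba = bab turns the wall on which y lies
from a to b. -/
theorem dev_of_zero {a : Letter} {y : H4} (h : wall a (y : E5) = 0) (t : Tile) :
    dev hlab (cross hlab a t) y = dev hlab t y := by
  induction hn : depth y using Nat.strong_induction_on generalizing y t a with
  | _ n ih =>
  subst hn
  by_cases hy : ∃ b, wall b (y : E5) < 0
  · obtain ⟨b, hb⟩ := hy
    have hab : a ≠ b := by rintro rfl; exact hb.ne h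
    have db := depth_refl_lt hb
    rw [dev_of_neg hlab hb, dev_of_neg hlab hb t]
    rcases gen_pair hlab hab h.le hb.le with ⟨h1, h2, h3⟩ | ⟨h1, h2, h3⟩
    · have w2 : wall a ((refl b • y : H4) : E5) < 0 := by
        rw [coe_smul, wall_refl, h1]; linarith
      have w4 : wall b ((refl a • refl b • y : H4) : E5) = 0 := by
        rw [coe_smul, wall_refl, coe_smul, wall_refl, wall_refl, wall_root, h1, h2, h]; ring
      rw [dev_of_neg hlab w2, dev_of_neg hlab w2 (cross hlab b t),
        ← ih _ ((depth_refl_lt w2).trans db) w4 (cross hlab a (cross hlab b t)) rfl]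
      congr 1
      exact Equiv.ext_iff.1 (Prod.ext_iff.1 h3).2 t
    · have w2 : wall a ((refl b • y : H4) : E5) = 0 := by
        rw [coe_smul, wall_refl, h1, h]; ring
      rw [← ih _ db w2 (cross hlab b t) rfl]
      congr 1
      exact (Equiv.ext_iff.1 (Prod.ext_iff.1 h3).2 t).symm
  · push Not at hy
    have hx : y ∈ polytope := mem_polytope.2 hy
    have := tile_cross hlab (x := ⟨y, hx⟩) h t
    rwa [← dev_coe hlab, ← dev_coe hlab] at this

theorem dev_cross_refl (a : Letter) (t : Tile) (y : H4) :
    dev hlab (cross hlab a t) (refl a • y) = dev hlab t y := by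
  rcases lt_trichotomy (wall a (y : E5)) 0 with h | h | h
  · exact (dev_of_neg hlab h t).symm
  · rw [refl_smul_of_wall_eq_zero h, dev_of_zero hlab h]
  · have h' : wall a ((refl a • y : H4) : E5) < 0 := by
      rw [coe_smul, wall_refl_self]; linarith
    rw [dev_of_neg hlab h', smul_smul, refl_mul_self, one_smul, cross_cross]

/-- The developing maps are equivariant. -/
theorem dev_smul {g : hypIso × Equiv.Perm Tile} (hg : g ∈ tileGroup hlab) (t : Tile) (y : H4) :
    dev hlab (g.2 t) (g.1 • y) = dev hlab t y := by
  induction hg using Subgroup.closure_induction generalizing t y with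
  | mem g hg =>
    obtain ⟨a, rfl⟩ := hg
    exact dev_cross_refl hlab a t y
  | one => rfl
  | mul g h _ _ h1 h2 =>
    rw [Prod.snd_mul, Prod.fst_mul, Equiv.Perm.mul_apply, mul_smul, h1, h2]
  | inv g _ h1 =>
    have := h1 (g⁻¹.2 t) (g⁻¹.1 • y)
    simpa using this.symm

end

/-! ### Subgroups generated by reflections -/

section

variable {lab : Sym2 (Fin 6) → Fin 5} (hlab : IsProperLabelling lab)

/-- The subgroup generated by the reflections in a set of facets. -/
noncomputable def parabolic (L : Set Letter) : Subgroup (hypIso × Equiv.Perm Tile) :=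
  Subgroup.closure (gen hlab '' L)

theorem tileGroup_eq_parabolic : tileGroup hlab = parabolic hlab univ := by
  rw [parabolic, image_univ, tileGroup]

variable {hlab} in
@[elab_as_elim]
theorem parabolic_induction {L : Set Letter}
    {p : (g : hypIso × Equiv.Perm Tile) → g ∈ parabolic hlab L → Prop} (one : p 1 (one_mem _))
    (mul : ∀ a (ha : a ∈ L) g (hg : g ∈ parabolic hlab L), p g hg →
      p (gen hlab a * g) (mul_mem (Subgroup.subset_closure ⟨a, ha, rfl⟩) hg))
    {g : hypIso × Equiv.Perm Tile} (hg : g ∈ parabolic hlab L) : p g hg := by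
  induction hg using Subgroup.closure_induction_left with
  | one => exact one
  | mul_left x hx y hy h =>
    obtain ⟨a, ha, rfl⟩ := hx
    exact mul a ha y hy h
  | inv_mul_cancel x hx y hy h =>
    obtain ⟨a, ha, rfl⟩ := hx
    simpa only [gen_inv] using mul a ha y hy h

theorem gen_mem_parabolic {L : Set Letter} {a : Letter} (ha : a ∈ L) :
    gen hlab a ∈ parabolic hlab L := Subgroup.subset_closure ⟨a, ha, rfl⟩

theorem parabolic_mono {L L' : Set Letter} (h : L ⊆ L') : parabolic hlab L ≤ parabolic hlab L' :=
  Subgroup.closure_mono (image_mono h)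

theorem parabolic_le (L : Set Letter) : parabolic hlab L ≤ tileGroup hlab := by
  rw [tileGroup_eq_parabolic]
  exact parabolic_mono hlab (subset_univ L)

theorem parabolic_fixes {L : Set Letter} {x : E5} (h : ∀ a ∈ L, wall a x = 0)
    {g : hypIso × Equiv.Perm Tile} (hg : g ∈ parabolic hlab L) : g.1.1 x = x := by
  induction hg using parabolic_induction with
  | one => rfl
  | mul a ha g _ ih =>
    change (refl a).1 (g.1.1 x) = x
    rw [ih, refl_apply_of_wall_eq_zero (h a ha)]

/-- Points of `V` can be moved into the polytope with the reflections in `L`, if `V` is invariant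
under the reflections that are needed. -/
theorem exists_smul_mem_polytope {V : Set H4} {L : Set Letter}
    (hV : ∀ z ∈ V, ∀ a, wall a (z : E5) < 0 → a ∈ L ∧ refl a • z ∈ V) {z : H4} (hz : z ∈ V) :
    ∃ g ∈ parabolic hlab L, g.1 • z ∈ V ∧ g.1 • z ∈ polytope := by
  induction hn : depth z using Nat.strong_induction_on generalizing z with
  | _ n ih =>
  subst hn
  by_cases h : ∃ a, wall a (z : E5) < 0
  · obtain ⟨a, ha⟩ := h
    obtain ⟨g, hg, h1, h2⟩ := ih _ (depth_refl_lt ha) (hV z hz a ha).2 rfl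
    refine ⟨g * gen hlab a, mul_mem hg (gen_mem_parabolic hlab (hV z hz a ha).1), ?_⟩
    rw [Prod.fst_mul, mul_smul]
    exact ⟨h1, h2⟩
  · push Not at h
    exact ⟨1, one_mem _, hz, mem_polytope.2 h⟩

theorem exists_tileGroup_smul_mem (z : H4) : ∃ g ∈ tileGroup hlab, g.1 • z ∈ polytope := by
  obtain ⟨g, hg, -, h⟩ := exists_smul_mem_polytope hlab (V := univ) (L := univ)
    (fun _ _ _ _ => ⟨mem_univ _, mem_univ _⟩) (mem_univ z)
  exact ⟨g, parabolic_le hlab _ hg, h⟩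

/-! ### The fibres of the developing map -/

/-- To separate orbits, send the point x of the tile t to the orbit of (t, x). A generator swaps two
tiles and fixes the points of their common facet, so this descends to M'; composed with the
developing map it is the orbit map. -/
theorem dev_eq_iff {t t' : Tile} {y y' : H4} :
    dev hlab t y = dev hlab t' y' ↔ ∃ g ∈ tileGroup hlab, g.2 t = t' ∧ g.1 • y = y' := by
  constructor
  · let S : Setoid (Tile × H4) :=
      { r := fun p q => ∃ g ∈ tileGroup hlab, g.2 p.1 = q.1 ∧ g.1 • p.2 = q.2
        iseqv :=
          { refl := fun p => ⟨1, one_mem _, rfl, one_smul _ _⟩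
            symm := by
              rintro p q ⟨g, hg, h1, h2⟩
              exact ⟨g⁻¹, inv_mem hg, by rw [← h1]; simp, by rw [← h2]; simp⟩
            trans := by
              rintro p q r ⟨g, hg, h1, h2⟩ ⟨g', hg', h1', h2'⟩
              exact ⟨g' * g, mul_mem hg' hg, by rw [← h1', ← h1]; simp,
                by rw [← h2', ← h2, Prod.fst_mul, mul_smul]⟩ } }
    obtain ⟨F, hF⟩ := exists_desc hlab (fun t x => (Quotient.mk S (t, (x : H4)))) <| by
      intro a t x hx
      refine Quotient.sound ⟨gen hlab a, gen_mem hlab a, cross_cross hlab a t, ?_⟩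
      exact refl_smul_of_wall_eq_zero hx
    have key : ∀ t y, F (dev hlab t y) = Quotient.mk S (t, y) := by
      intro t y
      obtain ⟨g, hg, h⟩ := exists_tileGroup_smul_mem hlab y
      rw [← dev_smul hlab hg t y, dev_coe hlab (g.2 t) ⟨g.1 • y, h⟩, hF]
      exact Quotient.sound ⟨g⁻¹, inv_mem hg, by simp, by simp⟩
    intro h
    have := congrArg F h
    rw [key, key] at this
    exact Quotient.exact this
  · rintro ⟨g, hg, rfl, rfl⟩
    exact (dev_smul hlab hg t y).symm

/-- The polytope is a strict fundamental domain. -/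
theorem smul_eq_of_mem_polytope {g : hypIso × Equiv.Perm Tile} (hg : g ∈ tileGroup hlab) {x : H4}
    (hx : x ∈ polytope) (hgx : g.1 • x ∈ polytope) : g.1 • x = x := by
  -- Forgetting the tile folds M' back onto the polytope.
  obtain ⟨F, hF⟩ := exists_desc hlab (fun _ x => x) (fun _ _ _ _ => rfl)
  have h := congrArg F (dev_smul hlab hg 0 x)
  rw [dev_coe hlab _ ⟨_, hgx⟩, dev_coe hlab _ ⟨_, hx⟩, hF, hF] at h
  exact congrArg Subtype.val h

include hlab in
theorem eq_of_tile_eq {t t' : Tile} {x : polytope} (hx : ∀ a, 0 < wall a (x : H4))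
    (h : tile lab t x = tile lab t' x) : t = t' := by
  classical
  -- Interior points remember their tile; boundary points go to `none`, which makes the map
  -- compatible with the gluing.
  obtain ⟨F, hF⟩ := exists_desc hlab
    (fun t x => if ∀ a, 0 < wall a (x : H4) then some t else none) <| by
      intro a t x hx
      have : ¬ ∀ a, 0 < wall a (x : H4) := fun h => (h a).ne' hx
      rw [if_neg this, if_neg this]
  have h1 := congrArg F h
  rw [hF, hF, if_pos hx, if_pos hx] at h1
  exact Option.some_injective _ h1

theorem snd_apply_eq_of_interior {g : hypIso × Equiv.Perm Tile} (hg : g ∈ tileGroup hlab) {x : H4}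
    (hx : ∀ a, 0 < wall a (x : E5)) (hgx : g.1 • x = x) (t : Tile) : g.2 t = t := by
  have hx' : x ∈ polytope := mem_polytope.2 fun a => (hx a).le
  have h := dev_smul hlab hg t x
  rw [hgx, dev_coe hlab _ ⟨x, hx'⟩, dev_coe hlab _ ⟨x, hx'⟩] at h
  exact eq_of_tile_eq hlab hx h

/-! ### Proper discontinuity -/

theorem tileGroup_intLattice {g : hypIso × Equiv.Perm Tile} (hg : g ∈ tileGroup hlab) {v : E5}
    (hv : v ∈ intLattice) : g.1.1 v ∈ intLattice := by
  rw [tileGroup_eq_parabolic] at hg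
  induction hg using parabolic_induction with
  | one => exact hv
  | mul a _ g _ ih => exact refl_mem_intLattice a ih

/-- An element is determined by its permutation and by the images of the five spanning integral
timelike vectors (1, …, 1) + eᵢ. Products with y are preserved, so bounds on the heights of y and of
its image bound the heights of these five images. -/
theorem finite_tileGroup_bounded (C : ℝ) :
    {g ∈ tileGroup hlab | ∃ y : H4, ht (y : E5) ≤ C ∧ ht ((g.1 • y : H4) : E5) ≤ C}.Finite := by
  let c : Fin 5 → E5 := fun i => (fun _ => 1 : E5) + Pi.single i 1
  have hch : ∀ i, ht (c i) = 6 := by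
    intro i
    simp only [c, map_add, ht_ones, ht_single]
    norm_num
  have hc : ∀ i, lor (c i) (c i) = -10 := by
    intro i
    have := hch i
    simp only [c] at this ⊢
    rw [lor_add_right, lor_ones, lor_single, this, Pi.add_apply, Pi.single_eq_same]
    norm_num
  have hcz : ∀ i, c i ∈ intLattice := fun i =>
    ⟨fun j => 1 + if j = i then 1 else 0, fun j => by simp [c, Pi.single_apply]⟩
  let F : hypIso × Equiv.Perm Tile → (Fin 5 → E5) × Equiv.Perm Tile := fun g =>
    (fun i => g.1.1 (c i), g.2)
  have hF : Function.Injective F := by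
    intro g h hgh
    have h1 : ∀ i, g.1.1 (c i) = h.1.1 (c i) := fun i => congrFun (Prod.ext_iff.1 hgh).1 i
    refine Prod.ext (hypIso_ext fun x => ?_) (Prod.ext_iff.1 hgh).2
    have hones : (fun _ => 1 : E5) = (1 / 6 : ℝ) • ∑ i, c i := by
      ext j
      simp [c, Finset.sum_add_distrib, Pi.single_apply]
      norm_num
    have h2 : g.1.1 (fun _ => 1) = h.1.1 (fun _ => 1) := by
      rw [hones, map_smul, map_smul, map_sum, map_sum]
      simp only [h1]
    have hx : x = ∑ i, x i • (c i - fun _ => 1) := by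
      ext j
      simp [c, Pi.single_apply]
    rw [hx, map_sum, map_sum]
    simp only [map_smul, map_sub, h1, h2]
  refine Set.Finite.of_finite_image (f := F) ?_ hF.injOn
  -- The vectors `c i` have height 6: `neg_lor_le` bounds their products with y by 3/5 · 6C, and
  -- `ht_le_of_causal` then bounds the heights of their images.
  refine ((Set.Finite.pi' fun _ : Fin 5 => finite_causal_intLattice (2 * C * (3 / 5 * (6 * C)))).prod
    (Set.finite_univ)).subset ?_
  rintro _ ⟨g, ⟨hg, y, hy, hgy⟩, rfl⟩
  refine ⟨fun i => ⟨tileGroup_intLattice hlab hg (hcz i), ?_, ?_, ?_⟩, mem_univ _⟩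
  · change lor (g.1.1 (c i)) (g.1.1 (c i)) ≤ 0
    rw [lor_map, hc]; norm_num
  · exact (ht_map_pos _ (by rw [hc]; norm_num) (by rw [hch]; norm_num)).le
  · have h1 : lor (g.1.1 (c i)) (g.1.1 (c i)) ≤ 0 := by rw [lor_map, hc]; norm_num
    have h2 := ht_le_of_causal h1
      (ht_map_pos _ (by rw [hc]; norm_num) (by rw [hch]; norm_num)).le (g.1 • y)
    rw [coe_smul, lor_map] at h2
    have h3 := neg_lor_le (x := c i) (y := y) (by rw [hc]; norm_num) (by rw [hch]; norm_num)
      (by rw [lor_coe_self]; norm_num) (ht_pos y).le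
    rw [hch] at h3
    have h4 := ht_pos (g.1 • y)
    have h5 := ht_pos y
    rw [coe_smul] at h4 hgy
    have h6 : 3 / 5 * (6 * ht (y : E5)) ≤ 3 / 5 * (6 * C) := by linarith
    refine h2.trans (mul_le_mul (by linarith) (h3.trans h6) ?_ (by linarith))
    exact le_of_not_gt fun hneg => by
      have := lor_neg_of_mem_timeCone (x := c i) (by rw [hc]; norm_num) (by rw [hch]; norm_num)
        (hyperboloid_subset_timeCone y.2)
      linarith

theorem finite_stabilizer (x : H4) : {g ∈ tileGroup hlab | g.1 • x = x}.Finite :=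
  (finite_tileGroup_bounded hlab (ht (x : E5))).subset fun g hg =>
    ⟨hg.1, x, le_rfl, by rw [hg.2]⟩

theorem continuous_linearMap_coe (f : E5 →ₗ[ℝ] ℝ) : Continuous fun z : H4 => f z :=
  f.continuous_of_finiteDimensional.comp continuous_subtype_val

/-- Near the two points the heights are bounded, so only finitely many group elements matter, and
each that does not take y to y' is excluded by shrinking the neighbourhoods. -/
theorem exists_nhds_smul (y y' : H4) : ∃ U ∈ 𝓝 y, ∃ V ∈ 𝓝 y', ∀ g ∈ tileGroup hlab, ∀ z ∈ U,
    g.1 • z ∈ V → g.1 • y = y' := by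
  set C := max (ht (y : E5)) (ht (y' : E5)) + 1
  have h1 : ∀ᶠ p in 𝓝 y ×ˢ 𝓝 y', ∀ g ∈ {g ∈ tileGroup hlab | ∃ y : H4, ht (y : E5) ≤ C ∧
      ht ((g.1 • y : H4) : E5) ≤ C}, g.1 • y ≠ y' → g.1 • p.1 ≠ p.2 := by
    rw [Filter.eventually_all_finite (finite_tileGroup_bounded hlab C)]
    intro g _
    by_cases hg : g.1 • y = y'
    · exact Eventually.of_forall fun p h => (h hg).elim
    · rw [← nhds_prod_eq]
      have hc : Continuous fun p : H4 × H4 => g.1 • p.1 := continuous_fst.const_smul g.1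
      have : IsOpen {p : H4 × H4 | g.1 • p.1 ≠ p.2} := isOpen_ne_fun hc continuous_snd
      filter_upwards [this.mem_nhds hg] with p hp _ using hp
  have h2 : ∀ᶠ z : H4 in 𝓝 y, ht (z : E5) < C :=
    (continuous_linearMap_coe ht).continuousAt.eventually_lt continuousAt_const
      ((le_max_left _ _).trans_lt (lt_add_one _))
  have h3 : ∀ᶠ z : H4 in 𝓝 y', ht (z : E5) < C :=
    (continuous_linearMap_coe ht).continuousAt.eventually_lt continuousAt_const
      ((le_max_right _ _).trans_lt (lt_add_one _))
  obtain ⟨pa, ha, pb, hb, hab⟩ := Filter.eventually_prod_iff.1 (h1.and (h2.prod_mk h3))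
  refine ⟨_, ha, _, hb, fun g hg z hz hgz => ?_⟩
  obtain ⟨h4, h5, h6⟩ := hab hz hgz
  by_contra hne
  exact h4 g ⟨hg, z, h5.le, h6.le⟩ hne rfl

/-! ### The star of a point -/

/-- V requires the walls that miss x to stay positive, and is made invariant by imposing this on all
images under the finite stabiliser of x. Points of V are then only behind walls through x, so the
descent into the polytope uses no other reflections. -/
theorem exists_star {x : H4} (hx : x ∈ polytope) : ∃ V ∈ 𝓝 x,
    (∀ g ∈ tileGroup hlab, g.1 • x = x → ∀ z ∈ V, g.1 • z ∈ V) ∧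
    ∀ z ∈ V, ∃ g ∈ parabolic hlab {a | wall a (x : E5) = 0}, g.1 • z ∈ polytope := by
  set V : Set H4 := {z | ∀ g ∈ {g ∈ tileGroup hlab | g.1 • x = x}, ∀ a, 0 < wall a (x : E5) →
    0 < wall a ((g.1 • z : H4) : E5)}
  have hinv : ∀ g ∈ tileGroup hlab, g.1 • x = x → ∀ z ∈ V, g.1 • z ∈ V := by
    rintro g hg hgx z hz h ⟨hh, hhx⟩ a ha
    have := hz (h * g) ⟨mul_mem hh hg, by rw [Prod.fst_mul, mul_smul, hgx, hhx]⟩ a ha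
    rwa [Prod.fst_mul, mul_smul] at this
  refine ⟨V, ?_, hinv, fun z hz => ?_⟩
  · have : ∀ᶠ z in 𝓝 x, ∀ g ∈ {g ∈ tileGroup hlab | g.1 • x = x}, ∀ a, 0 < wall a (x : E5) →
        0 < wall a ((g.1 • z : H4) : E5) := by
      rw [Filter.eventually_all_finite (finite_stabilizer hlab x)]
      rintro g ⟨_, hgx⟩
      rw [Filter.eventually_all]
      intro a
      by_cases ha : 0 < wall a (x : E5)
      · have hc : Continuous fun z : H4 => wall a ((g.1 • z : H4) : E5) :=
          (continuous_linearMap_coe (wall a)).comp (continuous_const_smul g.1)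
        have h0 : 0 < wall a ((g.1 • x : H4) : E5) := by rwa [hgx]
        filter_upwards [continuousAt_const.eventually_lt hc.continuousAt h0] with z hz _ using hz
      · exact Eventually.of_forall fun z h => (ha h).elim
    exact this
  · have hL : ∀ z ∈ V, ∀ a, wall a (z : E5) < 0 →
        a ∈ {a | wall a (x : E5) = 0} ∧ refl a • z ∈ V := by
      intro z hz a ha
      have h0 : wall a (x : E5) = 0 := by
        refine le_antisymm (not_lt.1 fun h => ?_) (mem_polytope.1 hx a)
        have := hz 1 ⟨one_mem _, one_smul _ _⟩ a h
        rw [Prod.fst_one, one_smul] at this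
        linarith
      exact ⟨h0, hinv _ (gen_mem hlab a) (refl_smul_of_wall_eq_zero h0) z hz⟩
    obtain ⟨g, hg, -, h⟩ := exists_smul_mem_polytope hlab hL hz
    exact ⟨g, hg, h⟩

/-- A small displacement towards the barycentre makes all walls positive. -/
theorem frequently_interior {x : H4} (hx : x ∈ polytope) :
    ∃ᶠ z : H4 in 𝓝 x, ∀ a, 0 < wall a (z : E5) := by
  intro h
  obtain ⟨δ, ⟨z, hz, c, hc, hzc⟩, hδ⟩ := (((eventually_displace h fun _ => 1).filter_mono
    (nhdsWithin_le_nhds (s := Ioi 0))).and self_mem_nhdsWithin).exists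
  refine hz fun a => ?_
  rw [hzc, map_smul, map_add, map_smul, smul_eq_mul, smul_eq_mul]
  have h1 : 0 < wall a (fun _ => 1) := by
    rcases a with i | i
    · simp
    · simp; norm_num
  have h2 := mem_polytope.1 hx a
  have : 0 < δ * wall a fun _ => 1 := mul_pos hδ h1
  exact mul_pos hc (by linarith)

theorem linearMap_eq_of_interior {x : H4} (hx : x ∈ polytope) {f g : E5 →ₗ[ℝ] E5}
    (h : ∀ᶠ z : H4 in 𝓝 x, (∀ a, 0 < wall a (z : E5)) → f z = g z) : f = g := by
  obtain ⟨z, hz, hzz⟩ := ((frequently_interior hx).and_eventually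
    (eventually_eventually_nhds.2 h)).exists
  have : ∀ᶠ y : H4 in 𝓝 z, ∀ a, 0 < wall a (y : E5) := by
    rw [Filter.eventually_all]
    exact fun a => continuousAt_const.eventually_lt
      (continuous_linearMap_coe (wall a)).continuousAt (hz a)
  exact linearMap_eq_of_eventually_eq ((hzz.and this).mono fun y hy => hy.1 hy.2)

/-- At most two F and at most one F' pass through a point. They are padded to exactly two and one
with distinct indices, so that a single finite group, the symmetric group S₃ times a group of order
two, covers all cases. -/
theorem exists_facets (x : H4) : ∃ i j k : Fin 5, i ≠ j ∧ k ≠ i ∧ k ≠ j ∧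
    {a | wall a (x : E5) = 0} ⊆ {.inl i, .inl j, .inr k} := by
  classical
  set A : Finset (Fin 5) := Finset.univ.filter fun i => (x : E5) i = 0
  have hA : A.card ≤ 2 := by
    by_contra! h
    obtain ⟨i, j, k, hi, hj, hk, hij, hik, hjk⟩ := Finset.two_lt_card_iff.1 h
    simp only [A, Finset.mem_filter, Finset.mem_univ, true_and] at hi hj hk
    exact not_three_wall_inl_eq_zero x hij hik hjk hi hj hk
  obtain ⟨k, hkA, hk⟩ : ∃ k, k ∉ A ∧ ∀ l, wall (.inr l) (x : E5) = 0 → l = k := by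
    by_cases hB : ∃ k, wall (.inr k) (x : E5) = 0
    · obtain ⟨k, hk⟩ := hB
      refine ⟨k, fun h => ?_, fun l hl => ?_⟩
      · simp only [A, Finset.mem_filter, Finset.mem_univ, true_and] at h
        exact not_wall_inl_inr_nonpos x k h.le hk.le
      · by_contra hlk
        exact not_wall_inr_inr_nonpos x hlk hl.le hk.le
    · push Not at hB
      obtain ⟨k, hk⟩ : ∃ k, k ∉ A := by
        by_contra! h
        have : A = Finset.univ := Finset.eq_univ_of_forall h
        rw [this] at hA
        simp at hA
      exact ⟨k, hk, fun l hl => (hB l hl).elim⟩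
  obtain ⟨A', hA1, hA2, hA3⟩ := Finset.exists_subsuperset_card_eq (s := A) (t := {k}ᶜ) (n := 2)
    (fun i hi => by
      rw [Finset.mem_compl, Finset.mem_singleton]
      rintro rfl
      exact hkA hi) hA (by rw [Finset.card_compl]; simp)
  obtain ⟨i, j, hij, rfl⟩ := Finset.card_eq_two.1 hA3
  have hi : k ≠ i := fun h => by have := @hA2 i (by simp); simp [h] at this
  have hj : k ≠ j := fun h => by have := @hA2 j (by simp); simp [h] at this
  refine ⟨i, j, k, hij, hi, hj, ?_⟩
  rintro (l | l) hl
  · have : l ∈ A := by simpa [A] using hl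
    have := hA1 this
    simp only [Finset.mem_insert, Finset.mem_singleton] at this
    rcases this with rfl | rfl <;> simp
  · rw [hk l hl]; simp

/-- A finite group generated by reflections in facets acts freely on the tiles. -/
theorem eq_one_of_mem_dihedral {i j k : Fin 5} (hij : i ≠ j) (hki : k ≠ i) (hkj : k ≠ j)
    {g : hypIso × Equiv.Perm Tile} (hg : g ∈ parabolic hlab {.inl i, .inl j, .inr k}) {t : Tile}
    (ht : g.2 t = t) : g = 1 := by
  set a := gen hlab (.inl i)
  set b := gen hlab (.inl j)
  set c := gen hlab (.inr k)
  have ha : ∀ x, a * (a * x) = x := fun x => by rw [← mul_assoc, gen_mul_self, one_mul]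
  have hb : ∀ x, b * (b * x) = x := fun x => by rw [← mul_assoc, gen_mul_self, one_mul]
  have hc : c * c = 1 := gen_mul_self hlab _
  have hab : ∀ x, b * (a * (b * x)) = a * (b * (a * x)) := fun x => by
    rw [← mul_assoc, ← mul_assoc, ← gen_inl_braid hlab hij, mul_assoc, mul_assoc]
  have hca : ∀ x, c * (a * x) = a * (c * x) := fun x => by
    rw [← mul_assoc, ← gen_inl_inr_comm hlab hki.symm, mul_assoc]
  have hcb : ∀ x, c * (b * x) = b * (c * x) := fun x => by
    rw [← mul_assoc, ← gen_inl_inr_comm hlab hkj.symm, mul_assoc]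
  -- The normal form of the elements: one of the six words in a and b, times 1 or c.
  have key : ∃ s, (s = 1 ∨ s = c) ∧ (g = s ∨ g = a * s ∨ g = b * s ∨ g = a * (b * s) ∨
      g = b * (a * s) ∨ g = a * (b * (a * s))) := by
    clear ht
    induction hg using parabolic_induction with
    | one => exact ⟨1, .inl rfl, .inl rfl⟩
    | mul l hl g _ ih =>
      obtain ⟨s, hs, h⟩ := ih
      rcases hl with rfl | rfl | rfl
      · refine ⟨s, hs, ?_⟩
        change a * g = _ ∨ a * g = _ ∨ a * g = _ ∨ a * g = _ ∨ a * g = _ ∨ a * g = _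
        rcases h with rfl | rfl | rfl | rfl | rfl | rfl <;> simp [ha]
      · refine ⟨s, hs, ?_⟩
        change b * g = _ ∨ b * g = _ ∨ b * g = _ ∨ b * g = _ ∨ b * g = _ ∨ b * g = _
        rcases h with rfl | rfl | rfl | rfl | rfl | rfl <;> simp [hb, ha, hab]
      · refine ⟨c * s, ?_, ?_⟩
        · rcases hs with rfl | rfl
          · simp
          · simp [hc]
        · change c * g = _ ∨ c * g = _ ∨ c * g = _ ∨ c * g = _ ∨ c * g = _ ∨ c * g = _
          rcases h with rfl | rfl | rfl | rfl | rfl | rfl <;> simp [hca, hcb]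
  have ea : ∀ x t, (a * x).2 t = ((x.2 t).1, matching hlab i (x.2 t).2) := fun _ _ => rfl
  have eb : ∀ x t, (b * x).2 t = ((x.2 t).1, matching hlab j (x.2 t).2) := fun _ _ => rfl
  have ec : ∀ t, c.2 t = (matching hlab k t.1, t.2) := fun _ => rfl
  have n1 := matching_ne hlab i
  have n2 := matching_ne hlab j
  have n3 := matching_ne_matching hlab hij
  have m1 := matching_matching hlab i
  have m2 := matching_matching hlab j
  -- Words with c move the first index of the tile, which a and b leave alone. Of the others, a and
  -- b move the second index since matchings have no fixed points; ab and ba do because the two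
  -- matchings have no common edge; aba is a conjugate of b.
  obtain ⟨s, rfl | rfl, h⟩ := key
  · rcases h with rfl | rfl | rfl | rfl | rfl | rfl
    · rfl
    · exact (n1 _ (Prod.ext_iff.1 ht).2).elim
    · exact (n2 _ (Prod.ext_iff.1 ht).2).elim
    · have h := (Prod.ext_iff.1 ht).2
      refine (n3 t.2 ?_).elim
      calc matching hlab i t.2 = matching hlab i (matching hlab i (matching hlab j t.2)) :=
            congrArg _ h.symm
        _ = _ := m1 _
    · have h := (Prod.ext_iff.1 ht).2
      refine (n3 t.2 ?_).elim
      calc matching hlab i t.2 = matching hlab j (matching hlab j (matching hlab i t.2)) :=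
            (m2 _).symm
        _ = _ := congrArg _ h
    · have h := (Prod.ext_iff.1 ht).2
      refine (n2 (matching hlab i t.2) ?_).elim
      calc matching hlab j (matching hlab i t.2) = matching hlab i (matching hlab i
            (matching hlab j (matching hlab i t.2))) := (m1 _).symm
        _ = _ := congrArg _ h
  · refine (matching_ne hlab k t.1 ?_).elim
    rcases h with rfl | rfl | rfl | rfl | rfl | rfl <;> exact (Prod.ext_iff.1 ht).1

/-- The group generated by the reflections acts freely on pairs of a tile and a point. -/
theorem eq_one_of_fixed {g : hypIso × Equiv.Perm Tile} (hg : g ∈ tileGroup hlab) {y : H4}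
    (hy : g.1 • y = y) {t : Tile} (ht : g.2 t = t) : g = 1 := by
  obtain ⟨h, hh, hx⟩ := exists_tileGroup_smul_mem hlab y
  suffices H : ∀ {x : H4}, x ∈ polytope → ∀ {g : hypIso × Equiv.Perm Tile}, g ∈ tileGroup hlab →
      g.1 • x = x → ∀ {t}, g.2 t = t → g = 1 by
    have := H hx (g := h * g * h⁻¹) (mul_mem (mul_mem hh hg) (inv_mem hh))
      (by simp [mul_smul, hy]) (t := h.2 t) (by simp [ht])
    simpa using this
  clear hg hy ht hx hh h y t g
  intro x hx g hg hgx t ht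
  obtain ⟨V, hV, h1, h2⟩ := exists_star hlab hx
  -- A reflection word h at x returns g • z to the polytope. The strict fundamental domain makes hg
  -- fix z, hence every tile; as g fixes t, so does h, and h = 1 by freeness of the finite group on
  -- tiles.
  have key : ∀ z ∈ V, (∀ a, 0 < wall a (z : E5)) → g.1 • z = z := by
    intro z hz hzi
    obtain ⟨h, hh, hhz⟩ := h2 _ (h1 g hg hgx z hz)
    have hzp : z ∈ polytope := mem_polytope.2 fun a => (hzi a).le
    have hhg : h * g ∈ tileGroup hlab := mul_mem (parabolic_le hlab _ hh) hg
    have e1 : (h * g).1 • z = z :=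
      smul_eq_of_mem_polytope hlab hhg hzp (by rwa [Prod.fst_mul, mul_smul])
    have e2 := snd_apply_eq_of_interior hlab hhg hzi e1 t
    rw [Prod.snd_mul, Equiv.Perm.mul_apply, ht] at e2
    obtain ⟨i, j, k, hij, hki, hkj, hL⟩ := exists_facets x
    rw [eq_one_of_mem_dihedral hlab hij hki hkj (parabolic_mono hlab hL hh) e2, one_mul] at e1
    exact e1
  obtain ⟨z, hz, hzV⟩ := ((frequently_interior hx).and_eventually hV).exists
  refine Prod.ext ?_ (Equiv.ext (snd_apply_eq_of_interior hlab hg hz (key z hzV hz)))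
  refine Subtype.ext (LinearEquiv.toLinearMap_injective ?_)
  refine linearMap_eq_of_interior hx ?_
  filter_upwards [hV] with z hz hzi
  exact congrArg Subtype.val (key z hz hzi)

end

/-! ### The topology of the glued space -/

theorem isOpen_glue_iff {Y : Type*} [TopologicalSpace Y] {lab : Sym2 (Fin 6) → Fin 5}
    {F : Fin 5 → Set Y} {U : Set (Glue lab F)} :
    IsOpen U ↔ ∀ u, IsOpen (Glue.mk lab F u ⁻¹' U) := by
  have h : IsOpen U ↔ IsOpen (Quot.mk (GlueRel lab F) ⁻¹' U) := isOpen_coinduced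
  rw [h]
  constructor
  · exact fun h u => h.preimage (Continuous.prodMk_right u)
  · intro h
    have : Quot.mk (GlueRel lab F) ⁻¹' U = ⋃ u, {u} ×ˢ (Glue.mk lab F u ⁻¹' U) := by
      ext ⟨u, y⟩
      simp only [Glue.mk, mem_iUnion, mem_prod, mem_singleton_iff, exists_eq_left', mem_preimage]
      exact Iff.rfl
    rw [this]
    exact isOpen_iUnion fun u => (isOpen_discrete _).prod (h u)

theorem isOpen_mPrime_iff {lab : Sym2 (Fin 6) → Fin 5} {U : Set (MPrime lab)} :
    IsOpen U ↔ ∀ t, IsOpen (tile lab t ⁻¹' U) := by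
  rw [isOpen_glue_iff]
  simp only [isOpen_glue_iff, Prod.forall]
  rfl

theorem continuous_tile (lab : Sym2 (Fin 6) → Fin 5) (t : Tile) : Continuous (tile lab t) :=
  ⟨fun _ hU => isOpen_mPrime_iff.1 hU t⟩

theorem eventually_nhds_polytope {x : polytope} {P : polytope → Prop} :
    (∀ᶠ y in 𝓝 x, P y) ↔ ∀ᶠ z in 𝓝 (x : H4), ∀ hz : z ∈ polytope, P ⟨z, hz⟩ := by
  rw [nhds_subtype_eq_comap, eventually_comap]
  refine ⟨fun h => h.mono fun z h hz => h ⟨z, hz⟩ rfl, fun h => h.mono ?_⟩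
  rintro z h y rfl
  exact h y.2

section

variable {lab : Sym2 (Fin 6) → Fin 5} (hlab : IsProperLabelling lab)

/-- A property that holds near the copies of `x` in the tiles of its star holds for the developed
points near `x`. -/
theorem eventually_dev {x : polytope} {P : H4 → Prop}
    (h : ∀ g ∈ parabolic hlab {a | wall a ((x : H4) : E5) = 0},
      ∀ᶠ y : polytope in 𝓝 x, P (g.1⁻¹ • (y : H4))) : ∀ᶠ z in 𝓝 (x : H4), P z := by
  obtain ⟨V, hV, -, hstar⟩ := exists_star hlab x.2
  have hfix : ∀ g ∈ parabolic hlab {a | wall a ((x : H4) : E5) = 0}, g.1 • (x : H4) = x :=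
    fun g hg => Subtype.ext (parabolic_fixes hlab (fun a ha => ha) hg)
  have hfin : ∀ᶠ z in 𝓝 (x : H4), ∀ g ∈ {g ∈ tileGroup hlab | g.1 • (x : H4) = x},
      g ∈ parabolic hlab {a | wall a ((x : H4) : E5) = 0} → g.1 • z ∈ polytope → P z := by
    rw [Filter.eventually_all_finite (finite_stabilizer hlab (x : H4))]
    intro g _
    by_cases hg : g ∈ parabolic hlab {a | wall a ((x : H4) : E5) = 0}
    · have hc : Tendsto (fun z : H4 => g.1 • z) (𝓝 (x : H4)) (𝓝 (x : H4)) := by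
        have := (continuous_const_smul g.1).tendsto (x : H4)
        rwa [hfix g hg] at this
      filter_upwards [hc.eventually (eventually_nhds_polytope.1 (h g hg))] with z hz _ hgz
      simpa using hz hgz
    · exact Eventually.of_forall fun z h => (hg h).elim
  filter_upwards [hV, hfin] with z hz hz'
  obtain ⟨g, hg, hgz⟩ := hstar z hz
  exact hz' g ⟨parabolic_le hlab _ hg, hfix g hg⟩ hg hgz

theorem dev_inv_smul_coe {L : Set Letter} {g : hypIso × Equiv.Perm Tile}
    (hg : g ∈ parabolic hlab L) (t : Tile) (y : polytope) :
    dev hlab t (g.1⁻¹ • (y : H4)) = tile lab (g.2 t) y := by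
  rw [← dev_smul hlab (parabolic_le hlab _ hg), smul_inv_smul, dev_coe]

theorem tile_parabolic_self {x : polytope} {g : hypIso × Equiv.Perm Tile}
    (hg : g ∈ parabolic hlab {a | wall a ((x : H4) : E5) = 0}) (t : Tile) :
    tile lab (g.2 t) x = tile lab t x := by
  have hfix : g.1 • (x : H4) = x := Subtype.ext (parabolic_fixes hlab (fun a ha => ha) hg)
  rw [← dev_coe hlab, ← dev_coe hlab, ← dev_smul hlab (parabolic_le hlab _ hg) t, hfix]

/-- By equivariance it suffices to look near a point of the polytope. There the star consists of
finitely many images of the polytope, on each of which the map is the inclusion of a tile, and these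
tiles agree at the point. -/
theorem continuous_dev (t : Tile) : Continuous (dev hlab t) := by
  rw [continuous_iff_continuousAt]
  intro y
  obtain ⟨g, hg, hx⟩ := exists_tileGroup_smul_mem hlab y
  have hcomp : dev hlab t = dev hlab (g.2 t) ∘ fun z => g.1 • z :=
    funext fun z => (dev_smul hlab hg t z).symm
  rw [hcomp]
  refine ContinuousAt.comp ?_ (continuous_const_smul g.1).continuousAt
  intro U hU
  refine eventually_dev hlab (x := ⟨g.1 • y, hx⟩) fun h hh => ?_
  have hU' : U ∈ 𝓝 (tile lab (h.2 (g.2 t)) ⟨g.1 • y, hx⟩) := by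
    rwa [tile_parabolic_self hlab hh, ← dev_coe hlab]
  filter_upwards [(continuous_tile lab (h.2 (g.2 t))).continuousAt hU'] with z hz
  rwa [dev_inv_smul_coe hlab hh]

/-- In each tile the image of an open set is a union of translates, by the description of the
fibres. -/
theorem isOpenMap_dev (t : Tile) : IsOpenMap (dev hlab t) := by
  intro U hU
  rw [isOpen_mPrime_iff]
  intro t'
  have : tile lab t' ⁻¹' (dev hlab t '' U) =
      ⋃ g ∈ {g ∈ tileGroup hlab | g.2 t = t'}, {x : polytope | g.1⁻¹ • (x : H4) ∈ U} := by
    ext x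
    simp only [mem_preimage, mem_image, mem_iUnion, ← dev_coe hlab, dev_eq_iff hlab]
    constructor
    · rintro ⟨y, hy, g, hg, h1, h2⟩
      refine ⟨g, ⟨hg, h1⟩, ?_⟩
      change g.1⁻¹ • (x : H4) ∈ U
      rwa [← h2, inv_smul_smul]
    · rintro ⟨g, ⟨hg, h1⟩, h2⟩
      exact ⟨_, h2, g, hg, h1, smul_inv_smul _ _⟩
  rw [this]
  refine isOpen_biUnion fun g _ => hU.preimage ?_
  exact (continuous_const_smul g.1⁻¹).comp continuous_subtype_val

/-- Two points near y with the same image differ by an element that fixes y and the tile, which is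
trivial by freeness. -/
theorem isLocalHomeomorph_dev (t : Tile) : IsLocalHomeomorph (dev hlab t) := by
  rw [isLocalHomeomorph_iff_isOpenEmbedding_restrict]
  intro y
  obtain ⟨U, hU, V, hV, H⟩ := exists_nhds_smul hlab y y
  obtain ⟨W, hW, hWo, hyW⟩ := mem_nhds_iff.1 (inter_mem hU hV)
  refine ⟨W, hWo.mem_nhds hyW, IsOpenEmbedding.of_continuous_injective_isOpenMap
    ((continuous_dev hlab t).comp continuous_subtype_val) ?_
    ((isOpenMap_dev hlab t).comp hWo.isOpenMap_subtype_val)⟩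
  rintro ⟨z, hz⟩ ⟨z', hz'⟩ h
  obtain ⟨g, hg, h1, h2⟩ := (dev_eq_iff hlab).1 h
  have h3 := H g hg z (hW hz).1 (by rw [h2]; exact (hW hz').2)
  rw [eq_one_of_fixed hlab hg h3 h1, Prod.fst_one, one_smul] at h2
  exact Subtype.ext h2

/-! ### Transitivity on the tiles, and the Hausdorff property -/

theorem exists_tileGroup_apply_eq (t t' : Tile) : ∃ g ∈ tileGroup hlab, g.2 t = t' := by
  have h1 : ∀ w w' u : Fin 6, ∃ g ∈ tileGroup hlab, g.2 (w, u) = (w', u) := by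
    intro w w' u
    rcases eq_or_ne w w' with rfl | h
    · exact ⟨1, one_mem _, rfl⟩
    · refine ⟨_, gen_mem hlab (.inr (lab s(w, w'))), ?_⟩
      exact congrArg (·, u) (matching_lab hlab h)
  have h2 : ∀ w u u' : Fin 6, ∃ g ∈ tileGroup hlab, g.2 (w, u) = (w, u') := by
    intro w u u'
    rcases eq_or_ne u u' with rfl | h
    · exact ⟨1, one_mem _, rfl⟩
    · refine ⟨_, gen_mem hlab (.inl (lab s(u, u'))), ?_⟩
      exact congrArg (w, ·) (matching_lab hlab h)
  obtain ⟨g, hg, e1⟩ := h1 t.1 t'.1 t.2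
  obtain ⟨h, hh, e2⟩ := h2 t'.1 t.2 t'.2
  exact ⟨h * g, mul_mem hh hg, by rw [Prod.snd_mul, Equiv.Perm.mul_apply, e1, e2]⟩

theorem dev_surjective (t : Tile) : Function.Surjective (dev hlab t) := by
  intro z
  obtain ⟨t', x, rfl⟩ := tile_surjective z
  obtain ⟨g, hg, h⟩ := exists_tileGroup_apply_eq hlab t' t
  exact ⟨g.1 • (x : H4), by rw [← h, dev_smul hlab hg, dev_coe]⟩

include hlab in
theorem t2Space_mPrime : T2Space (MPrime lab) := by
  refine ⟨fun z z' hne => ?_⟩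
  obtain ⟨y, rfl⟩ := dev_surjective hlab 0 z
  obtain ⟨y', rfl⟩ := dev_surjective hlab 0 z'
  obtain ⟨U, hU, V, hV, H⟩ := exists_nhds_smul hlab y y'
  by_cases h : ∃ g ∈ tileGroup hlab, g.2 (0 : Tile) = 0 ∧ g.1 • y = y'
  · exact (hne ((dev_eq_iff hlab).2 h)).elim
  · obtain ⟨S, hS, V', hV', H'⟩ : ∃ S ∈ 𝓝 y, ∃ V' ∈ 𝓝 y', ∀ g ∈ tileGroup hlab,
        g.2 (0 : Tile) = 0 → ∀ z ∈ S, g.1 • z ∉ V' :=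
      ⟨U, hU, V, hV, fun g hg hg0 z hz hgz => h ⟨g, hg, hg0, H g hg z hz hgz⟩⟩
    refine ⟨dev hlab 0 '' interior S, dev hlab 0 '' interior V',
      isOpenMap_dev hlab 0 _ isOpen_interior, isOpenMap_dev hlab 0 _ isOpen_interior,
      mem_image_of_mem _ (mem_interior_iff_mem_nhds.2 hS),
      mem_image_of_mem _ (mem_interior_iff_mem_nhds.2 hV'), ?_⟩
    rw [Set.disjoint_left]
    rintro _ ⟨a, ha, rfl⟩ ⟨b, hb, hab⟩
    obtain ⟨g, hg, h1, h2⟩ := (dev_eq_iff hlab).1 hab.symm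
    exact H' g hg h1 a (interior_subset ha) (h2 ▸ interior_subset hb)

end

/-! ### Rigidity of the charts -/

/-- By orthogonality and nondegeneracy, k maps the normal vector to a multiple of itself, and
invariance of its norm makes the factor ±1. -/
theorem eq_one_or_refl {a : Letter} {k : hypIso} (h : ∀ w, wall a w = 0 → k.1 w = w) :
    k = 1 ∨ k = refl a := by
  set β := root a
  have hdec : ∀ y, wall a (y - (wall a y / 2) • β) = 0 := fun y => by
    rw [map_sub, map_smul, wall_root, smul_eq_mul]; ring
  have hsplit : ∀ y, y = (y - (wall a y / 2) • β) + (wall a y / 2) • β := fun y => by simp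
  set μ := wall a (k.1 β) / 2
  have hn : k.1 β - μ • β = 0 := by
    refine lor_nondegenerate fun y => ?_
    have h1 : lor (k.1 β) (y - (wall a y / 2) • β) = 0 := by
      rw [← h _ (hdec y), lor_map, lor_comm, lor_root, hdec, mul_zero]
    have h2 : lor β (y - (wall a y / 2) • β) = 0 := by
      rw [lor_comm, lor_root, hdec, mul_zero]
    have h3 : lor (k.1 β - μ • β) β = 0 := by rw [lor_root, hdec, mul_zero]
    rw [hsplit y, lor_add_right, lor_smul_right, h3, lor_sub_left, lor_smul_left, h1, h2]
    ring
  have hk : k.1 β = μ • β := sub_eq_zero.1 hn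
  have hμ : μ * μ = 1 := by
    have h1 := lor_map k β β
    have h2 : lor β β ≠ 0 := by
      rw [lor_root, wall_root]
      exact mul_ne_zero (rootScale_pos a).ne' two_ne_zero
    rw [hk, lor_smul_left, lor_smul_right, ← mul_assoc] at h1
    exact mul_right_cancel₀ h2 (by rw [h1, one_mul])
  have hkx : ∀ x, k.1 x = (x - (wall a x / 2) • β) + (wall a x / 2) • μ • β := fun x => by
    conv_lhs => rw [hsplit x, map_add, map_smul, h _ (hdec x), hk]
  rcases mul_self_eq_one_iff.1 hμ with h1 | h1
  · left
    refine hypIso_ext fun x => ?_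
    rw [hkx, h1, one_smul, ← hsplit]
    rfl
  · right
    refine hypIso_ext fun x => ?_
    rw [hkx, h1, refl_apply]
    module

/-- A point in the interior of a facet, up to scale. -/
def facetCentre : Letter → E5
  | .inl i => (fun _ => 1 : E5) - Pi.single i 1
  | .inr i => (fun _ => 1 : E5) + (3 : ℝ) • (Pi.single i 1 : E5)

theorem wall_facetCentre_self (a : Letter) : wall a (facetCentre a) = 0 := by
  rcases a with i | i
  · simp [facetCentre]
  · rw [wall_inr, facetCentre, map_add, map_smul, ht_single, ht_ones]
    simp
    norm_num

theorem wall_facetCentre_pos {a b : Letter} (h : b ≠ a) : 0 < wall b (facetCentre a) := by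
  rcases a with i | i <;> rcases b with j | j
  · have : j ≠ i := fun e => h (by rw [e])
    simp [facetCentre, this]
  · rw [wall_inr, facetCentre, map_sub, ht_single, ht_ones]
    by_cases e : j = i
    · subst e; simp
    · simp [e]; norm_num
  · by_cases e : j = i
    · subst e; simp [facetCentre]; norm_num
    · simp [facetCentre, e]
  · have : j ≠ i := fun e => h (by rw [e])
    rw [wall_inr, facetCentre, map_add, map_smul, ht_single, ht_ones]
    simp [this]; norm_num

/-- Near x the facet may be cut off by further walls, yet it spans its hyperplane: from x one can
move in every direction along the wall a that is positive on the other walls, and small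
perturbations of `facetCentre a` within the hyperplane are such directions. -/
theorem fixes_wall_of_eventually {a : Letter} {x : H4} (hx : x ∈ polytope)
    (hxa : wall a (x : E5) = 0) {k : E5 →ₗ[ℝ] E5}
    (h : ∀ᶠ z : H4 in 𝓝 x, z ∈ polytope → wall a (z : E5) = 0 → k z = z) {w : E5}
    (hw : wall a w = 0) : k w = w := by
  have hkx : k x = x := h.self_of_nhds hx hxa
  have key : ∀ d, wall a d = 0 → (∀ b, b ≠ a → 0 < wall b d) → k d = d := by
    intro d hd hd'
    obtain ⟨δ, ⟨z, hz, c, hc, hzc⟩, hδ⟩ := (((eventually_displace h d).filter_mono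
      (nhdsWithin_le_nhds (s := Ioi 0))).and self_mem_nhdsWithin).exists
    have hwall : ∀ b, wall b (z : E5) = c * (wall b (x : E5) + δ * wall b d) := fun b => by
      rw [hzc, map_smul, map_add, map_smul, smul_eq_mul, smul_eq_mul]
    have hza : wall a (z : E5) = 0 := by rw [hwall, hxa, hd]; ring
    have hzp : z ∈ polytope := mem_polytope.2 fun b => by
      by_cases hb : b = a
      · rw [hb, hza]
      · rw [hwall]
        have h1 := mem_polytope.1 hx b
        have h2 := mul_pos (show (0 : ℝ) < δ from hδ) (hd' b hb)
        positivity
    have := hz hzp hza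
    rw [hzc, map_smul] at this
    have h3 := smul_right_injective _ hc.ne' this
    rw [map_add, map_smul, hkx] at h3
    exact smul_right_injective _ (ne_of_gt hδ) (add_left_cancel h3)
  have hev : ∀ᶠ η : ℝ in 𝓝 0, ∀ b, b ≠ a → 0 < wall b (facetCentre a + η • w) := by
    rw [Filter.eventually_all]
    intro b
    by_cases hb : b = a
    · exact Eventually.of_forall fun _ h => (h hb).elim
    · have hc : Continuous fun η : ℝ => wall b (facetCentre a + η • w) := by
        simp only [map_add, map_smul]
        fun_prop
      have h0 : 0 < wall b (facetCentre a + (0 : ℝ) • w) := by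
        simpa using wall_facetCentre_pos hb
      filter_upwards [continuousAt_const.eventually_lt hc.continuousAt h0] with η hη _ using hη
  obtain ⟨η, hη, hη0⟩ := ((hev.filter_mono (nhdsWithin_le_nhds (s := {0}ᶜ))).and
    self_mem_nhdsWithin).exists
  have h1 := key (facetCentre a + η • w)
    (by rw [map_add, map_smul, wall_facetCentre_self, hw]; simp) hη
  rw [map_add, map_smul, key _ (wall_facetCentre_self a) fun b => wall_facetCentre_pos] at h1
  exact smul_right_injective _ hη0 (add_left_cancel h1)

section

variable {lab : Sym2 (Fin 6) → Fin 5} (hlab : IsProperLabelling lab)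

theorem mem_mPrime_atlas {φ : OpenPartialHomeomorph (MPrime lab) H4} :
    φ ∈ MPrime.atlas lab ↔ ∀ t x, tile lab t x ∈ φ.source →
      ∃ h : hypIso, ∀ᶠ y : polytope in 𝓝 x, φ (tile lab t y) = h • (y : H4) := by
  constructor
  · rintro H ⟨w, u⟩ x hx
    obtain ⟨g, hg, h⟩ := H w u x hx
    exact ⟨⟨g, hg⟩, h.mono fun y hy => Subtype.ext hy⟩
  · rintro H w u x hx
    obtain ⟨h, hh⟩ := H (w, u) x hx
    exact ⟨h.1, h.2, hh.mono fun y hy => congrArg Subtype.val hy⟩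

/-- A chart of `M'` unfolds adjacent tiles by the reflection in their common facet. -/
theorem chart_cross {φ : OpenPartialHomeomorph (MPrime lab) H4} {a : Letter} {x : polytope}
    (hxa : wall a ((x : H4) : E5) = 0) {t : Tile} (hx : tile lab t x ∈ φ.source) {h h' : hypIso}
    (H : ∀ᶠ y : polytope in 𝓝 x, φ (tile lab t y) = h • (y : H4))
    (H' : ∀ᶠ y : polytope in 𝓝 x, φ (tile lab (cross hlab a t) y) = h' • (y : H4)) :
    h' = h * refl a := by
  have hk : ∀ w, wall a w = 0 → (h⁻¹ * h').1 w = w := by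
    intro w hw
    refine fixes_wall_of_eventually x.2 hxa
      (k := ((h⁻¹ * h').1 : E5 →ₗ[ℝ] E5)) ?_ hw
    filter_upwards [eventually_nhds_polytope.1 H, eventually_nhds_polytope.1 H'] with z h1 h2 hz hza
    have h3 := h2 hz
    rw [tile_cross hlab (x := ⟨z, hz⟩) hza, h1 hz] at h3
    have : (h⁻¹ * h') • z = z := by rw [mul_smul, ← h3, inv_smul_smul]
    exact congrArg Subtype.val this
  rcases eq_one_or_refl hk with h1 | h1
  -- If both tiles were charted by the same isometry, an interior point and its copy in the adjacent
  -- tile would have the same image, against injectivity of the chart.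
  · exfalso
    have hh : h' = h := by rw [← mul_inv_cancel_left h h', h1, mul_one]
    have hs1 : ∀ᶠ y : polytope in 𝓝 x, tile lab t y ∈ φ.source :=
      (continuous_tile lab t).continuousAt (φ.open_source.mem_nhds hx)
    have hs2 : ∀ᶠ y : polytope in 𝓝 x, tile lab (cross hlab a t) y ∈ φ.source := by
      refine (continuous_tile lab _).continuousAt (φ.open_source.mem_nhds ?_)
      rwa [tile_cross hlab hxa]
    obtain ⟨z, hz, h2⟩ := ((frequently_interior x.2).and_eventually (eventually_nhds_polytope.1
      ((H.and H').and (hs1.and hs2)))).exists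
    obtain ⟨⟨h3, h4⟩, h5, h6⟩ := h2 (mem_polytope.2 fun a => (hz a).le)
    rw [hh, ← h3] at h4
    exact cross_ne hlab a t (eq_of_tile_eq hlab hz (φ.injOn h6 h5 h4))
  · rw [← h1, mul_inv_cancel_left]

/-- A homeomorphism onto an open subset of `H4` is a chart of `M'` if and only if it becomes
locally an isometry when it is composed with the developing map. -/
theorem mem_mPrime_atlas_iff_dev (t : Tile) {φ : OpenPartialHomeomorph (MPrime lab) H4} :
    φ ∈ MPrime.atlas lab ↔ ∀ y, dev hlab t y ∈ φ.source →
      ∃ h : hypIso, ∀ᶠ z in 𝓝 y, φ (dev hlab t z) = h • z := by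
  rw [mem_mPrime_atlas]
  constructor
  · intro H y hy
    obtain ⟨g, hg, hx⟩ := exists_tileGroup_smul_mem hlab y
    rw [← dev_smul hlab hg] at hy
    suffices hs : ∃ h : hypIso, ∀ᶠ z in 𝓝 (g.1 • y), φ (dev hlab (g.2 t) z) = h • z by
      obtain ⟨h, hh⟩ := hs
      refine ⟨h * g.1, ?_⟩
      filter_upwards [(continuous_const_smul g.1).continuousAt.eventually hh] with z hz
      rw [← dev_smul hlab hg, hz, mul_smul]
    generalize g.2 t = t at hy
    have hy' : tile lab t ⟨g.1 • y, hx⟩ ∈ φ.source := by rwa [← dev_coe hlab]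
    change ∃ h : hypIso, ∀ᶠ z in 𝓝 ((⟨g.1 • y, hx⟩ : polytope) : H4), φ (dev hlab t z) = h • z
    generalize (⟨g.1 • y, hx⟩ : polytope) = x at hy'
    obtain ⟨h, hh⟩ := H t x hy'
    refine ⟨h, eventually_dev hlab fun k hk => ?_⟩
    -- The isometry on one tile determines those on all tiles of the star: each letter of the word k
    -- crosses a facet through x, where `chart_cross` applies.
    have key : ∀ᶠ y : polytope in 𝓝 x, φ (tile lab (k.2 t) y) = (h * k.1⁻¹) • (y : H4) := by
      induction hk using parabolic_induction with
      | one => simpa using hh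
      | mul a ha k hk ih =>
        have hs : tile lab (k.2 t) x ∈ φ.source := by rwa [tile_parabolic_self hlab hk]
        have hs' : tile lab ((gen hlab a * k).2 t) x ∈ φ.source := by
          rwa [tile_parabolic_self hlab (mul_mem (gen_mem_parabolic hlab ha) hk)]
        obtain ⟨h', hh'⟩ := H _ _ hs'
        have e := chart_cross hlab ha hs ih hh'
        have e2 : h' = h * (gen hlab a * k).1⁻¹ := by
          have : (refl a)⁻¹ = refl a := inv_eq_of_mul_eq_one_left (refl_mul_self a)
          rw [e, Prod.fst_mul, mul_inv_rev, mul_assoc]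
          change _ = h * (k.1⁻¹ * (refl a)⁻¹)
          rw [this]
        rwa [e2] at hh'
    filter_upwards [key] with y hy
    rw [dev_inv_smul_coe hlab hk, hy, mul_smul]
  · intro H t' x hx
    obtain ⟨g, hg, hgt⟩ := exists_tileGroup_apply_eq hlab t' t
    have e : ∀ y : polytope, tile lab t' y = dev hlab t (g.1 • (y : H4)) := fun y => by
      rw [← hgt, dev_smul hlab hg, dev_coe]
    obtain ⟨h, hh⟩ := H (g.1 • (x : H4)) (by rwa [← e])
    refine ⟨h * g.1, ?_⟩
    have hc : Continuous fun y : polytope => g.1 • (y : H4) :=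
      continuous_subtype_val.const_smul g.1
    filter_upwards [hc.continuousAt.eventually hh] with y hy
    rw [e, hy, mul_smul]

end

/-! ### Hyperbolic structures with a developing map

A hyperbolic structure on `N` is often the structure of a quotient of `H4` by a group of
isometries. -/

section Developing

variable {N : Type*} [TopologicalSpace N]

/-- The atlas `A` is the structure that `N` has as the quotient of `H4` by `Γ`, with quotient
map `p`. -/
structure IsDeveloping (A : Set (OpenPartialHomeomorph N H4)) (Γ : Subgroup hypIso)
    (p : H4 → N) : Prop where
  t2 : T2Space N
  surjective : Function.Surjective p
  isLocalHomeomorph : IsLocalHomeomorph p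
  eq_iff : ∀ y y', p y = p y' ↔ ∃ g ∈ Γ, g • y = y'
  mem_iff : ∀ φ, φ ∈ A ↔ ∀ y, p y ∈ φ.source → ∃ h : hypIso, ∀ᶠ z in 𝓝 y, φ (p z) = h • z

variable {A : Set (OpenPartialHomeomorph N H4)} {Γ : Subgroup hypIso} {p : H4 → N}

namespace IsDeveloping

theorem smul_eq (H : IsDeveloping A Γ p) {g : hypIso} (hg : g ∈ Γ) (y : H4) : p (g • y) = p y :=
  ((H.eq_iff _ _).2 ⟨g, hg, rfl⟩).symm

theorem eventually_nhds_iff (H : IsDeveloping A Γ p) {y : H4} {P : N → Prop} :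
    (∀ᶠ x in 𝓝 (p y), P x) ↔ ∀ᶠ z in 𝓝 y, P (p z) := by
  rw [← H.isLocalHomeomorph.map_nhds_eq, eventually_map]

theorem eventually_smul (H : IsDeveloping A Γ p) {φ : OpenPartialHomeomorph N H4} {y : H4}
    {h g : hypIso} (hg : g ∈ Γ) (hh : ∀ᶠ z in 𝓝 (g • y), φ (p z) = h • z) :
    ∀ᶠ z in 𝓝 y, φ (p z) = (h * g) • z := by
  filter_upwards [(continuous_const_smul g).continuousAt.eventually hh] with z hz
  rw [← H.smul_eq hg, hz, mul_smul]

/-- Local inverses of the developing map, followed by an isometry, are charts. -/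
theorem exists_chart (H : IsDeveloping A Γ p) (y : H4) (h : hypIso) :
    ∃ φ ∈ A, p y ∈ φ.source ∧ (∀ᶠ z in 𝓝 y, φ (p z) = h • z) ∧
      ∀ y', p y' ∈ φ.source → ∃ g ∈ Γ, ∀ᶠ z in 𝓝 y', φ (p z) = (h * g) • z := by
  set e := H.isLocalHomeomorph.localInverseAt y
  set φ := e.trans (Homeomorph.smul h).toOpenPartialHomeomorph
  have hs : φ.source = e.source := by simp [φ]
  have hφ : ∀ x, φ x = h • e x := fun x => rfl
  have hpe : ∀ q ∈ e.target, e (p q) = q := fun q hq => by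
    have h1 : e.symm = p := H.isLocalHomeomorph.localInverseAt_symm y
    rw [← h1]
    exact e.right_inv hq
  have hy : y ∈ e.target := H.isLocalHomeomorph.self_mem_localInverseAt_target
  have h1 : ∀ q ∈ e.target, ∀ᶠ z in 𝓝 q, φ (p z) = h • z := fun q hq => by
    filter_upwards [e.open_target.mem_nhds hq] with z hz
    rw [hφ, hpe z hz]
  have h2 : ∀ y', p y' ∈ φ.source → ∃ g ∈ Γ, ∀ᶠ z in 𝓝 y', φ (p z) = (h * g) • z := by
    intro y' hy'
    rw [hs] at hy'
    have h3 : p (e (p y')) = p y' := H.isLocalHomeomorph.apply_localInverseAt_of_mem hy'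
    obtain ⟨g, hg, hgy⟩ := (H.eq_iff _ _).1 h3.symm
    refine ⟨g, hg, H.eventually_smul hg ?_⟩
    rw [hgy]
    exact h1 _ (e.map_source hy')
  refine ⟨φ, (H.mem_iff φ).2 fun y' hy' => ?_, ?_, h1 y hy, h2⟩
  · obtain ⟨g, -, hg⟩ := h2 y' hy'
    exact ⟨_, hg⟩
  · rw [hs]
    exact H.isLocalHomeomorph.apply_self_mem_localInverseAt_source

theorem agreeAt (H : IsDeveloping A Γ p) {φ ψ : OpenPartialHomeomorph N H4} {y : H4}
    {h k : hypIso} (hφ : ∀ᶠ z in 𝓝 y, φ (p z) = h • z) (hψ : ∀ᶠ z in 𝓝 y, ψ (p z) = k • z) :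
    ∀ᶠ x in 𝓝 (p y), (ψ x : E5) = (k * h⁻¹).1 (φ x : E5) := by
  rw [H.eventually_nhds_iff]
  filter_upwards [hφ, hψ] with z h1 h2
  rw [← coe_smul, h1, h2, mul_smul, inv_smul_smul]

theorem isHyperbolicAtlas (H : IsDeveloping A Γ p) : IsHyperbolicAtlas A := by
  refine ⟨fun x => ?_, ?_⟩
  · obtain ⟨y, rfl⟩ := H.surjective x
    obtain ⟨φ, hφ, hy, -⟩ := H.exists_chart y 1
    exact ⟨φ, hφ, hy⟩
  · rintro φ hφ ψ hψ x ⟨hx1, hx2⟩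
    obtain ⟨y, rfl⟩ := H.surjective x
    obtain ⟨h, hh⟩ := (H.mem_iff φ).1 hφ y hx1
    obtain ⟨k, hk⟩ := (H.mem_iff ψ).1 hψ y hx2
    exact ⟨_, (k * h⁻¹).2, H.agreeAt hh hk⟩

end IsDeveloping

/-! ### Geodesics and completeness -/

/-- The unit speed geodesic with given initial position and velocity. -/
noncomputable def geodesic (y w : E5) (s : ℝ) : E5 := Real.cosh s • y + Real.sinh s • w

/-- The norm -1 leaves two sheets, and the negative product with y selects the upper one. -/
theorem geodesic_mem (y : H4) {w : E5} (h1 : lor (y : E5) w = 0) (h2 : lor w w = 1) (s : ℝ) :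
    geodesic y w s ∈ hyperboloid := by
  have h3 : lor (geodesic y w s) (geodesic y w s) = -1 := by
    simp only [geodesic, lor_add_left, lor_add_right, lor_smul_left, lor_smul_right, h1, h2,
      lor_comm w, lor_coe_self]
    linear_combination -(Real.cosh_sq_sub_sinh_sq s)
  have h4 : lor (geodesic y w s) y < 0 := by
    simp only [geodesic, lor_add_left, lor_smul_left, lor_comm w, h1, lor_coe_self]
    linarith [Real.cosh_pos s]
  refine ⟨h3, ?_⟩
  rw [← ht_apply]
  by_contra! h5
  rcases h5.eq_or_lt with h6 | h6
  · have := lor_self_ge (geodesic y w s)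
    rw [h3, h6] at this
    norm_num at this
  · have h7 : -geodesic y w s = (-1 : ℝ) • geodesic y w s := by simp
    have := lor_neg_of_mem_timeCone (x := -geodesic y w s)
      (by rw [h7, lor_smul_left, lor_smul_right, h3]; norm_num)
      (by rw [map_neg]; linarith) (hyperboloid_subset_timeCone y.2)
    rw [h7, lor_smul_left] at this
    linarith

theorem isGeodesicAt_of_eventually {p : H4 → N} (hp : Continuous p) {y : H4} {w : E5}
    (h1 : lor (y : E5) w = 0) (h2 : lor w w = 1) {φ : OpenPartialHomeomorph N H4} {h : hypIso}
    {t : ℝ} (hs : p ⟨_, geodesic_mem y h1 h2 t⟩ ∈ φ.source)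
    (hh : ∀ᶠ z in 𝓝 (⟨_, geodesic_mem y h1 h2 t⟩ : H4), φ (p z) = h • z) :
    IsGeodesicAt φ (fun s => p ⟨_, geodesic_mem y h1 h2 s⟩) t
      (h.1 (Real.sinh t • (y : E5) + Real.cosh t • w)) := by
  have hc : Continuous fun s => (⟨_, geodesic_mem y h1 h2 s⟩ : H4) := by
    refine Continuous.subtype_mk ?_ _
    unfold geodesic
    have := Real.continuous_cosh
    have := Real.continuous_sinh
    fun_prop
  have ht := congrArg Subtype.val hh.self_of_nhds
  rw [coe_smul] at ht
  simp only at ht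
  have hw : lor w (y : E5) = 0 := by rw [lor_comm, h1]
  refine ⟨?_, ?_, ?_⟩
  · rw [ht, lor_map]
    simp only [geodesic, lor_add_left, lor_add_right, lor_smul_left, lor_smul_right, h1, h2,
      hw, lor_coe_self]
    ring
  · rw [lor_map]
    simp only [lor_add_left, lor_add_right, lor_smul_left, lor_smul_right, h1, h2,
      hw, lor_coe_self]
    linear_combination Real.cosh_sq_sub_sinh_sq t
  · filter_upwards [hc.continuousAt.eventually hh,
      (hp.comp hc).continuousAt (φ.open_source.mem_nhds hs)] with s hs1 hs2
    refine ⟨hs2, ?_⟩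
    rw [ht, hs1, coe_smul, ← map_smul, ← map_smul, ← map_add]
    congr 1
    have e1 : Real.cosh s = Real.cosh (s - t) * Real.cosh t + Real.sinh (s - t) * Real.sinh t := by
      rw [← Real.cosh_add]; simp
    have e2 : Real.sinh s = Real.sinh (s - t) * Real.cosh t + Real.cosh (s - t) * Real.sinh t := by
      rw [← Real.sinh_add]; simp
    simp only [geodesic]
    rw [e1, e2]
    module

namespace IsDeveloping

/-- The isometry of the chart transports the initial vector to H⁴, where geodesics are defined for
all times; the geodesic is then projected to N. -/
theorem isGeodesicallyComplete (H : IsDeveloping A Γ p) : IsGeodesicallyComplete A := by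
  intro φ hφ x hx w hw1 hw2
  obtain ⟨y, rfl⟩ := H.surjective x
  obtain ⟨h, hh⟩ := (H.mem_iff φ).1 hφ y hx
  have hinv : h.1 (h⁻¹.1 w) = w := by
    change (h * h⁻¹).1 w = w
    rw [mul_inv_cancel]; rfl
  have h1 : lor (y : E5) (h⁻¹.1 w) = 0 := by
    rw [← lor_map h, hinv, ← coe_smul, ← hh.self_of_nhds, hw1]
  have h2 : lor (h⁻¹.1 w) (h⁻¹.1 w) = 1 := by rw [lor_map, hw2]
  have h0 : (⟨_, geodesic_mem y h1 h2 0⟩ : H4) = y := Subtype.ext (by simp [geodesic])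
  refine ⟨fun s => p ⟨_, geodesic_mem y h1 h2 s⟩, congrArg p h0, ?_, fun t => ?_⟩
  · have := isGeodesicAt_of_eventually H.isLocalHomeomorph.continuous h1 h2 (φ := φ) (h := h)
      (t := 0) (by rwa [h0]) (by rwa [h0])
    simpa [hinv] using this
  · obtain ⟨ψ, hψ, hs, hk, -⟩ := H.exists_chart ⟨_, geodesic_mem y h1 h2 t⟩ 1
    exact ⟨ψ, hψ, _, isGeodesicAt_of_eventually H.isLocalHomeomorph.continuous h1 h2 hs hk⟩

theorem isCompleteHyperbolicManifold (H : IsDeveloping A Γ p) :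
    IsCompleteHyperbolicManifold A :=
  ⟨H.t2, (H.isLocalHomeomorph.isOpenMap.isQuotientMap H.isLocalHomeomorph.continuous
    H.surjective).secondCountableTopology H.isLocalHomeomorph.isOpenMap,
    H.surjective.connectedSpace H.isLocalHomeomorph.continuous, H.isHyperbolicAtlas,
    H.isGeodesicallyComplete⟩

end IsDeveloping

/-! ### Orientations -/

/-- The determinant on the isometry group. -/
noncomputable def hypDet : hypIso →* ℝ :=
  (LinearMap.det : (E5 →ₗ[ℝ] E5) →* ℝ).comp
    ((LinearEquiv.automorphismGroup.toLinearMapMonoidHom (R := ℝ) (M := E5)).comp hypIso.subtype)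

theorem hypDet_apply (g : hypIso) : hypDet g = LinearMap.det (g.1 : E5 →ₗ[ℝ] E5) := rfl

theorem hypDet_ne_zero (g : hypIso) : hypDet g ≠ 0 :=
  g.1.isUnit_det'.ne_zero

theorem hypDet_refl (a : Letter) : hypDet (refl a) = -1 := det_refl a

theorem hypDet_inv_pos {g : hypIso} : 0 < hypDet g⁻¹ ↔ 0 < hypDet g := by
  have h : hypDet g * hypDet g⁻¹ = 1 := by rw [← map_mul, mul_inv_cancel, map_one]
  exact (pos_iff_pos_of_mul_pos (h ▸ one_pos)).symm

theorem hypDet_mul_pos {g h : hypIso} : 0 < hypDet (g * h) ↔ (0 < hypDet g ↔ 0 < hypDet h) := by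
  rw [map_mul]
  have hg := hypDet_ne_zero g
  have hh := hypDet_ne_zero h
  rcases hg.lt_or_gt with h1 | h1 <;> rcases hh.lt_or_gt with h2 | h2
  · simp [mul_pos_of_neg_of_neg h1 h2, h1.not_gt, h2.not_gt]
  · simp [(mul_neg_of_neg_of_pos h1 h2).not_gt, h1.not_gt, h2]
  · simp [(mul_neg_of_pos_of_neg h1 h2).not_gt, h1, h2.not_gt]
  · simp [mul_pos h1 h2, h1, h2]

/-- The orientation preserving isometries. -/
def orientationSubgroup : Subgroup hypIso where
  carrier := {g | 0 < hypDet g}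
  mul_mem' {a b} ha hb := by
    change 0 < hypDet (a * b)
    rw [map_mul]
    exact mul_pos ha hb
  one_mem' := by change 0 < hypDet 1; rw [map_one]; exact one_pos
  inv_mem' h := hypDet_inv_pos.2 h

/-- The chart `φ` is, near `p y`, orientation preserving with respect to the map `p`. -/
def PositiveAt (p : H4 → N) (φ : OpenPartialHomeomorph N H4) (y : H4) : Prop :=
  ∃ h : hypIso, 0 < hypDet h ∧ ∀ᶠ z in 𝓝 y, φ (p z) = h • z

theorem positiveAt_iff {φ : OpenPartialHomeomorph N H4} {y : H4} {h : hypIso}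
    (hh : ∀ᶠ z in 𝓝 y, φ (p z) = h • z) : PositiveAt p φ y ↔ 0 < hypDet h := by
  refine ⟨?_, fun h0 => ⟨h, h0, hh⟩⟩
  rintro ⟨k, hk0, hk⟩
  have : h = k := hypIso_eq_of_eventually_eq (x := y) <| by
    filter_upwards [hh, hk] with z h1 h2
    rw [← h1, h2]
  rwa [this]

namespace IsDeveloping

theorem eventually_positiveAt_iff (H : IsDeveloping A Γ p) {φ : OpenPartialHomeomorph N H4}
    (hφ : φ ∈ A) {y : H4} (hy : p y ∈ φ.source) :
    ∀ᶠ z in 𝓝 y, (PositiveAt p φ z ↔ PositiveAt p φ y) := by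
  obtain ⟨h, hh⟩ := (H.mem_iff φ).1 hφ y hy
  filter_upwards [eventually_eventually_nhds.2 hh] with z hz
  rw [positiveAt_iff hz, positiveAt_iff hh]

theorem positiveAt_smul (H : IsDeveloping A Γ p) {φ : OpenPartialHomeomorph N H4} (hφ : φ ∈ A)
    {y : H4} (hy : p y ∈ φ.source) {g : hypIso} (hg : g ∈ Γ) :
    PositiveAt p φ y ↔ (PositiveAt p φ (g • y) ↔ 0 < hypDet g) := by
  obtain ⟨h, hh⟩ := (H.mem_iff φ).1 hφ (g • y) (by rwa [H.smul_eq hg])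
  rw [positiveAt_iff hh, positiveAt_iff (H.eventually_smul hg hh), hypDet_mul_pos]

theorem orientAgreeAt_iff (H : IsDeveloping A Γ p) {φ ψ : OpenPartialHomeomorph N H4}
    (hφ : φ ∈ A) (hψ : ψ ∈ A) {y : H4} (hy : p y ∈ φ.source) (hy' : p y ∈ ψ.source) :
    OrientAgreeAt φ ψ (p y) ↔ (PositiveAt p φ y ↔ PositiveAt p ψ y) := by
  obtain ⟨h, hh⟩ := (H.mem_iff φ).1 hφ y hy
  obtain ⟨k, hk⟩ := (H.mem_iff ψ).1 hψ y hy'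
  rw [positiveAt_iff hh, positiveAt_iff hk]
  constructor
  · rintro ⟨g, hg, hg0, hgx⟩
    have : k = ⟨g, hg⟩ * h := hypIso_eq_of_eventually_eq (x := y) <| by
      filter_upwards [hh, hk, H.eventually_nhds_iff.1 hgx] with z h1 h2 h3
      rw [← h2, mul_smul, ← h1]
      exact Subtype.ext h3
    have h1 : 0 < hypDet (⟨g, hg⟩ : hypIso) := hg0
    rw [this, map_mul, mul_pos_iff_of_pos_left h1]
  · intro e
    refine ⟨_, (k * h⁻¹).2, ?_, H.agreeAt hh hk⟩
    rw [← hypDet_apply, hypDet_mul_pos, hypDet_inv_pos, e]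

theorem isOrientable (H : IsDeveloping A Γ p) (hΓ : ∀ g ∈ Γ, 0 < hypDet g) : IsOrientable A := by
  refine ⟨{φ ∈ A | ∀ y, p y ∈ φ.source → PositiveAt p φ y}, fun φ h => h.1, fun x => ?_, ?_⟩
  · obtain ⟨y, rfl⟩ := H.surjective x
    obtain ⟨φ, hφ, hy, -, h⟩ := H.exists_chart y 1
    refine ⟨φ, ⟨hφ, fun y' hy' => ?_⟩, hy⟩
    obtain ⟨g, hg, hgz⟩ := h y' hy'
    exact ⟨1 * g, by rw [one_mul]; exact hΓ g hg, hgz⟩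
  · rintro φ ⟨hφ, h1⟩ ψ ⟨hψ, h2⟩ x ⟨hx1, hx2⟩
    obtain ⟨y, rfl⟩ := H.surjective x
    rw [H.orientAgreeAt_iff hφ hψ hx1 hx2]
    exact iff_of_true (h1 y hx1) (h2 y hx2)

/-- An oriented subatlas would split H⁴ into two open sets, according to the sign of its charts with
respect to p. By connectedness one of them is empty, but an orientation reversing g puts y and g •
y, which have the same image, on different sides. -/
theorem not_isOrientable (H : IsDeveloping A Γ p) {g : hypIso} (hg : g ∈ Γ)
    (hg0 : ¬ 0 < hypDet g) : ¬ IsOrientable A := by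
  rintro ⟨A₀, hA, hcov, hagree⟩
  have key : ∀ b : Prop, IsOpen {y | ∃ φ ∈ A₀, p y ∈ φ.source ∧ (PositiveAt p φ y ↔ b)} := by
    intro b
    rw [isOpen_iff_mem_nhds]
    rintro y ⟨φ, hφ, hy, hb⟩
    filter_upwards [H.eventually_positiveAt_iff (hA hφ) hy,
      H.isLocalHomeomorph.continuous.continuousAt (φ.open_source.mem_nhds hy)] with z h1 h2
    exact ⟨φ, hφ, h2, h1.trans hb⟩
  have hcompl : {y | ∃ φ ∈ A₀, p y ∈ φ.source ∧ (PositiveAt p φ y ↔ False)} =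
      {y | ∃ φ ∈ A₀, p y ∈ φ.source ∧ (PositiveAt p φ y ↔ True)}ᶜ := by
    ext y
    constructor
    · rintro ⟨φ, hφ, h1, h2⟩ ⟨ψ, hψ, h3, h4⟩
      have := (H.orientAgreeAt_iff (hA hφ) (hA hψ) h1 h3).1 (hagree φ hφ ψ hψ _ ⟨h1, h3⟩)
      tauto
    · intro h
      obtain ⟨φ, hφ, h1⟩ := hcov (p y)
      by_cases h2 : PositiveAt p φ y
      · exact (h ⟨φ, hφ, h1, by simpa using h2⟩).elim
      · exact ⟨φ, hφ, h1, by simpa using h2⟩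
  have hclopen : IsClopen {y | ∃ φ ∈ A₀, p y ∈ φ.source ∧ (PositiveAt p φ y ↔ True)} :=
    ⟨⟨hcompl ▸ key False⟩, key True⟩
  obtain ⟨y⟩ : Nonempty H4 := inferInstance
  obtain ⟨φ, hφ, hy⟩ := hcov (p y)
  have hy' : p (g • y) ∈ φ.source := by rwa [H.smul_eq hg]
  have h1 := H.positiveAt_smul (hA hφ) hy hg
  have h2 := isClopen_iff.1 hclopen
  by_cases hb : PositiveAt p φ y
  · have h3 : y ∈ {y | ∃ φ ∈ A₀, p y ∈ φ.source ∧ (PositiveAt p φ y ↔ True)} :=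
      ⟨φ, hφ, hy, by simpa using hb⟩
    have h4 : g • y ∉ {y | ∃ φ ∈ A₀, p y ∈ φ.source ∧ (PositiveAt p φ y ↔ True)} := by
      rw [← mem_compl_iff, ← hcompl]
      exact ⟨φ, hφ, hy', by tauto⟩
    rcases h2 with h2 | h2
    · rw [h2] at h3; exact h3
    · rw [h2] at h4; exact h4 (mem_univ _)
  · have h3 : g • y ∈ {y | ∃ φ ∈ A₀, p y ∈ φ.source ∧ (PositiveAt p φ y ↔ True)} :=
      ⟨φ, hφ, hy', by tauto⟩
    have h4 : y ∉ {y | ∃ φ ∈ A₀, p y ∈ φ.source ∧ (PositiveAt p φ y ↔ True)} := by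
      rw [← mem_compl_iff, ← hcompl]
      exact ⟨φ, hφ, hy, by tauto⟩
    rcases h2 with h2 | h2
    · rw [h2] at h3; exact h3
    · rw [h2] at h4; exact h4 (mem_univ _)

end IsDeveloping

end Developing

/-! ### The orientation double cover of a quotient of hyperbolic space -/

section OrientationCover

variable {N : Type*} [TopologicalSpace N] {A : Set (OpenPartialHomeomorph N H4)}

/-- Coherence determines the signs of all charts around a point from the sign of one. -/
theorem OrientationCover.eq_of_point_eq {z z' : OrientationCover A} (h : z.point = z'.point)
    {φ : OpenPartialHomeomorph N H4} (hφ : φ ∈ A) (hz : z.point ∈ φ.source)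
    (hpos : φ ∈ z.pos ↔ φ ∈ z'.pos) : z = z' := by
  refine OrientationCover.ext h (Set.ext fun ψ => ?_)
  by_cases hψ : ψ ∈ A ∧ z.point ∈ ψ.source
  · have h1 := z.coherent φ hφ ψ hψ.1 hz hψ.2
    have h2 := z'.coherent φ hφ ψ hψ.1 (h ▸ hz) (h ▸ hψ.2)
    rw [← h] at h2
    tauto
  · exact iff_of_false (fun h' => hψ (z.pos_sub ψ h')) fun h' =>
      hψ (by rw [h]; exact z'.pos_sub ψ h')

theorem OrientationCover.continuous_point :
    Continuous (OrientationCover.point : OrientationCover A → N) :=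
  continuous_iff_le_induced.2 inf_le_left

theorem OrientationCover.isOpen_pos {φ : OpenPartialHomeomorph N H4} (hφ : φ ∈ A) :
    IsOpen {z : OrientationCover A | z.point ∈ φ.source ∧ φ ∈ z.pos} :=
  (show (inferInstance : TopologicalSpace (OrientationCover A)) ≤ _ from inf_le_right) _
    (TopologicalSpace.isOpen_generateFrom_of_mem ⟨φ, hφ, .inl rfl⟩)

theorem OrientationCover.isOpen_neg {φ : OpenPartialHomeomorph N H4} (hφ : φ ∈ A) :
    IsOpen {z : OrientationCover A | z.point ∈ φ.source ∧ φ ∉ z.pos} :=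
  (show (inferInstance : TopologicalSpace (OrientationCover A)) ≤ _ from inf_le_right) _
    (TopologicalSpace.isOpen_generateFrom_of_mem ⟨φ, hφ, .inr rfl⟩)

theorem OrientationCover.continuous_iff {X : Type*} [TopologicalSpace X]
    {f : X → OrientationCover A} : Continuous f ↔ Continuous (fun x => (f x).point) ∧
      ∀ φ ∈ A, ∀ x, (f x).point ∈ φ.source → ∀ᶠ x' in 𝓝 x, (φ ∈ (f x').pos ↔ φ ∈ (f x).pos) := by
  constructor
  · refine fun hf => ⟨OrientationCover.continuous_point.comp hf, fun φ hφ x hx => ?_⟩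
    by_cases h : φ ∈ (f x).pos
    · filter_upwards [hf.continuousAt ((OrientationCover.isOpen_pos hφ).mem_nhds ⟨hx, h⟩)]
        with x' hx' using iff_of_true hx'.2 h
    · filter_upwards [hf.continuousAt ((OrientationCover.isOpen_neg hφ).mem_nhds ⟨hx, h⟩)]
        with x' hx' using iff_of_false hx'.2 h
  · rintro ⟨h1, h2⟩
    refine continuous_inf_rng.2 ⟨continuous_induced_rng.2 h1, continuous_generateFrom_iff.2 ?_⟩
    rintro _ ⟨φ, hφ, rfl | rfl⟩ <;>
    · rw [isOpen_iff_mem_nhds]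
      rintro x ⟨hx, hx'⟩
      filter_upwards [h1.continuousAt (φ.open_source.mem_nhds hx), h2 φ hφ x hx] with x' h3 h4
      exact ⟨h3, by tauto⟩

variable {Γ : Subgroup hypIso} {p : H4 → N}

namespace IsDeveloping

/-- The point over `p y` of the orientation cover that is given by the standard orientation
of `H4`. -/
def lift (H : IsDeveloping A Γ p) (y : H4) : OrientationCover A where
  point := p y
  pos := {φ | φ ∈ A ∧ p y ∈ φ.source ∧ PositiveAt p φ y}
  pos_sub _ h := ⟨h.1, h.2.1⟩
  coherent φ hφ ψ hψ h1 h2 := by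
    rw [H.orientAgreeAt_iff hφ hψ h1 h2]
    simp only [mem_ofPred_eq]
    tauto

theorem mem_lift_pos (H : IsDeveloping A Γ p) {φ : OpenPartialHomeomorph N H4} (hφ : φ ∈ A) {y : H4}
    (hy : p y ∈ φ.source) : φ ∈ (H.lift y).pos ↔ PositiveAt p φ y :=
  ⟨fun h => h.2.2, fun h => ⟨hφ, hy, h⟩⟩

theorem continuous_lift (H : IsDeveloping A Γ p) : Continuous H.lift := by
  refine OrientationCover.continuous_iff.2 ⟨H.isLocalHomeomorph.continuous, fun φ hφ y hy => ?_⟩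
  filter_upwards [H.eventually_positiveAt_iff hφ hy,
    H.isLocalHomeomorph.continuous.continuousAt (φ.open_source.mem_nhds hy)] with z h1 h2
  rw [H.mem_lift_pos hφ hy, H.mem_lift_pos hφ h2, h1]

/-- Over every point there are points of the orientation cover with both signs. -/
theorem exists_cover_point (H : IsDeveloping A Γ p) {φ : OpenPartialHomeomorph N H4} (hφ : φ ∈ A)
    {x : N} (hx : x ∈ φ.source) (b : Prop) :
    ∃ z : OrientationCover A, z.point = x ∧ (φ ∈ z.pos ↔ b) := by
  obtain ⟨y, rfl⟩ := H.surjective x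
  refine ⟨⟨p y, {ψ | ψ ∈ A ∧ p y ∈ ψ.source ∧ ((PositiveAt p ψ y ↔ PositiveAt p φ y) ↔ b)},
    fun ψ h => ⟨h.1, h.2.1⟩, fun ψ hψ χ hχ h1 h2 => ?_⟩, rfl, ?_⟩
  · rw [H.orientAgreeAt_iff hψ hχ h1 h2]
    simp only [mem_ofPred_eq]
    tauto
  · simp only [mem_ofPred_eq]
    tauto

open Classical in
/-- Over the domain of a chart, the orientation cover is a product. -/
noncomputable def coverEquiv (H : IsDeveloping A Γ p) {φ : OpenPartialHomeomorph N H4}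
    (hφ : φ ∈ A) :
    (OrientationCover.point : OrientationCover A → N) ⁻¹' φ.source ≃ φ.source × Bool :=
  Equiv.ofBijective (fun z => (⟨z.1.point, z.2⟩, decide (φ ∈ z.1.pos))) <| by
    constructor
    · rintro ⟨z, hz⟩ ⟨z', hz'⟩ h
      rw [Prod.ext_iff] at h
      have h1 : z.point = z'.point := congrArg Subtype.val h.1
      exact Subtype.ext (OrientationCover.eq_of_point_eq h1 hφ hz (decide_eq_decide.1 h.2))
    · rintro ⟨⟨x, hx⟩, b⟩
      obtain ⟨z, rfl, h⟩ := H.exists_cover_point hφ hx (b = true)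
      exact ⟨⟨z, hx⟩, Prod.ext rfl (by simp [h])⟩

theorem coverEquiv_fst (H : IsDeveloping A Γ p) {φ : OpenPartialHomeomorph N H4} (hφ : φ ∈ A)
    (z : (OrientationCover.point : OrientationCover A → N) ⁻¹' φ.source) :
    (H.coverEquiv hφ z).1.1 = z.1.point := rfl

theorem coverEquiv_snd (H : IsDeveloping A Γ p) {φ : OpenPartialHomeomorph N H4} (hφ : φ ∈ A)
    (z : (OrientationCover.point : OrientationCover A → N) ⁻¹' φ.source) :
    (H.coverEquiv hφ z).2 = true ↔ φ ∈ z.1.pos := by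
  classical
  exact decide_eq_true_iff

theorem continuous_coverEquiv (H : IsDeveloping A Γ p) {φ : OpenPartialHomeomorph N H4}
    (hφ : φ ∈ A) : Continuous (H.coverEquiv hφ) := by
  have h1 : Continuous fun z => (H.coverEquiv hφ z).1 :=
    (OrientationCover.continuous_point.comp continuous_subtype_val).subtype_mk fun z => z.2
  refine h1.prodMk (continuous_discrete_rng.2 fun b => ?_)
  have h2 := (OrientationCover.continuous_iff.1 (continuous_subtype_val :
    Continuous (Subtype.val : (OrientationCover.point : OrientationCover A → N) ⁻¹' φ.source → _))).2
    φ hφ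
  rw [isOpen_iff_mem_nhds]
  rintro z rfl
  filter_upwards [h2 z z.2] with z' h3
  exact Bool.eq_iff_iff.2 ((H.coverEquiv_snd hφ z').trans (h3.trans (H.coverEquiv_snd hφ z).symm))

theorem continuous_coverEquiv_symm (H : IsDeveloping A Γ p) {φ : OpenPartialHomeomorph N H4}
    (hφ : φ ∈ A) : Continuous (H.coverEquiv hφ).symm := by
  refine Continuous.subtype_mk (f := fun q => ((H.coverEquiv hφ).symm q).1) ?_ _
  have hpt : ∀ q, ((H.coverEquiv hφ).symm q).1.point = q.1.1 := fun q => by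
    rw [← H.coverEquiv_fst hφ, Equiv.apply_symm_apply]
  have hpos : ∀ q, φ ∈ ((H.coverEquiv hφ).symm q).1.pos ↔ q.2 = true := fun q => by
    rw [← H.coverEquiv_snd hφ, Equiv.apply_symm_apply]
  refine OrientationCover.continuous_iff.2 ⟨?_, fun ψ hψ q hq => ?_⟩
  · simp only [hpt]
    exact continuous_subtype_val.comp continuous_fst
  -- Whether φ and ψ agree in orientation is locally constant, so the sign of φ controls the sign of
  -- ψ near the point.
  · have hagree : ∀ᶠ x in 𝓝 q.1.1, (OrientAgreeAt φ ψ x ↔ OrientAgreeAt φ ψ q.1.1) := by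
      have hq1 := q.1.2
      rw [hpt] at hq
      generalize q.1.1 = x at hq hq1
      obtain ⟨y, rfl⟩ := H.surjective x
      rw [H.eventually_nhds_iff, H.orientAgreeAt_iff hφ hψ hq1 hq]
      filter_upwards [H.eventually_positiveAt_iff hφ hq1, H.eventually_positiveAt_iff hψ hq,
        H.isLocalHomeomorph.continuous.continuousAt (φ.open_source.mem_nhds hq1),
        H.isLocalHomeomorph.continuous.continuousAt (ψ.open_source.mem_nhds hq)] with z h1 h2 h3 h4
      rw [H.orientAgreeAt_iff hφ hψ h3 h4, h1, h2]
    have hsrc : ∀ᶠ x in 𝓝 q.1.1, x ∈ ψ.source := ψ.open_source.mem_nhds (by rwa [hpt] at hq)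
    have hc : Continuous fun q : φ.source × Bool => q.1.1 :=
      continuous_subtype_val.comp continuous_fst
    have hb : ∀ᶠ q' : φ.source × Bool in 𝓝 q, q'.2 = q.2 :=
      continuous_snd.continuousAt ((isOpen_discrete {q.2}).mem_nhds rfl)
    filter_upwards [hc.continuousAt.eventually hagree, hc.continuousAt.eventually hsrc, hb]
      with q' h1 h2 h3
    have e1 := ((H.coverEquiv hφ).symm q).1.coherent φ hφ ψ hψ (by rw [hpt]; exact q.1.2) hq
    have e2 := ((H.coverEquiv hφ).symm q').1.coherent φ hφ ψ hψ (by rw [hpt]; exact q'.1.2)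
      (by rwa [hpt])
    rw [hpt, hpos] at e1 e2
    rw [h3] at e2
    tauto

theorem isCoveringMap (H : IsDeveloping A Γ p) :
    IsCoveringMap (fun z : OrientationCover A => z.point) := by
  intro x
  obtain ⟨y, rfl⟩ := H.surjective x
  obtain ⟨φ, hφ, hy, -⟩ := H.exists_chart y 1
  have : IsEvenlyCovered (fun z : OrientationCover A => z.point) (p y) Bool :=
    ⟨inferInstance, φ.source, hy, φ.open_source,
      φ.open_source.preimage OrientationCover.continuous_point,
      ⟨H.coverEquiv hφ, H.continuous_coverEquiv hφ, H.continuous_coverEquiv_symm hφ⟩,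
      fun z => H.coverEquiv_fst hφ z⟩
  exact this.to_isEvenlyCovered_preimage

theorem ncard_fibre (H : IsDeveloping A Γ p) (x : N) :
    {z : OrientationCover A | z.point = x}.ncard = 2 := by
  obtain ⟨y, rfl⟩ := H.surjective x
  obtain ⟨φ, hφ, hy, -⟩ := H.exists_chart y 1
  obtain ⟨z, hz, hzp⟩ := H.exists_cover_point hφ hy True
  obtain ⟨z', hz', hzp'⟩ := H.exists_cover_point hφ hy False
  refine Set.ncard_eq_two.2 ⟨z, z', ?_, ?_⟩
  · rintro rfl
    tauto
  · ext w
    simp only [mem_ofPred_eq, mem_insert_iff, mem_singleton_iff]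
    constructor
    · intro hw
      by_cases h : φ ∈ w.pos
      · exact .inl (OrientationCover.eq_of_point_eq (hw.trans hz.symm) hφ (by rwa [hw]) (by tauto))
      · exact .inr (OrientationCover.eq_of_point_eq (hw.trans hz'.symm) hφ (by rwa [hw]) (by tauto))
    · rintro (rfl | rfl) <;> assumption

theorem lift_eq_iff (H : IsDeveloping A Γ p) (y y' : H4) :
    H.lift y = H.lift y' ↔ ∃ g ∈ Γ ⊓ orientationSubgroup, g • y = y' := by
  obtain ⟨φ, hφ, hy, -⟩ := H.exists_chart y 1
  have hl : ∀ g ∈ Γ, (H.lift y = H.lift (g • y) ↔ 0 < hypDet g) := by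
    intro g hg
    have e := H.smul_eq hg y
    have hy' : p (g • y) ∈ φ.source := by rwa [e]
    have h1 := H.positiveAt_smul hφ hy hg
    rw [← H.mem_lift_pos hφ hy, ← H.mem_lift_pos hφ hy'] at h1
    constructor
    · intro h
      rw [← h] at h1
      tauto
    · exact fun h => OrientationCover.eq_of_point_eq e.symm hφ hy (by tauto)
  constructor
  · intro h
    obtain ⟨g, hg, rfl⟩ := (H.eq_iff y y').1 (congrArg OrientationCover.point h)
    exact ⟨g, ⟨hg, (hl g hg).1 h⟩, rfl⟩
  · rintro ⟨g, ⟨hg, hg'⟩, rfl⟩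
    exact (hl g hg).2 hg'

theorem isLocalHomeomorph_lift (H : IsDeveloping A Γ p) : IsLocalHomeomorph H.lift :=
  IsLocalHomeomorph.of_comp (g := fun z : OrientationCover A => z.point)
    H.isLocalHomeomorph H.isCoveringMap.isLocalHomeomorph H.continuous_lift

/-- There are only two orientations over p y; they are the lifts of y and of g • y for an
orientation reversing g. -/
theorem lift_surjective (H : IsDeveloping A Γ p) {g : hypIso} (hg : g ∈ Γ)
    (hg0 : ¬ 0 < hypDet g) : Function.Surjective H.lift := by
  intro z
  obtain ⟨y, hy⟩ := H.surjective z.point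
  obtain ⟨φ, hφ, hys, -⟩ := H.exists_chart y 1
  have hys' : p (g • y) ∈ φ.source := by rwa [H.smul_eq hg]
  by_cases h : φ ∈ z.pos ↔ φ ∈ (H.lift y).pos
  · exact ⟨y, OrientationCover.eq_of_point_eq hy hφ hys h.symm⟩
  · have h1 := H.positiveAt_smul hφ hys hg
    rw [← H.mem_lift_pos hφ hys, ← H.mem_lift_pos hφ hys'] at h1
    exact ⟨g • y, OrientationCover.eq_of_point_eq ((H.smul_eq hg y).trans hy) hφ hys' (by tauto)⟩

/-- The orientation cover of a non-orientable quotient of `H4` is the quotient by the orientation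
preserving subgroup. -/
theorem isDeveloping_lift (H : IsDeveloping A Γ p) {g : hypIso} (hg : g ∈ Γ)
    (hg0 : ¬ 0 < hypDet g) :
    IsDeveloping (liftedAtlas A) (Γ ⊓ orientationSubgroup) H.lift where
  t2 := by
    have := H.t2
    refine ⟨fun z z' hne => ?_⟩
    by_cases h : z.point = z'.point
    · exact H.isCoveringMap.isSeparatedMap z z' h hne
    · obtain ⟨U, V, hU, hV, h1, h2, h3⟩ := t2_separation h
      exact ⟨_, _, hU.preimage OrientationCover.continuous_point,
        hV.preimage OrientationCover.continuous_point, h1, h2, h3.preimage _⟩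
  surjective := H.lift_surjective hg hg0
  isLocalHomeomorph := H.isLocalHomeomorph_lift
  eq_iff := H.lift_eq_iff
  mem_iff ψ := by
    constructor
    · intro hψ y hy
      obtain ⟨φ, hφ, h1, h2⟩ := hψ _ hy
      obtain ⟨h, hh⟩ := (H.mem_iff φ).1 hφ y h1
      refine ⟨h, ?_⟩
      filter_upwards [hh, H.continuous_lift.continuousAt.eventually h2] with z h3 h4
      rw [h4]
      exact h3
    · intro hψ z hz
      obtain ⟨y, rfl⟩ := H.lift_surjective hg hg0 z
      obtain ⟨h, hh⟩ := hψ y hz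
      obtain ⟨φ, hφ, h1, h2, -⟩ := H.exists_chart y h
      refine ⟨φ, hφ, h1, ?_⟩
      rw [← H.isLocalHomeomorph_lift.map_nhds_eq, eventually_map]
      filter_upwards [hh, h2] with z h3 h4
      rw [h3, ← h4]
      rfl

end IsDeveloping

end OrientationCover

/-! ### The developing map of `M'` -/

section

variable {lab : Sym2 (Fin 6) → Fin 5} (hlab : IsProperLabelling lab)

/-- The group of deck transformations: the isometries that fix the base tile. -/
def deckGroup : Subgroup hypIso where
  carrier := {g | ∃ σ : Equiv.Perm Tile, (g, σ) ∈ tileGroup hlab ∧ σ 0 = 0}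
  mul_mem' := by
    rintro g h ⟨σ, h1, h2⟩ ⟨τ, h3, h4⟩
    exact ⟨σ * τ, mul_mem h1 h3, by rw [Equiv.Perm.mul_apply, h4, h2]⟩
  one_mem' := ⟨1, one_mem _, rfl⟩
  inv_mem' := by
    rintro g ⟨σ, h1, h2⟩
    exact ⟨σ⁻¹, inv_mem h1, by rw [Equiv.Perm.inv_eq_iff_eq, h2]⟩

theorem isDeveloping_mPrime : IsDeveloping (MPrime.atlas lab) (deckGroup hlab) (dev hlab 0) where
  t2 := t2Space_mPrime hlab
  surjective := dev_surjective hlab 0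
  isLocalHomeomorph := isLocalHomeomorph_dev hlab 0
  eq_iff y y' := by
    rw [dev_eq_iff]
    constructor
    · rintro ⟨g, h1, h2, h3⟩
      exact ⟨g.1, ⟨g.2, h1, h2⟩, h3⟩
    · rintro ⟨g, ⟨σ, h1, h2⟩, h3⟩
      exact ⟨(g, σ), h1, h2, h3⟩
  mem_iff _ := mem_mPrime_atlas_iff_dev hlab 0

end

/-! ### The tiles around an ideal vertex -/

/-- The facets that contain the ideal vertex `e 0`, `e 1` of the polytope. -/
def cuspLetters (e : Equiv.Perm (Fin 5)) : Set Letter :=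
  {.inl (e 2), .inl (e 3), .inl (e 4), .inr (e 0), .inr (e 1)}

section

variable {lab : Sym2 (Fin 6) → Fin 5} (hlab : IsProperLabelling lab)

/-- The hexagon formed by two matchings passes through all six vertices, so two reflections already
act transitively on the index u. -/
theorem exists_parabolic_inl {i j : Fin 5} (hij : i ≠ j) (w u u' : Fin 6) :
    ∃ g ∈ parabolic hlab {.inl i, .inl j}, g.2 (w, u) = (w, u') := by
  obtain ⟨p, hp, -, H⟩ := matching_hexagon hlab hij u
  have hi : gen hlab (.inl i) ∈ parabolic hlab {.inl i, .inl j} :=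
    gen_mem_parabolic hlab (by simp)
  have hj : gen hlab (.inl j) ∈ parabolic hlab {.inl i, .inl j} :=
    gen_mem_parabolic hlab (by simp)
  rcases H u' with rfl | rfl | rfl | rfl | rfl | rfl
  · exact ⟨1, one_mem _, rfl⟩
  · exact ⟨_, hi, rfl⟩
  · exact ⟨_, hj, rfl⟩
  · exact ⟨_, mul_mem hj hi, rfl⟩
  · exact ⟨_, mul_mem hi hj, rfl⟩
  · exact ⟨_, mul_mem hi (mul_mem hj hi), by rw [← hp]; rfl⟩

theorem exists_parabolic_inr {i j : Fin 5} (hij : i ≠ j) (w w' u : Fin 6) :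
    ∃ g ∈ parabolic hlab {.inr i, .inr j}, g.2 (w, u) = (w', u) := by
  obtain ⟨p, hp, -, H⟩ := matching_hexagon hlab hij w
  have hi : gen hlab (.inr i) ∈ parabolic hlab {.inr i, .inr j} :=
    gen_mem_parabolic hlab (by simp)
  have hj : gen hlab (.inr j) ∈ parabolic hlab {.inr i, .inr j} :=
    gen_mem_parabolic hlab (by simp)
  rcases H w' with rfl | rfl | rfl | rfl | rfl | rfl
  · exact ⟨1, one_mem _, rfl⟩
  · exact ⟨_, hi, rfl⟩
  · exact ⟨_, hj, rfl⟩
  · exact ⟨_, mul_mem hj hi, rfl⟩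
  · exact ⟨_, mul_mem hi hj, rfl⟩
  · exact ⟨_, mul_mem hi (mul_mem hj hi), by rw [← hp]; rfl⟩

/-- Three matchings contain a triangle. -/
theorem exists_triangle (e : Equiv.Perm (Fin 5)) :
    ∃ u, matching hlab (e 4) (matching hlab (e 3) (matching hlab (e 2) u)) = u := by
  by_contra! H
  set k := matching hlab (e 2)
  set l := matching hlab (e 3)
  have h23 : e 2 ≠ e 3 := fun h => by simpa using e.injective h
  have hkl : ∀ u, l (k u) ≠ u := fun u h => by
    refine matching_ne_matching hlab h23 u ?_
    rw [← matching_matching hlab (e 3) (matching hlab (e 2) u)]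
    exact congrArg _ h
  -- The labels `e 2` and `e 3` are already used by edges of the path u, k u, l (k u), and `e 4`
  -- would close a triangle of the desired kind.
  have hlabel : ∀ u, lab s(u, l (k u)) = e 0 ∨ lab s(u, l (k u)) = e 1 := by
    intro u
    obtain ⟨n, hn⟩ := e.surjective (lab s(u, l (k u)))
    have hmatch : matching hlab (e n) u = l (k u) := by
      rw [hn]; exact matching_lab hlab (hkl u).symm
    rw [← hn]
    fin_cases n
    · exact .inl rfl
    · exact .inr rfl
    · refine (matching_ne hlab (e 3) (k u) ?_).elim
      exact hmatch.symm
    · refine (matching_ne hlab (e 2) u ?_).elim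
      exact ((matching hlab (e 3)).injective hmatch).symm
    · refine (H u ?_).elim
      rw [← hmatch]
      exact matching_matching hlab (e 4) u
  set f : Fin 6 → Fin 6 := fun u => l (k u)
  -- By the hexagon f has order three. The orbit of 0 is a triangle whose edges, pairwise adjacent,
  -- need three labels, whereas only `e 0` and `e 1` are available.
  have hf3 : ∀ u, f (f (f u)) = u := by
    intro u
    have h1 : k (l (k u)) = l (k (l u)) := matching_braid hlab h23 u
    have h2 : f (f u) = k (l u) := by
      change l (k (l (k u))) = _
      rw [h1]
      exact matching_matching hlab (e 3) _
    rw [h2]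
    change l (k (k (l u))) = u
    rw [show k (k (l u)) = l u from matching_matching hlab (e 2) _]
    exact matching_matching hlab (e 3) _
  have n1 : f 0 ≠ 0 := hkl 0
  have n2 : f (f 0) ≠ f 0 := hkl (f 0)
  have n3 : f (f 0) ≠ 0 := fun h => by
    have := hf3 0
    rw [h] at this
    exact n1 this
  have l1 := hlabel 0
  have l2 := hlabel (f 0)
  have l3 := hlabel (f (f 0))
  change lab s(f (f 0), f (f (f 0))) = _ ∨ lab s(f (f 0), f (f (f 0))) = _ at l3
  change lab s(0, f 0) = _ ∨ lab s(0, f 0) = _ at l1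
  change lab s(f 0, f (f 0)) = _ ∨ lab s(f 0, f (f 0)) = _ at l2
  rw [hf3] at l3
  have d1 : lab s(f 0, 0) ≠ lab s(f 0, f (f 0)) := hlab _ _ _ n1 n2.symm n3.symm
  have d2 : lab s(f (f 0), 0) ≠ lab s(f (f 0), f 0) := hlab _ _ _ n3 n2 n1.symm
  have d3 : lab s(0, f 0) ≠ lab s(0, f (f 0)) := hlab _ _ _ n1.symm n3.symm n2.symm
  rw [Sym2.eq_swap (a := f 0) (b := 0)] at d1
  rw [Sym2.eq_swap (a := f (f 0)) (b := f 0), Sym2.eq_swap (a := f (f 0)) (b := 0)] at d2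
  rw [Sym2.eq_swap (a := f (f 0)) (b := 0)] at l3
  rcases l1 with l1 | l1 <;> rcases l2 with l2 | l2 <;> rcases l3 with l3 | l3 <;>
    simp_all

theorem hypDet_gen (a : Letter) : hypDet (gen hlab a).1 = -1 := hypDet_refl a

/-- The reflections in the facets at an ideal vertex act transitively on the tiles, also when the
orientation is taken into account. -/
theorem exists_parabolic_cuspLetters (e : Equiv.Perm (Fin 5)) (t : Tile) (b : Prop) :
    ∃ g ∈ parabolic hlab (cuspLetters e), g.2 t = 0 ∧ (0 < hypDet g.1 ↔ b) := by
  have h23 : e 2 ≠ e 3 := fun h => by simpa using e.injective h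
  have h01 : e 0 ≠ e 1 := fun h => by simpa using e.injective h
  have hr : parabolic hlab {.inl (e 2), .inl (e 3)} ≤ parabolic hlab (cuspLetters e) :=
    parabolic_mono hlab (by intro a; simp only [cuspLetters, mem_insert_iff, mem_singleton_iff]; tauto)
  have hs : parabolic hlab {.inr (e 0), .inr (e 1)} ≤ parabolic hlab (cuspLetters e) :=
    parabolic_mono hlab (by intro a; simp only [cuspLetters, mem_insert_iff, mem_singleton_iff]; tauto)
  obtain ⟨u, hu⟩ := exists_triangle hlab e
  obtain ⟨c, hc, hcu⟩ := exists_parabolic_inl hlab h23 0 0 u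
  -- An odd word that walks around a triangle: conjugated by c to the base tile, it changes the
  -- orientation without changing the tile.
  set d := gen hlab (.inl (e 4)) * gen hlab (.inl (e 3)) * gen hlab (.inl (e 2))
  have hd : d ∈ parabolic hlab (cuspLetters e) := by
    refine mul_mem (mul_mem ?_ ?_) ?_ <;> exact gen_mem_parabolic hlab (by simp [cuspLetters])
  have hd0 : (c⁻¹ * d * c).2 0 = 0 := by
    have e1 : d.2 (0, u) = (0, u) := Prod.ext rfl hu
    have e2 : c.2 (0 : Tile) = (0, u) := hcu
    simp only [Prod.snd_mul, Equiv.Perm.mul_apply, Prod.snd_inv, e2, e1]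
    rw [Equiv.Perm.inv_eq_iff_eq, e2]
  have hdet : hypDet (c⁻¹ * d * c).1 = -1 := by
    simp only [Prod.fst_mul, Prod.fst_inv, map_mul, d, hypDet_gen]
    have : hypDet c.1⁻¹ * hypDet c.1 = 1 := by rw [← map_mul, inv_mul_cancel, map_one]
    linear_combination -this
  obtain ⟨g, hg, e1⟩ := exists_parabolic_inl hlab h23 t.1 t.2 0
  obtain ⟨g', hg', e2⟩ := exists_parabolic_inr hlab h01 t.1 0 0
  have hgg : g' * g ∈ parabolic hlab (cuspLetters e) := mul_mem (hs hg') (hr hg)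
  have e3 : (g' * g).2 t = 0 := by
    rw [Prod.snd_mul, Equiv.Perm.mul_apply, e1, e2]; rfl
  by_cases h : 0 < hypDet (g' * g).1 ↔ b
  · exact ⟨_, hgg, e3, h⟩
  · refine ⟨(c⁻¹ * d * c) * (g' * g),
      mul_mem (mul_mem (mul_mem (inv_mem (hr hc)) hd) (hr hc)) hgg, ?_, ?_⟩
    · rw [Prod.snd_mul, Equiv.Perm.mul_apply, e3, hd0]
    · rw [Prod.fst_mul, hypDet_mul_pos, hdet]
      have : ¬ (0 : ℝ) < -1 := by norm_num
      tauto

/-- The deck group contains orientation reversing elements. -/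
theorem exists_deckGroup_not_pos : ∃ g ∈ deckGroup hlab, ¬ 0 < hypDet g := by
  obtain ⟨g, hg, h1, h2⟩ := exists_parabolic_cuspLetters hlab 1 0 False
  exact ⟨g.1, ⟨g.2, parabolic_le hlab _ hg, h1⟩, by tauto⟩

end

/-! ### Null vectors and horoballs -/

theorem lor_self_nonneg_of_orthogonal {x : E5} {y : H4} (h : lor x y = 0) : 0 ≤ lor x x := by
  by_contra! hx
  have hy := hyperboloid_subset_timeCone y.2
  rcases lt_trichotomy (ht x) 0 with h0 | h0 | h0
  · have e : -x = (-1 : ℝ) • x := by simp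
    have := lor_neg_of_mem_timeCone (x := -x) (by rw [e, lor_smul_left, lor_smul_right]; linarith)
      (by rw [map_neg]; linarith) hy
    rw [e, lor_smul_left, h] at this
    linarith
  · have := lor_self_ge x
    rw [h0] at this
    linarith
  · have := lor_neg_of_mem_timeCone hx.le h0 hy
    linarith

/-- The primitive integral null vectors in the future cone. -/
def IsPrimitiveNull (v : E5) : Prop :=
  v ∈ intLattice ∧ lor v v = 0 ∧ 0 < ht v ∧ ∀ r : ℝ, r • v ∈ intLattice → ∃ n : ℤ, r = n

theorem IsPrimitiveNull.lor_neg {v : E5} (hv : IsPrimitiveNull v) (y : H4) :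
    lor (y : E5) v < 0 := by
  rw [lor_comm]
  exact lor_neg_of_mem_timeCone hv.2.1.le hv.2.2.1 (hyperboloid_subset_timeCone y.2)

/-- Orthogonal null vectors are proportional, because their combination of height 0 has norm 0 and
the form is definite there. Primitivity of both makes the factor 1. -/
theorem IsPrimitiveNull.eq_of_lor_eq_zero {v v' : E5} (hv : IsPrimitiveNull v)
    (hv' : IsPrimitiveNull v') (h : lor v v' = 0) : v = v' := by
  obtain ⟨h1, h2, h3, h4⟩ := hv
  obtain ⟨h1', h2', h3', h4'⟩ := hv'
  have hw0 : ht (ht v' • v - ht v • v') = 0 := by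
    rw [map_sub, map_smul, map_smul, smul_eq_mul, smul_eq_mul]; ring
  have hw : lor (ht v' • v - ht v • v') (ht v' • v - ht v • v') = 0 := by
    simp only [lor_sub_left, lor_sub_right, lor_smul_left, lor_smul_right, h, lor_comm v' v, h2, h2']
    ring
  rw [lor_self, ← ht_apply (ht v' • v - ht v • v'), hw0] at hw
  have hz : ht v' • v = ht v • v' := by
    rw [← sub_eq_zero]
    ext i
    have hs : ∑ i, ((ht v' • v - ht v • v') i) ^ 2 = 0 := by simpa using hw
    have := (Finset.sum_eq_zero_iff_of_nonneg fun i _ => sq_nonneg _).1 hs i (Finset.mem_univ i)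
    exact pow_eq_zero_iff (two_ne_zero) |>.1 this
  have e1 : v' = (ht v' / ht v) • v := by
    rw [div_eq_inv_mul, mul_smul, hz, smul_smul, inv_mul_cancel₀ h3.ne', one_smul]
  have e2 : v = (ht v / ht v') • v' := by
    rw [div_eq_inv_mul, mul_smul, ← hz, smul_smul, inv_mul_cancel₀ h3'.ne', one_smul]
  obtain ⟨n, hn⟩ := h4 _ (e1 ▸ h1')
  obtain ⟨n', hn'⟩ := h4' _ (e2 ▸ h1)
  have hprod : n * n' = 1 := by
    have : (n * n' : ℝ) = 1 := by
      rw [← hn, ← hn']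
      field_simp
    exact_mod_cast this
  have hpos : 0 < n := by
    have : (0 : ℝ) < n := by rw [← hn]; positivity
    exact_mod_cast this
  have hn1 : n = 1 := Int.eq_one_of_mul_eq_one_right hpos.le hprod
  rw [e1, hn, hn1]
  simp

theorem two_mul_lor_intLattice {v v' : E5} (hv : v ∈ intLattice) (hv' : v' ∈ intLattice) :
    ∃ n : ℤ, 2 * lor v v' = n := by
  obtain ⟨a, ha⟩ := ht_intLattice hv
  obtain ⟨b, hb⟩ := ht_intLattice hv'
  obtain ⟨z, hz⟩ := hv
  obtain ⟨z', hz'⟩ := hv'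
  refine ⟨2 * ∑ i, z i * z' i - a * b, ?_⟩
  rw [lor, ← ht_apply v, ← ht_apply v', ha, hb]
  simp only [hz, hz']
  push_cast
  ring

theorem horoball_two_smul (v : E5) : horoball ((2 : ℝ) • v) = {x : H4 | -lor (x : E5) v < 1 / 2} := by
  ext x
  simp only [horoball, mem_ofPred_eq, lor_smul_right]
  constructor <;> intro <;> linarith

/-- The horoballs at distinct primitive null vectors are disjoint. -/
theorem IsPrimitiveNull.eq_of_mem_horoball {v v' : E5} (hv : IsPrimitiveNull v)
    (hv' : IsPrimitiveNull v') {y : H4} (h : y ∈ horoball ((2 : ℝ) • v))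
    (h' : y ∈ horoball ((2 : ℝ) • v')) : v = v' := by
  rw [horoball_two_smul] at h h'
  have h0 := hv.lor_neg y
  have h0' := hv'.lor_neg y
  refine hv.eq_of_lor_eq_zero hv' ?_
  by_contra hne
  have hle : lor v v' ≤ 0 := by
    have h1 := spatial_sq_le v v'
    rw [hv.2.1, hv'.2.1] at h1
    have h2 : (∑ i, (v i - ht v / 5) * (v' i - ht v' / 5)) ^ 2 ≤
        (3 / 10 * (ht v * ht v')) ^ 2 := h1.trans (le_of_eq (by ring))
    have h3 := hv.2.2.1
    have h4 := hv'.2.2.1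
    have h5 := (abs_le_of_sq_le_sq' h2 (by positivity)).2
    rw [lor_eq_sum]
    linarith
  obtain ⟨n, hn⟩ := two_mul_lor_intLattice hv.1 hv'.1
  have hn1 : n ≤ -1 := by
    have : n < 0 := by
      have : (n : ℝ) < 0 := by rw [← hn]; linarith [lt_of_le_of_ne hle hne]
      exact_mod_cast this
    omega
  have hn1' : (n : ℝ) ≤ -1 := by exact_mod_cast hn1
  -- The vector v + v' + L y is orthogonal to y, so its norm 2⟨v, v'⟩ + L² is nonnegative. But 2⟨v,
  -- v'⟩ is an integer at most -1, and the horoballs give -1 < L < 0.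
  set L := lor (y : E5) v + lor (y : E5) v' with hL
  have horth : lor (v + v' + L • (y : E5)) y = 0 := by
    rw [lor_add_left, lor_add_left, lor_smul_left, lor_coe_self, hL, lor_comm v, lor_comm v']
    ring
  have hnn := lor_self_nonneg_of_orthogonal horth
  have e : lor (v + v' + L • (y : E5)) (v + v' + L • (y : E5)) = 2 * lor v v' + L ^ 2 := by
    simp only [lor_add_left, lor_add_right, lor_smul_left, lor_smul_right, lor_coe_self, hv.2.1,
      hv'.2.1, lor_comm v' v, lor_comm v (y : E5), lor_comm v' (y : E5)]
    rw [hL]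
    ring
  rw [e, hn] at hnn
  have h1 : -1 < L := by
    simp only [mem_ofPred_eq] at h h'
    linarith
  have h2 : L < 0 := by linarith
  nlinarith

section

variable {lab : Sym2 (Fin 6) → Fin 5} (hlab : IsProperLabelling lab)

theorem IsPrimitiveNull.smul {v : E5} (hv : IsPrimitiveNull v) {g : hypIso × Equiv.Perm Tile}
    (hg : g ∈ tileGroup hlab) : IsPrimitiveNull (g.1.1 v) := by
  refine ⟨tileGroup_intLattice hlab hg hv.1, by rw [lor_map, hv.2.1],
    ht_map_pos _ hv.2.1.le hv.2.2.1, fun r hr => hv.2.2.2 r ?_⟩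
  rw [← map_smul] at hr
  have := tileGroup_intLattice hlab (inv_mem hg) hr
  have e : g⁻¹.1.1 (g.1.1 (r • v)) = r • v := by
    change (g.1⁻¹ * g.1).1 (r • v) = r • v
    rw [inv_mul_cancel]; rfl
  rwa [e] at this

theorem smul_mem_horoball {g : hypIso} {v : E5} {y : H4} :
    g • y ∈ horoball ((2 : ℝ) • g.1 v) ↔ y ∈ horoball ((2 : ℝ) • v) := by
  simp only [horoball_two_smul, mem_ofPred_eq, coe_smul, lor_map]

/-! ### The cusps of the polytope -/

/-- The ideal vertex `e 0`, `e 1` of the polytope. -/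
def idealVertex (e : Equiv.Perm (Fin 5)) : E5 := Pi.single (e 0) 1 + Pi.single (e 1) 1

variable (e : Equiv.Perm (Fin 5))

theorem sum_perm (x : E5) :
    ∑ i, x i = x (e 0) + x (e 1) + x (e 2) + x (e 3) + x (e 4) := by
  rw [← Equiv.sum_comp e, Fin.sum_univ_five]

theorem ht_perm (x : E5) : ht x = x (e 0) + x (e 1) + x (e 2) + x (e 3) + x (e 4) := by
  rw [ht_apply, sum_perm e]

/-- The distance of `x` from the ideal vertex, measured by horospheres. -/
def level : E5 →ₗ[ℝ] ℝ :=
  wall (.inl (e 2)) + wall (.inl (e 3)) + wall (.inl (e 4))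

theorem level_apply (x : E5) : level e x = x (e 2) + x (e 3) + x (e 4) := rfl

theorem lor_idealVertex (x : E5) : lor x (idealVertex e) = -level e x := by
  rw [idealVertex, lor_add_right, lor_single, lor_single, level_apply, ht_perm e]
  ring

theorem idealVertex_apply (n : Fin 5) : idealVertex e (e n) = if n = 0 ∨ n = 1 then 1 else 0 := by
  simp only [idealVertex, Pi.add_apply, Pi.single_apply, e.injective.eq_iff]
  fin_cases n <;> simp

theorem ht_idealVertex : ht (idealVertex e) = 2 := by
  rw [idealVertex, map_add, ht_single, ht_single]; norm_num

theorem isPrimitiveNull_idealVertex : IsPrimitiveNull (idealVertex e) := by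
  refine ⟨?_, ?_, by rw [ht_idealVertex]; norm_num, ?_⟩
  · refine ⟨fun i => if e.symm i = 0 ∨ e.symm i = 1 then 1 else 0, fun i => ?_⟩
    have := idealVertex_apply e (e.symm i)
    rw [e.apply_symm_apply] at this
    rw [this]
    push_cast
    rfl
  · rw [lor_idealVertex, level_apply]
    simp [idealVertex_apply]
  · rintro r ⟨z, hz⟩
    refine ⟨z (e 0), ?_⟩
    rw [← hz, Pi.smul_apply, idealVertex_apply]
    simp

theorem mem_horoball_idealVertex {x : H4} :
    x ∈ horoball ((2 : ℝ) • idealVertex e) ↔ level e (x : E5) < 1 / 2 := by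
  rw [horoball_two_smul, mem_ofPred_eq, lor_idealVertex, neg_neg]

theorem level_pos (x : H4) : 0 < level e (x : E5) := by
  have := (isPrimitiveNull_idealVertex e).lor_neg x
  rw [lor_idealVertex] at this
  linarith

theorem wall_idealVertex_nonneg (a : Letter) : 0 ≤ wall a (idealVertex e) := by
  rcases a with i | i
  · obtain ⟨n, rfl⟩ := e.surjective i
    rw [wall_inl, idealVertex_apply]
    split_ifs <;> norm_num
  · obtain ⟨n, rfl⟩ := e.surjective i
    rw [wall_inr, ht_idealVertex, idealVertex_apply]
    split_ifs <;> norm_num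

theorem wall_idealVertex_eq_zero {a : Letter} :
    wall a (idealVertex e) = 0 ↔ a ∈ cuspLetters e := by
  rcases a with i | i
  · obtain ⟨n, rfl⟩ := e.surjective i
    rw [wall_inl, idealVertex_apply]
    fin_cases n <;> simp [cuspLetters]
  · obtain ⟨n, rfl⟩ := e.surjective i
    rw [wall_inr, ht_idealVertex, idealVertex_apply]
    fin_cases n <;> simp [cuspLetters]

theorem exists_interior_horoball :
    ∃ x : H4, (∀ a, 0 < wall a (x : E5)) ∧ x ∈ horoball ((2 : ℝ) • idealVertex e) := by
  -- A step of 1/100 from the ideal vertex towards the barycentre is small enough: the level is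
  -- 3/100, and normalising divides it by more than 6/100.
  set z : E5 := idealVertex e + (1 / 100 : ℝ) • (fun _ => 1 : E5)
  have hlev : level e (fun _ => 1) = 3 := by simp only [level_apply]; norm_num
  have hlev0 : level e (idealVertex e) = 0 := by
    rw [level_apply]
    simp [idealVertex_apply]
  have hzz : lor z z = -(243 / 4000) := by
    have a1 : lor (fun _ => 1) (idealVertex e) = -3 := by rw [lor_idealVertex, hlev]
    have a2 : lor (idealVertex e) (fun _ => 1) = -3 := by rw [lor_comm, a1]
    have a3 : lor (idealVertex e) (idealVertex e) = 0 := (isPrimitiveNull_idealVertex e).2.1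
    have a4 : lor (fun _ => 1) (fun _ => 1) = -(15 / 2) := by rw [lor_ones, ht_ones]; norm_num
    simp only [z, lor_add_left, lor_add_right, lor_smul_left, lor_smul_right, a1, a2, a3, a4]
    norm_num
  have hz : z ∈ timeCone := by
    refine ⟨by rw [hzz]; norm_num, ?_⟩
    simp only [z, map_add, map_smul, ht_ones, ht_idealVertex]
    norm_num
  have hs : 6 / 100 < √(-lor z z) := by
    rw [hzz]
    exact Real.lt_sqrt_of_sq_lt (by norm_num)
  refine ⟨⟨_, normalize_mem hz⟩, fun a => ?_, ?_⟩
  · have h1 := wall_idealVertex_nonneg e a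
    have h2 : 0 < wall a (fun _ => 1) := by
      rcases a with i | i
      · simp
      · simp; norm_num
    simp only [normalize, map_smul, z, map_add, smul_eq_mul]
    exact mul_pos (inv_pos.2 (by linarith)) (by linarith)
  · rw [mem_horoball_idealVertex]
    simp only [normalize, map_smul, smul_eq_mul]
    have : level e z = 3 / 100 := by
      simp only [z, map_add, map_smul, hlev, hlev0]; norm_num
    rw [this, inv_mul_lt_iff₀ (by linarith)]
    linarith

/-- Points of the horoball at an ideal vertex are moved into the polytope by reflections in facets
that contain the ideal vertex. -/
theorem exists_parabolic_smul_mem {y : H4} (hy : y ∈ horoball ((2 : ℝ) • idealVertex e)) :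
    ∃ g ∈ parabolic hlab (cuspLetters e),
      g.1 • y ∈ horoball ((2 : ℝ) • idealVertex e) ∧ g.1 • y ∈ polytope := by
  refine exists_smul_mem_polytope hlab (fun z hz a ha => ?_) hy
  -- If the wall missed the ideal vertex, z would be even deeper in the horoball at the reflected
  -- vertex; since distinct horoballs are disjoint, the vertex would lie on the wall after all.
  have h0 : wall a (idealVertex e) = 0 := by
    by_contra hne
    have hpos := lt_of_le_of_ne (wall_idealVertex_nonneg e a) (Ne.symm hne)
    have hprim := (isPrimitiveNull_idealVertex e).smul hlab (gen_mem hlab a)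
    have hz' : z ∈ horoball ((2 : ℝ) • (refl a).1 (idealVertex e)) := by
      rw [horoball_two_smul, mem_ofPred_eq] at hz ⊢
      rw [refl_apply, lor_sub_right, lor_smul_right, lor_root]
      have := mul_neg_of_pos_of_neg hpos (mul_neg_of_pos_of_neg (rootScale_pos a) ha)
      linarith
    have heq : idealVertex e = (refl a).1 (idealVertex e) :=
      (isPrimitiveNull_idealVertex e).eq_of_mem_horoball hprim hz hz'
    have := wall_refl_self a (idealVertex e)
    rw [← heq] at this
    linarith
  refine ⟨(wall_idealVertex_eq_zero e).1 h0, ?_⟩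
  have := smul_mem_horoball (g := refl a) (v := idealVertex e) (y := z)
  rw [refl_apply_of_wall_eq_zero h0] at this
  exact this.2 hz

/-- The ideal vertices of the polytope are inequivalent under the group. -/
theorem idealVertex_eq_of_smul {e e' : Equiv.Perm (Fin 5)} {g : hypIso × Equiv.Perm Tile}
    (hg : g ∈ tileGroup hlab) (h : g.1.1 (idealVertex e) = idealVertex e') :
    idealVertex e = idealVertex e' := by
  obtain ⟨y, hy, hyv⟩ := exists_interior_horoball e
  have hgy : g.1 • y ∈ horoball ((2 : ℝ) • idealVertex e') := by
    rwa [← h, smul_mem_horoball]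
  obtain ⟨k, hk, h1, h2⟩ := exists_parabolic_smul_mem hlab e' hgy
  have h3 := smul_eq_of_mem_polytope hlab (mul_mem (parabolic_le hlab _ hk) hg)
    (mem_polytope.2 fun a => (hy a).le) (by rwa [Prod.fst_mul, mul_smul])
  rw [Prod.fst_mul, mul_smul] at h3
  rw [h3] at h1
  exact (isPrimitiveNull_idealVertex e).eq_of_mem_horoball (isPrimitiveNull_idealVertex e') hyv h1

/-- The stabiliser of an ideal vertex is generated by reflections. -/
theorem mem_parabolic_of_fixes {g : hypIso × Equiv.Perm Tile} (hg : g ∈ tileGroup hlab)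
    (h : g.1.1 (idealVertex e) = idealVertex e) : g ∈ parabolic hlab (cuspLetters e) := by
  obtain ⟨y, hy, hyv⟩ := exists_interior_horoball e
  have hgy : g.1 • y ∈ horoball ((2 : ℝ) • idealVertex e) := by
    have := smul_mem_horoball (g := g.1) (v := idealVertex e) (y := y)
    rw [h] at this
    exact this.2 hyv
  obtain ⟨k, hk, h1, h2⟩ := exists_parabolic_smul_mem hlab e hgy
  have hkg := mul_mem (parabolic_le hlab _ hk) hg
  have h3 := smul_eq_of_mem_polytope hlab hkg (mem_polytope.2 fun a => (hy a).le)
    (by rwa [Prod.fst_mul, mul_smul])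
  have h4 := eq_one_of_fixed hlab hkg h3 (snd_apply_eq_of_interior hlab hkg hy h3 0)
  rw [eq_inv_of_mul_eq_one_right h4]
  exact inv_mem hk

theorem parabolic_fixes_idealVertex {g : hypIso × Equiv.Perm Tile}
    (hg : g ∈ parabolic hlab (cuspLetters e)) : g.1.1 (idealVertex e) = idealVertex e :=
  parabolic_fixes hlab (fun _ ha => (wall_idealVertex_eq_zero e).2 ha) hg

end

/-- Far points of the polytope are in one of the horoballs. -/
theorem exists_mem_horoball_of_ht {x : H4} (hx : x ∈ polytope) (h : 24 < ht (x : E5)) :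
    ∃ i j : Fin 5, i ≠ j ∧ -lor (x : E5) (Pi.single i 1 + Pi.single j 1) < 1 / 2 := by
  set s := ht (x : E5)
  have h0 : ∀ i, 0 ≤ (x : E5) i := fun i => mem_polytope.1 hx (.inl i)
  have h1 : ∀ i, 0 ≤ s - 2 * (x : E5) i := fun i => mem_polytope.1 hx (.inr i)
  -- These nonnegative products add up to `s ^ 2` - 2 ∑ xᵢ² = 2. For s > 24 every coordinate is
  -- therefore below 1/6 or within 1/6 of s/2, and as they sum to s exactly two are large.
  have hprod : ∀ i, (x : E5) i * (s - 2 * (x : E5) i) ≤ 2 := by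
    intro i
    have hsum : ∑ i, (x : E5) i * (s - 2 * (x : E5) i) = 2 := by
      have h2 := sum_sq_eq x
      have h3 : ∑ i, (x : E5) i = s := (ht_apply _).symm
      calc ∑ i, (x : E5) i * (s - 2 * (x : E5) i)
          = s * ∑ i, (x : E5) i - 2 * ∑ i, (x : E5) i ^ 2 := by
            rw [Finset.mul_sum, Finset.mul_sum, ← Finset.sum_sub_distrib]
            exact Finset.sum_congr rfl fun i _ => by ring
        _ = 2 := by rw [h2, h3]; ring
    exact (Finset.single_le_sum (f := fun i => (x : E5) i * (s - 2 * (x : E5) i))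
      (fun i _ => mul_nonneg (h0 i) (h1 i)) (Finset.mem_univ i)).trans hsum.le
  set B : Finset (Fin 5) := Finset.univ.filter fun i => s / 4 < (x : E5) i
  have hB : ∀ i ∈ B, s / 2 - 1 / 6 ≤ (x : E5) i := by
    intro i hi
    have h2 : s / 4 < (x : E5) i := (Finset.mem_filter.1 hi).2
    by_contra! h3
    have := hprod i
    nlinarith [h1 i]
  have hB' : ∀ i ∈ B, (x : E5) i ≤ s / 2 := fun i _ => by linarith [h1 i]
  have hC : ∀ i ∈ Bᶜ, (x : E5) i < 1 / 6 := by
    intro i hi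
    have h2 : (x : E5) i ≤ s / 4 := by
      by_contra! h3
      exact (Finset.mem_compl.1 hi) (Finset.mem_filter.2 ⟨Finset.mem_univ i, h3⟩)
    by_contra! h3
    have := hprod i
    nlinarith [h1 i]
  have hsplit : ∑ i ∈ B, (x : E5) i + ∑ i ∈ Bᶜ, (x : E5) i = s := by
    rw [Finset.sum_add_sum_compl, ← ht_apply]
  have hcard : B.card + Bᶜ.card = 5 := by
    rw [Finset.card_compl, Fintype.card_fin]
    have := B.card_le_univ
    rw [Fintype.card_fin] at this
    omega
  have u1 := Finset.sum_le_card_nsmul B _ _ hB'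
  have u2 := Finset.card_nsmul_le_sum B _ _ hB
  have u3 := Finset.sum_le_card_nsmul Bᶜ _ _ fun i hi => (hC i hi).le
  have u4 : 0 ≤ ∑ i ∈ Bᶜ, (x : E5) i := Finset.sum_nonneg fun i _ => h0 i
  simp only [nsmul_eq_mul] at u1 u2 u3
  have hcR : (B.card : ℝ) + (Bᶜ.card : ℝ) = 5 := by exact_mod_cast hcard
  have hlow : 2 ≤ B.card := by
    by_contra! hlt
    have : (B.card : ℝ) ≤ 1 := by exact_mod_cast Nat.lt_succ_iff.1 hlt
    nlinarith
  have hhigh : B.card ≤ 2 := by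
    by_contra! hlt
    have : (3 : ℝ) ≤ B.card := by exact_mod_cast hlt
    nlinarith
  obtain ⟨i, j, hij, hBij⟩ := Finset.card_eq_two.1 (le_antisymm hhigh hlow)
  refine ⟨i, j, hij, ?_⟩
  have u5 : ∑ i ∈ Bᶜ, (x : E5) i < 1 / 2 := by
    have hc3 : Bᶜ.card = 3 := by omega
    have hne : Bᶜ.Nonempty := Finset.card_pos.1 (by omega)
    have := Finset.sum_lt_sum_of_nonempty hne hC
    rw [Finset.sum_const, hc3] at this
    norm_num at this
    linarith
  rw [hBij, Finset.sum_pair hij] at hsplit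
  rw [hBij] at u5
  rw [lor_add_right, lor_single, lor_single]
  linarith

/-! ### Euclidean coordinates on horospheres -/

section

variable (e : Equiv.Perm (Fin 5))

theorem level_map {g : hypIso} (h : g.1 (idealVertex e) = idealVertex e) (x : E5) :
    level e (g.1 x) = level e x := by
  have := lor_map g x (idealVertex e)
  rw [h, lor_idealVertex, lor_idealVertex] at this
  linarith

/-- The coordinates of the triangular factor of a horosphere at the ideal vertex. -/
def coord (a : Fin 3) (x : E5) : ℝ := x (e (![2, 3, 4] a))

/-- The coordinate of the interval factor of a horosphere at the ideal vertex. -/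
def diff (x : E5) : ℝ := x (e 0) - x (e 1)

theorem level_eq_coord (x : E5) : level e x = coord e 0 x + coord e 1 x + coord e 2 x := rfl

/-- The point of the horosphere at level `h` with given Euclidean coordinates. -/
noncomputable def horo (h : ℝ) (Y : Fin 3 → ℝ) : E5 := fun i =>
  -- The first two coordinates have difference h · Y 2, and the equation ⟨x, x⟩ = -1 determines
  -- their sum.
  ![(h * (Y 0 ^ 2 + Y 1 ^ 2 + (1 - Y 0 - Y 1) ^ 2 + Y 2 ^ 2 / 2 - 1 / 2 + Y 2) + 1 / h) / 2,
    (h * (Y 0 ^ 2 + Y 1 ^ 2 + (1 - Y 0 - Y 1) ^ 2 + Y 2 ^ 2 / 2 - 1 / 2 - Y 2) + 1 / h) / 2,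
    h * Y 0, h * Y 1, h * (1 - Y 0 - Y 1)] (e.symm i)

variable {e} {h : ℝ} {Y : Fin 3 → ℝ}

theorem coord_zero_horo : coord e 0 (horo e h Y) = h * Y 0 := by simp [coord, horo]

theorem coord_one_horo : coord e 1 (horo e h Y) = h * Y 1 := by simp [coord, horo]

theorem coord_two_horo : coord e 2 (horo e h Y) = h * (1 - Y 0 - Y 1) := by simp [coord, horo]

theorem diff_horo : diff e (horo e h Y) = h * Y 2 := by
  simp [diff, horo]
  ring

theorem level_horo : level e (horo e h Y) = h := by
  rw [level_eq_coord, coord_zero_horo, coord_one_horo, coord_two_horo]; ring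

theorem horo_mem (hh : 0 < h) : horo e h Y ∈ hyperboloid := by
  have h1 : h * h⁻¹ = 1 := mul_inv_cancel₀ hh.ne'
  constructor
  · simp only [lor, sum_perm e, horo, Equiv.symm_apply_apply]
    simp only [one_div, Matrix.cons_val]
    linear_combination -h1
  · simp only [sum_perm e, horo, Equiv.symm_apply_apply, one_div, Matrix.cons_val]
    have h2 : 0 < h⁻¹ := inv_pos.2 hh
    nlinarith [mul_nonneg hh.le (sq_nonneg (Y 0 - 1 / 2)), mul_nonneg hh.le (sq_nonneg (Y 1 - 1 / 2)),
      mul_nonneg hh.le (sq_nonneg (1 / 2 - Y 0 - Y 1)), mul_nonneg hh.le (sq_nonneg (Y 2))]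

/-- The equation ⟨z, z⟩ = -1 is linear in the sum of the coordinates `e 0` and `e 1`, with
coefficient proportional to the positive level; the listed coordinates give everything else. -/
theorem ext_coord {x y : H4} (h0 : coord e 0 (x : E5) = coord e 0 (y : E5))
    (h1 : coord e 1 (x : E5) = coord e 1 (y : E5)) (h2 : coord e 2 (x : E5) = coord e 2 (y : E5))
    (h3 : diff e (x : E5) = diff e (y : E5)) : x = y := by
  have hx := level_pos e x
  have hl : level e (x : E5) = level e (y : E5) := by simp only [level_eq_coord, h0, h1, h2]
  have key : ∀ z : H4, 2 * level e (z : E5) * ((z : E5) (e 0) + (z : E5) (e 1)) =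
      2 * (coord e 0 (z : E5) ^ 2 + coord e 1 (z : E5) ^ 2 + coord e 2 (z : E5) ^ 2) +
        diff e (z : E5) ^ 2 - level e (z : E5) ^ 2 + 2 := by
    intro z
    have := lor_coe_self z
    simp only [lor, sum_perm e] at this
    simp only [level_eq_coord, coord, diff, Matrix.cons_val]
    linear_combination -2 * this
  have hs : (x : E5) (e 0) + (x : E5) (e 1) = (y : E5) (e 0) + (y : E5) (e 1) := by
    refine mul_left_cancel₀ (mul_pos two_pos hx).ne' ?_
    rw [key x, h0, h1, h2, h3, hl, ← key y]
  simp only [coord, diff, Matrix.cons_val] at h0 h1 h2 h3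
  ext i
  obtain ⟨n, rfl⟩ := e.surjective i
  fin_cases n
  · change (x : E5) (e 0) = (y : E5) (e 0); linarith
  · change (x : E5) (e 1) = (y : E5) (e 1); linarith
  · exact h0
  · exact h1
  · exact h2

theorem eq_horo (x : H4) {l : ℝ} (hl : level e (x : E5) = l) :
    (x : E5) = horo e l ![coord e 0 (x : E5) / l, coord e 1 (x : E5) / l, diff e (x : E5) / l] := by
  have hx : 0 < l := hl ▸ level_pos e x
  have h2 : coord e 2 (x : E5) = l - coord e 0 (x : E5) - coord e 1 (x : E5) := by
    rw [← hl, level_eq_coord]; ring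
  refine congrArg Subtype.val (ext_coord (e := e) (x := x) (y := ⟨_, horo_mem hx⟩) ?_ ?_ ?_ ?_)
  · rw [coord_zero_horo]; simp; field_simp
  · rw [coord_one_horo]; simp; field_simp
  · rw [coord_two_horo, h2]; simp; field_simp
  · rw [diff_horo]; simp; field_simp

/-- `g` acts on the horospheres at the ideal vertex as a translation. -/
def IsTranslation (e : Equiv.Perm (Fin 5)) (g : hypIso) (n : Fin 3 → ℝ) : Prop :=
  g.1 (idealVertex e) = idealVertex e ∧ ∀ x,
    coord e 0 (g.1 x) = coord e 0 x + n 0 * level e x ∧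
    coord e 1 (g.1 x) = coord e 1 x + n 1 * level e x ∧
    diff e (g.1 x) = diff e x + n 2 * level e x

theorem IsTranslation.apply_horo {g : hypIso} {n : Fin 3 → ℝ} (hg : IsTranslation e g n)
    (hh : 0 < h) : g.1 (horo e h Y) = horo e h (Y + n) := by
  obtain ⟨h1, h2, h3⟩ := hg.2 (horo e h Y)
  have h4 := level_map e hg.1 (horo e h Y)
  rw [level_eq_coord, h1, h2, level_horo, coord_zero_horo, coord_one_horo] at h4
  rw [level_horo, coord_zero_horo] at h1
  rw [level_horo, coord_one_horo] at h2
  rw [level_horo, diff_horo] at h3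
  refine congrArg Subtype.val (ext_coord (e := e) (x := g • ⟨_, horo_mem hh⟩)
    (y := ⟨_, horo_mem hh⟩) ?_ ?_ ?_ ?_)
  · rw [coe_smul, h1, coord_zero_horo, Pi.add_apply]; ring
  · rw [coe_smul, h2, coord_one_horo, Pi.add_apply]; ring
  · rw [coe_smul, coord_two_horo, Pi.add_apply, Pi.add_apply]; linarith
  · rw [coe_smul, h3, diff_horo, Pi.add_apply]; ring

theorem horo_injective (hh : 0 < h) : Function.Injective (horo e h) := by
  intro Y Y' hY
  have h0 := congrArg (coord e 0) hY
  have h1 := congrArg (coord e 1) hY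
  have h2 := congrArg (diff e) hY
  rw [coord_zero_horo, coord_zero_horo] at h0
  rw [coord_one_horo, coord_one_horo] at h1
  rw [diff_horo, diff_horo] at h2
  ext i
  fin_cases i
  · exact mul_left_cancel₀ hh.ne' h0
  · exact mul_left_cancel₀ hh.ne' h1
  · exact mul_left_cancel₀ hh.ne' h2

theorem IsTranslation.eq {g : hypIso} {n m : Fin 3 → ℝ} (hn : IsTranslation e g n)
    (hm : IsTranslation e g m) : n = m := by
  have := hn.apply_horo (Y := 0) one_pos
  rw [hm.apply_horo one_pos, zero_add, zero_add] at this
  exact (horo_injective one_pos this).symm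

theorem IsTranslation.one : IsTranslation e 1 0 :=
  ⟨rfl, fun x => by
    simp⟩

theorem IsTranslation.mul {g g' : hypIso} {n n' : Fin 3 → ℝ} (hg : IsTranslation e g n)
    (hg' : IsTranslation e g' n') : IsTranslation e (g * g') (n + n') := by
  refine ⟨by change g.1 (g'.1 _) = _; rw [hg'.1, hg.1], fun x => ?_⟩
  change coord e 0 (g.1 (g'.1 x)) = _ ∧ coord e 1 (g.1 (g'.1 x)) = _ ∧ diff e (g.1 (g'.1 x)) = _
  obtain ⟨h1, h2, h3⟩ := hg.2 (g'.1 x)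
  obtain ⟨h1', h2', h3'⟩ := hg'.2 x
  rw [h1, h2, h3, h1', h2', h3', level_map e hg'.1]
  simp only [Pi.add_apply]
  refine ⟨?_, ?_, ?_⟩ <;> ring

theorem IsTranslation.inv {g : hypIso} {n : Fin 3 → ℝ} (hg : IsTranslation e g n) :
    IsTranslation e g⁻¹ (-n) := by
  have hinv : ∀ x, g.1 (g⁻¹.1 x) = x := fun x => g.1.apply_symm_apply x
  have hfix : g⁻¹.1 (idealVertex e) = idealVertex e := by
    apply g.1.injective
    rw [hinv, hg.1]
  refine ⟨hfix, fun x => ?_⟩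
  obtain ⟨h1, h2, h3⟩ := hg.2 (g⁻¹.1 x)
  rw [hinv, level_map e hfix] at h1 h2 h3
  simp only [Pi.neg_apply]
  refine ⟨?_, ?_, ?_⟩ <;> linarith

theorem IsTranslation.pow {g : hypIso} {n : Fin 3 → ℝ} (hg : IsTranslation e g n) (N : ℕ) :
    IsTranslation e (g ^ N) ((N : ℝ) • n) := by
  induction N with
  | zero => simpa using IsTranslation.one
  | succ N ih =>
    rw [pow_succ, Nat.cast_succ, add_smul, one_smul]
    exact ih.mul hg

end

/-! ### The stabiliser of an ideal vertex -/

section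

variable {lab : Sym2 (Fin 6) → Fin 5} (hlab : IsProperLabelling lab) (e : Equiv.Perm (Fin 5))

theorem refl_inl_apply (i j : Fin 5) (x : E5) :
    (refl (.inl i)).1 x j = x j - x i * (if j = i then 2 else -1) := by
  rw [refl_apply, Pi.sub_apply, Pi.smul_apply, wall_inl, root]
  by_cases h : j = i
  · subst h; simp; norm_num
  · simp [h]

theorem refl_inr_apply (i j : Fin 5) (x : E5) :
    (refl (.inr i)).1 x j = x j + if j = i then 2 * (ht x - 2 * x i) else 0 := by
  rw [refl_apply, Pi.sub_apply, Pi.smul_apply, wall_inr, root]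
  by_cases h : j = i
  · subst h; simp; ring
  · simp [h]

/-- In the plane where the three coordinates sum to the level, the reflection in a side of the
triangle has minus a transposition as linear part. Indices are taken modulo 3. -/
theorem coord_refl_inl (a b : Fin 3) (x : E5) :
    coord e a ((refl (.inl (e (![2, 3, 4] b)))).1 x) =
      -coord e (Equiv.swap (b + 1) (b + 2) a) x + (if a = b then 0 else 1) * level e x := by
  simp only [coord, refl_inl_apply, level_eq_coord, e.injective.eq_iff]
  fin_cases a <;> fin_cases b <;> simp [Equiv.swap_apply_def] <;> ring

theorem diff_refl_inl (b : Fin 3) (x : E5) :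
    diff e ((refl (.inl (e (![2, 3, 4] b)))).1 x) = diff e x := by
  simp only [diff, refl_inl_apply, e.injective.eq_iff]
  fin_cases b <;> simp

theorem coord_refl_inr (a : Fin 3) (c : Fin 2) (x : E5) :
    coord e a ((refl (.inr (e (![0, 1] c)))).1 x) = coord e a x := by
  simp only [coord, refl_inr_apply, e.injective.eq_iff]
  fin_cases a <;> fin_cases c <;> simp

theorem diff_refl_inr (c : Fin 2) (x : E5) :
    diff e ((refl (.inr (e (![0, 1] c)))).1 x) = -diff e x + ![2, -2] c * level e x := by
  simp only [diff, refl_inr_apply, e.injective.eq_iff, level_apply, ht_perm e]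
  fin_cases c <;> simp <;> ring

/-- The letters of the reflections in the sides of the triangular factor. -/
def triangleLetters : Set Letter := range fun a : Fin 3 => .inl (e (![2, 3, 4] a))

/-- The letters of the reflections in the ends of the interval factor. -/
def intervalLetters : Set Letter := range fun c : Fin 2 => .inr (e (![0, 1] c))

theorem cuspLetters_eq_union : cuspLetters e = triangleLetters e ∪ intervalLetters e := by
  ext a
  simp only [cuspLetters, triangleLetters, intervalLetters, mem_insert_iff, mem_singleton_iff,
    mem_union, mem_range, Fin.exists_fin_succ]
  simp [eq_comm, or_assoc]

theorem triangleLetters_subset : triangleLetters e ⊆ cuspLetters e :=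
  cuspLetters_eq_union e ▸ subset_union_left

theorem intervalLetters_subset : intervalLetters e ⊆ cuspLetters e :=
  cuspLetters_eq_union e ▸ subset_union_right

/-- An invariant of words in the triangle reflections: the linear part is a permutation times its
sign, which is also the determinant, and the translation part is integral. -/
theorem exists_triangle_action {g : hypIso × Equiv.Perm Tile}
    (hg : g ∈ parabolic hlab (triangleLetters e)) :
    ∃ (σ : Equiv.Perm (Fin 3)) (n : Fin 3 → ℤ), hypDet g.1 = (Equiv.Perm.sign σ : ℤ) ∧
      (∀ a x, coord e a (g.1.1 x) = (Equiv.Perm.sign σ : ℤ) * coord e (σ a) x + n a * level e x) ∧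
      (∀ x, diff e (g.1.1 x) = diff e x) ∧ ∀ t, (g.2 t).1 = t.1 := by
  induction hg using parabolic_induction with
  | one =>
    refine ⟨1, 0, by simp, fun a x => ?_, fun x => rfl, fun t => rfl⟩
    simp
  | mul a ha g hg ih =>
    obtain ⟨b, rfl⟩ := ha
    obtain ⟨σ, n, h1, h2, h3, h4⟩ := ih
    have hlev : ∀ x, level e (g.1.1 x) = level e x := level_map e
      (parabolic_fixes_idealVertex hlab e (parabolic_mono hlab (triangleLetters_subset e) hg))
    have hsign : Equiv.Perm.sign (σ * Equiv.swap (b + 1) (b + 2)) = -Equiv.Perm.sign σ := by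
      have : b + 1 ≠ b + 2 := by revert b; decide
      rw [map_mul, Equiv.Perm.sign_swap this, mul_neg_one]
    refine ⟨σ * Equiv.swap (b + 1) (b + 2),
      fun a => -n (Equiv.swap (b + 1) (b + 2) a) + if a = b then 0 else 1, ?_, ?_, ?_, ?_⟩
    · rw [Prod.fst_mul, map_mul, hypDet_gen, h1, hsign]; simp
    · intro a x
      change coord e a ((refl _).1 (g.1.1 x)) = _
      rw [coord_refl_inl, h2, hlev, hsign, Equiv.Perm.mul_apply]
      push_cast
      ring
    · intro x
      exact (diff_refl_inl e b _).trans (h3 x)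
    · intro t
      exact h4 t

theorem exists_interval_action {g : hypIso × Equiv.Perm Tile}
    (hg : g ∈ parabolic hlab (intervalLetters e)) :
    ∃ (ε : ℤˣ) (n : ℤ), hypDet g.1 = (ε : ℤ) ∧
      (∀ x, diff e (g.1.1 x) = (ε : ℤ) * diff e x + n * level e x) ∧
      (∀ a x, coord e a (g.1.1 x) = coord e a x) ∧ ∀ t, (g.2 t).2 = t.2 := by
  induction hg using parabolic_induction with
  | one =>
    refine ⟨1, 0, by simp, fun x => ?_, fun a x => rfl, fun t => rfl⟩
    simp
  | mul a ha g hg ih =>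
    obtain ⟨c, rfl⟩ := ha
    obtain ⟨ε, n, h1, h2, h3, h4⟩ := ih
    have hlev : ∀ x, level e (g.1.1 x) = level e x := level_map e
      (parabolic_fixes_idealVertex hlab e (parabolic_mono hlab (intervalLetters_subset e) hg))
    refine ⟨-ε, -n + ![2, -2] c, ?_, ?_, ?_, ?_⟩
    · rw [Prod.fst_mul, map_mul, hypDet_gen, h1]; simp
    · intro x
      change diff e ((refl _).1 (g.1.1 x)) = _
      rw [diff_refl_inr, h2, hlev]
      fin_cases c <;> simp <;> ring
    · intro a x
      exact (coord_refl_inr e a c _).trans (h3 a x)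
    · intro t
      exact h4 t

/-- The triangle and the interval reflections commute, so the stabiliser is the product of a
Euclidean triangle group and an infinite dihedral group. -/
theorem exists_mul_of_mem_parabolic {g : hypIso × Equiv.Perm Tile}
    (hg : g ∈ parabolic hlab (cuspLetters e)) : ∃ r ∈ parabolic hlab (triangleLetters e),
      ∃ s ∈ parabolic hlab (intervalLetters e), g = r * s := by
  induction hg using parabolic_induction with
  | one => exact ⟨1, one_mem _, 1, one_mem _, rfl⟩
  | mul a ha g hg ih =>
    obtain ⟨r, hr, s, hs, rfl⟩ := ih
    rw [cuspLetters_eq_union] at ha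
    rcases ha with ha | ha
    · exact ⟨_, mul_mem (gen_mem_parabolic hlab ha) hr, s, hs, (mul_assoc _ _ _).symm⟩
    · refine ⟨r, hr, _, mul_mem (gen_mem_parabolic hlab ha) hs, ?_⟩
      have hcomm : gen hlab a * r = r * gen hlab a := by
        clear hg
        obtain ⟨c, rfl⟩ := ha
        induction hr using parabolic_induction with
        | one => rw [mul_one, one_mul]
        | mul b hb r hr ih =>
          obtain ⟨b, rfl⟩ := hb
          have hne : e (![2, 3, 4] b) ≠ e (![0, 1] c) := by
            rw [e.injective.ne_iff]
            have : ∀ (b : Fin 3) (c : Fin 2), (![2, 3, 4] b : Fin 5) ≠ ![0, 1] c := by decide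
            exact this b c
          rw [← mul_assoc, ← gen_inl_inr_comm hlab hne, mul_assoc, ih, mul_assoc]
      rw [← mul_assoc, hcomm, mul_assoc]

/-- Orientation preserving elements of the stabiliser of an ideal vertex that fix a tile are
translations: other elements would have fixed points. -/
theorem exists_isTranslation {g : hypIso × Equiv.Perm Tile} (hg : g ∈ tileGroup hlab)
    (h0 : g.2 0 = 0) (hdet : 0 < hypDet g.1) (hv : g.1.1 (idealVertex e) = idealVertex e) :
    ∃ n : Fin 3 → ℤ, IsTranslation e g.1 fun i => n i := by
  obtain ⟨r, hr, s, hs, rfl⟩ :=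
    exists_mul_of_mem_parabolic hlab e (mem_parabolic_of_fixes hlab e hg hv)
  obtain ⟨σ, n, r1, r2, r3, r4⟩ := exists_triangle_action hlab e hr
  obtain ⟨ε, m, s1, s2, s3, s4⟩ := exists_interval_action hlab e hs
  have hr' := parabolic_mono hlab (triangleLetters_subset e) hr
  have hs' := parabolic_mono hlab (intervalLetters_subset e) hs
  -- The two factors move different indices of the tile, so each fixes the base tile and is trivial
  -- as soon as it has a fixed point.
  have hs0 : s.2 0 = 0 := by
    refine Prod.ext ?_ (s4 0)
    rw [← r4, ← Equiv.Perm.mul_apply, ← Prod.snd_mul, h0]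
  have hr0 : r.2 0 = 0 := by
    rwa [Prod.snd_mul, Equiv.Perm.mul_apply, hs0] at h0
  have rfix {Y : Fin 3 → ℝ} (hY : ∀ a, coord e a (r.1.1 (horo e 1 Y)) = coord e a (horo e 1 Y)) :
      r = 1 := by
    refine eq_one_of_fixed hlab (parabolic_le hlab _ hr) (y := ⟨_, horo_mem (e := e) (Y := Y) one_pos⟩) ?_ hr0
    exact ext_coord (hY 0) (hY 1) (hY 2) (r3 _)
  have sfix {Y : Fin 3 → ℝ} (hY : diff e (s.1.1 (horo e 1 Y)) = diff e (horo e 1 Y)) : s = 1 := by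
    refine eq_one_of_fixed hlab (parabolic_le hlab _ hs) (y := ⟨_, horo_mem (e := e) (Y := Y) one_pos⟩) ?_ hs0
    exact ext_coord (s3 0 _) (s3 1 _) (s3 2 _) hY
  have hε : ε = 1 := by
    rcases Int.units_eq_one_or ε with h | h
    · exact h
    · have hs1 : s = 1 := by
        -- A reflection of the line fixes a point; then s = 1, which contradicts its determinant.
        refine sfix (Y := ![0, 0, m / 2]) ?_
        rw [s2, h, level_horo, diff_horo]
        simp
        ring
      rw [hs1, h] at s1
      simp at s1
      norm_num at s1
  have hσ : Equiv.Perm.sign σ = 1 := by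
    rcases Int.units_eq_one_or (Equiv.Perm.sign σ) with h | h
    · exact h
    · rw [Prod.fst_mul, map_mul, r1, s1, hε, h] at hdet
      norm_num at hdet
  have hsum : n 0 + n 1 + n 2 = 0 := by
    have h1 := level_map e (parabolic_fixes_idealVertex hlab e hr') (horo e 1 0)
    have h2 : ∑ a, coord e a (horo e 1 0) = 1 := by
      rw [Fin.sum_univ_three, ← level_eq_coord, level_horo]
    rw [level_horo, level_eq_coord, r2, r2, r2, hσ, level_horo] at h1
    rw [← Equiv.sum_comp σ, Fin.sum_univ_three] at h2
    have : (n 0 + n 1 + n 2 : ℝ) = 0 := by push_cast at h1; linarith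
    exact_mod_cast this
  obtain ⟨n', hr1⟩ : ∃ n' : Fin 3 → ℤ,
      ∀ a x, coord e a (r.1.1 x) = coord e a x + n' a * level e x := by
    by_cases h1 : σ = 1
    · refine ⟨n, fun a x => ?_⟩
      rw [r2, hσ, h1]
      simp
    · have hcyc : ∀ σ : Equiv.Perm (Fin 3), Equiv.Perm.sign σ = 1 → σ ≠ 1 →
          (σ 0 = 1 ∧ σ 1 = 2 ∧ σ 2 = 0) ∨ (σ 0 = 2 ∧ σ 1 = 0 ∧ σ 2 = 1) := by decide
      have hsumR : (n 0 + n 1 + n 2 : ℝ) = 0 := by exact_mod_cast hsum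
      have hr1 : r = 1 := by
        -- The centre of the rotation, found from y_a = y_{σ a} + n_a and the normalisation that the
        -- three coordinates sum to 1.
        refine rfix (Y := ![(1 + 2 * n 0 + n (σ 0)) / 3, (1 + 2 * n 1 + n (σ 1)) / 3, 0]) ?_
        intro a
        rw [r2, hσ, level_horo]
        rcases hcyc σ hσ h1 with ⟨h0, h1, h2⟩ | ⟨h0, h1, h2⟩ <;> fin_cases a <;>
          simp [h0, h1, h2, coord_zero_horo, coord_one_horo, coord_two_horo] <;>
          linarith
      exact ⟨0, fun a x => by simp [hr1]⟩
  refine ⟨![n' 0, n' 1, m], hv, fun x => ?_⟩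
  have hlev := level_map e (parabolic_fixes_idealVertex hlab e hs') x
  change coord e 0 (r.1.1 (s.1.1 x)) = _ ∧ coord e 1 (r.1.1 (s.1.1 x)) = _ ∧
    diff e (r.1.1 (s.1.1 x)) = _
  rw [hr1, hr1, r3, s2, s3, s3, hlev, hε]
  simp

/-! ### The translation lattice -/

/-- The word aba is the reflection in the line through a vertex of the triangle parallel to the side
c, so that c·aba is a translation. -/
theorem exists_isTranslation_triangle (a b c : Fin 3) (n : Fin 3 → ℝ)
    (h : (a, b, c) = (0, 1, 2) ∧ n = ![1, 1, 0] ∨ (a, b, c) = (1, 2, 0) ∧ n = ![-2, 1, 0]) :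
    ∃ g ∈ parabolic hlab (cuspLetters e), hypDet g.1 = 1 ∧ IsTranslation e g.1 n := by
  have hmem : ∀ a : Fin 3, gen hlab (.inl (e (![2, 3, 4] a))) ∈ parabolic hlab (cuspLetters e) :=
    fun a => gen_mem_parabolic hlab (triangleLetters_subset e ⟨a, rfl⟩)
  have key : ∀ (b : Fin 3) (y : E5), level e ((refl (.inl (e (![2, 3, 4] b)))).1 y) = level e y :=
    fun b => level_map e (parabolic_fixes_idealVertex hlab e (hmem b))
  have hg := mul_mem (hmem c) (mul_mem (hmem a) (mul_mem (hmem b) (hmem a)))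
  refine ⟨_, hg, ?_, parabolic_fixes_idealVertex hlab e hg, fun x => ?_⟩
  · simp only [Prod.fst_mul, map_mul, hypDet_gen]; norm_num
  change coord e 0 ((refl _).1 ((refl _).1 ((refl _).1 ((refl _).1 x)))) = _ ∧
    coord e 1 ((refl _).1 ((refl _).1 ((refl _).1 ((refl _).1 x)))) = _ ∧
    diff e ((refl _).1 ((refl _).1 ((refl _).1 ((refl _).1 x)))) = _
  simp only [coord_refl_inl, key, diff_refl_inl]
  rcases h with ⟨h, rfl⟩ | ⟨h, rfl⟩
  · obtain ⟨rfl, rfl, rfl⟩ := by simpa using h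
    simp [Equiv.swap_apply_def, level_eq_coord]
    constructor <;> ring
  · obtain ⟨rfl, rfl, rfl⟩ := by simpa using h
    simp [Equiv.swap_apply_def, level_eq_coord]
    constructor <;> ring

theorem exists_isTranslation_interval :
    ∃ g ∈ parabolic hlab (cuspLetters e), hypDet g.1 = 1 ∧ IsTranslation e g.1 ![0, 0, 4] := by
  have hmem : ∀ c : Fin 2, gen hlab (.inr (e (![0, 1] c))) ∈ parabolic hlab (cuspLetters e) :=
    fun c => gen_mem_parabolic hlab (intervalLetters_subset e ⟨c, rfl⟩)
  have hg := mul_mem (hmem 0) (hmem 1)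
  refine ⟨_, hg, ?_, parabolic_fixes_idealVertex hlab e hg, fun x => ?_⟩
  · simp only [Prod.fst_mul, map_mul, hypDet_gen]; norm_num
  change coord e 0 ((refl _).1 ((refl _).1 x)) = _ ∧ coord e 1 ((refl _).1 ((refl _).1 x)) = _ ∧
    diff e ((refl _).1 ((refl _).1 x)) = _
  have key : level e ((refl (.inr (e (![0, 1] 1)))).1 x) = level e x :=
    level_map e (parabolic_fixes_idealVertex hlab e (hmem 1)) x
  simp only [coord_refl_inr, diff_refl_inr, key]
  simp
  ring

/-- The group of a cusp of the orientation double cover. -/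
noncomputable def cuspGroup : Subgroup hypIso where
  carrier := {g | g ∈ deckGroup hlab ⊓ orientationSubgroup ∧ g.1 (idealVertex e) = idealVertex e}
  mul_mem' ha hb := ⟨mul_mem ha.1 hb.1, by
    rename_i a b
    change a.1 (b.1 _) = _
    rw [hb.2, ha.2]⟩
  one_mem' := ⟨one_mem _, rfl⟩
  inv_mem' {a} ha := ⟨inv_mem ha.1, by
    rw [← ha.2]
    exact (a.1.symm_apply_apply _).trans ha.2.symm⟩

theorem exists_isTranslation_of_mem {g : hypIso} (hg : g ∈ cuspGroup hlab e) :
    ∃ n : Fin 3 → ℤ, IsTranslation e g fun i => n i := by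
  obtain ⟨⟨⟨σ, h1, h2⟩, h3⟩, h4⟩ := hg
  exact exists_isTranslation hlab e h1 h2 h3 h4

/-- This power acts trivially on the tiles, so a positive multiple of every translation in the
stabiliser of the ideal vertex belongs to the cusp. -/
theorem pow_mem_cuspGroup {g : hypIso × Equiv.Perm Tile} (hg : g ∈ parabolic hlab (cuspLetters e))
    (h : hypDet g.1 = 1) : g.1 ^ Nat.card (Equiv.Perm Tile) ∈ cuspGroup hlab e := by
  have hN := pow_mem hg (Nat.card (Equiv.Perm Tile))
  refine ⟨⟨⟨_, parabolic_le hlab _ hN, ?_⟩, ?_⟩, parabolic_fixes_idealVertex hlab e hN⟩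
  · change (g.2 ^ Nat.card (Equiv.Perm Tile)) 0 = 0
    rw [pow_card_eq_one']
    rfl
  · change 0 < hypDet (g.1 ^ Nat.card (Equiv.Perm Tile))
    rw [map_pow, h, one_pow]
    exact one_pos

/-- The lattice of the translations in the group of a cusp. -/
noncomputable def cuspLattice : Submodule ℤ (Fin 3 → ℝ) :=
  AddSubgroup.toIntSubmodule
    { carrier := {n | ∃ g ∈ cuspGroup hlab e, IsTranslation e g n}
      add_mem' := fun ⟨g, h1, h2⟩ ⟨g', h1', h2'⟩ => ⟨g * g', mul_mem h1 h1', h2.mul h2'⟩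
      zero_mem' := ⟨1, one_mem _, .one⟩
      neg_mem' := fun ⟨g, h1, h2⟩ => ⟨g⁻¹, inv_mem h1, h2.inv⟩ }

theorem mem_cuspLattice {n : Fin 3 → ℝ} :
    n ∈ cuspLattice hlab e ↔ ∃ g ∈ cuspGroup hlab e, IsTranslation e g n := Iff.rfl

/-- All translation vectors are integral. -/
instance : DiscreteTopology (cuspLattice hlab e) := by
  refine DiscreteTopology.of_subset
    (s := (Submodule.span ℤ (range (Pi.basisFun ℝ (Fin 3))) : Set (Fin 3 → ℝ)))
    (inferInstanceAs (DiscreteTopology (Submodule.span ℤ (range (Pi.basisFun ℝ (Fin 3)))))) ?_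
  rintro n ⟨g, hg, hn⟩
  obtain ⟨m, hm⟩ := exists_isTranslation_of_mem hlab e hg
  rw [hn.eq hm]
  refine (Module.Basis.mem_span_iff_repr_mem ℤ _ _).2 fun i => ⟨m i, ?_⟩
  simp

/-- The lattice contains multiples of three independent translations of the reflection group. -/
instance : IsZLattice ℝ (cuspLattice hlab e) where
  span_top := by
    have hN : (Nat.card (Equiv.Perm Tile) : ℝ) ≠ 0 := by
      exact Nat.cast_ne_zero.2 Nat.card_pos.ne'
    have hmem : ∀ n, (∃ g ∈ parabolic hlab (cuspLetters e), hypDet g.1 = 1 ∧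
        IsTranslation e g.1 n) → n ∈ Submodule.span ℝ (cuspLattice hlab e : Set (Fin 3 → ℝ)) := by
      rintro n ⟨g, h1, h2, h3⟩
      have := Submodule.subset_span (R := ℝ) (s := (cuspLattice hlab e : Set (Fin 3 → ℝ)))
        ⟨_, pow_mem_cuspGroup hlab e h1 h2, h3.pow _⟩
      exact (Submodule.smul_mem_iff _ hN).1 this
    have h1 := hmem _ (exists_isTranslation_triangle hlab e 0 1 2 _ (.inl ⟨rfl, rfl⟩))
    have h2 := hmem _ (exists_isTranslation_triangle hlab e 1 2 0 _ (.inr ⟨rfl, rfl⟩))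
    have h3 := hmem _ (exists_isTranslation_interval hlab e)
    refine eq_top_iff.2 fun x _ => ?_
    have hx : x = ((x 0 + 2 * x 1) / 3) • ![1, 1, 0] + ((x 1 - x 0) / 3) • ![-2, 1, 0] +
        (x 2 / 4) • ![0, 0, 4] := by
      ext i
      fin_cases i <;> simp <;> ring
    rw [hx]
    exact add_mem (add_mem (Submodule.smul_mem _ _ h1) (Submodule.smul_mem _ _ h2))
      (Submodule.smul_mem _ _ h3)

theorem exists_basis_cuspLattice : ∃ B : (Fin 3 → ℝ) ≃ₗ[ℝ] (Fin 3 → ℝ), ∀ x,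
    B x ∈ cuspLattice hlab e ↔ ∃ n : Fin 3 → ℤ, ∀ i, x i = n i := by
  have := ZLattice.module_free ℝ (cuspLattice hlab e)
  have := ZLattice.module_finite ℝ (cuspLattice hlab e)
  have hrank : Module.finrank ℤ (cuspLattice hlab e) = 3 := by
    rw [ZLattice.rank ℝ (cuspLattice hlab e)]
    simp
  let b := (Module.finBasisOfFinrankEq ℤ (cuspLattice hlab e) hrank).ofZLatticeBasis ℝ
    (cuspLattice hlab e)
  refine ⟨b.equivFun.symm, fun x => ?_⟩
  rw [← (Module.finBasisOfFinrankEq ℤ (cuspLattice hlab e) hrank).ofZLatticeBasis_span ℝ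
    (cuspLattice hlab e), Module.Basis.mem_span_iff_repr_mem ℤ b]
  simp only [← Module.Basis.equivFun_apply, LinearEquiv.apply_symm_apply, mem_range]
  constructor
  · intro h
    choose n hn using h
    exact ⟨n, fun i => (hn i).symm⟩
  · rintro ⟨n, hn⟩ i
    exact ⟨n i, (hn i).symm⟩

end

/-! ### The cusps of the orientation double cover -/

section

variable (e : Equiv.Perm (Fin 5))

theorem mem_horosphere_idealVertex {x : H4} {t : ℝ} :
    x ∈ horosphere ((2 : ℝ) • idealVertex e) t ↔ level e (x : E5) = t / 2 := by
  rw [horosphere, mem_ofPred_eq, lor_smul_right, lor_idealVertex]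
  constructor <;> intro <;> linarith

/-- The point of the horosphere at level `h` with given Euclidean coordinates, as a point of
hyperbolic space. -/
noncomputable def horoPoint {h : ℝ} (hh : 0 < h) (Y : Fin 3 → ℝ) : H4 := ⟨horo e h Y, horo_mem hh⟩

theorem level_horoPoint {h : ℝ} (hh : 0 < h) (Y : Fin 3 → ℝ) :
    level e (horoPoint e hh Y : E5) = h := level_horo

theorem exists_horoPoint_eq {h : ℝ} (hh : 0 < h) {x : H4} (hx : level e (x : E5) = h) :
    ∃ Y, horoPoint e hh Y = x := ⟨_, Subtype.ext (eq_horo x hx).symm⟩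

theorem contDiff_horo (h : ℝ) : ContDiff ℝ ∞ (horo e h) := by
  refine contDiff_pi.2 fun i => ?_
  obtain ⟨n, rfl⟩ := e.surjective i
  simp only [horo, Equiv.symm_apply_apply]
  fin_cases n <;> simp only [Fin.zero_eta, Fin.mk_one, Fin.reduceFinMk, Matrix.cons_val] <;> fun_prop

theorem continuous_horoPoint {h : ℝ} (hh : 0 < h) : Continuous (horoPoint e hh) :=
  (contDiff_horo e h).continuous.subtype_mk _

/-- The Euclidean coordinates, as a linear map. -/
def coords : E5 →ₗ[ℝ] (Fin 3 → ℝ) where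
  toFun x := ![coord e 0 x, coord e 1 x, diff e x]
  map_add' x y := by
    ext i
    fin_cases i <;> simp [coord, diff]; ring
  map_smul' c x := by
    ext i
    fin_cases i <;> simp [coord, diff]; ring

theorem coords_horo (h : ℝ) (Y : Fin 3 → ℝ) : coords e (horo e h Y) = h • Y := by
  ext i
  fin_cases i <;> simp [coords, coord_zero_horo, coord_one_horo, diff_horo]

/-- The linear map `coords` is a left inverse of the parametrisation up to the factor h. -/
theorem injective_fderiv_horo {h : ℝ} (hh : 0 < h) (B : (Fin 3 → ℝ) ≃ₗ[ℝ] (Fin 3 → ℝ))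
    (x : Fin 3 → ℝ) : Function.Injective (fderiv ℝ (fun y => horo e h (B y)) x) := by
  have hB : ContDiff ℝ ∞ (fun y => horo e h (B y)) :=
    (contDiff_horo e h).comp B.toContinuousLinearEquiv.contDiff
  have h1 := (hB.differentiable (by simp) x).hasFDerivAt
  have h2 := (coords e).toContinuousLinearMap.hasFDerivAt.comp x h1
  have h3 : HasFDerivAt (fun y => h • B y)
      (h • (B.toContinuousLinearEquiv : (Fin 3 → ℝ) →L[ℝ] (Fin 3 → ℝ))) x :=
    B.toContinuousLinearEquiv.hasFDerivAt.const_smul h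
  have h4 : (coords e).toContinuousLinearMap ∘ (fun y => horo e h (B y)) = fun y => h • B y :=
    funext fun y => coords_horo e h (B y)
  rw [h4] at h2
  have h5 := h2.unique h3
  refine Function.Injective.of_comp (f := coords e) ?_
  intro u v huv
  have h6 := DFunLike.congr_fun h5 u
  have h7 := DFunLike.congr_fun h5 v
  have h8 : h • B u = h • B v := h6.symm.trans (huv.trans h7)
  exact B.injective (smul_right_injective _ hh.ne' h8)

theorem image_horosphere {N : Type*} (p : H4 → N) {t : ℝ} (ht : 0 < t) (B : (Fin 3 → ℝ) ≃ₗ[ℝ] (Fin 3 → ℝ)) :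
    p '' horosphere ((2 : ℝ) • idealVertex e) t =
      range fun x => p (horoPoint e (half_pos ht) (B x)) := by
  ext z
  constructor
  · rintro ⟨x, hx, rfl⟩
    obtain ⟨Y, hY⟩ := exists_horoPoint_eq e (half_pos ht) ((mem_horosphere_idealVertex e).1 hx)
    exact ⟨B.symm Y, by simp [hY]⟩
  · rintro ⟨x, rfl⟩
    exact ⟨_, (mem_horosphere_idealVertex e).2 (level_horoPoint e _ _), rfl⟩

end

section

variable {lab : Sym2 (Fin 6) → Fin 5} {hlab : IsProperLabelling lab} {N : Type*}
  [TopologicalSpace N] {A : Set (OpenPartialHomeomorph N H4)} {p : H4 → N}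
  (H : IsDeveloping A (deckGroup hlab ⊓ orientationSubgroup) p) (e : Equiv.Perm (Fin 5))

theorem isCompact_ht_le (C : ℝ) : IsCompact {x : H4 | ht (x : E5) ≤ C} := by
  refine (isClosed_hyperboloid.isClosedEmbedding_subtypeVal.isCompact_preimage
    (isCompact_Icc (a := fun _ : Fin 5 => -C) (b := fun _ => C))).of_isClosed_subset
    (isClosed_le (ht.continuous_of_finiteDimensional.comp continuous_subtype_val)
      continuous_const) fun x hx => ?_
  have h := fun i => (abs_coord_le (by rw [lor_coe_self]; norm_num) (ht_pos x).le i).trans hx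
  exact ⟨fun i => (abs_le.1 (h i)).1, fun i => (abs_le.1 (h i)).2⟩

theorem exists_perm_idealVertex {i j : Fin 5} (hij : i ≠ j) :
    ∃ e : Equiv.Perm (Fin 5), e 0 = i ∧ e 1 = j := by
  have : ∀ i j : Fin 5, i ≠ j → (Equiv.swap 0 i * Equiv.swap 1 (Equiv.swap 0 i j)) 0 = i ∧
      (Equiv.swap 0 i * Equiv.swap 1 (Equiv.swap 0 i j)) 1 = j := by decide
  exact ⟨_, this i j hij⟩

include H

/-- An element that takes a point of the horoball back into it must fix the ideal vertex, because
horoballs at distinct vertices are disjoint. -/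
theorem apply_eq_iff_of_mem_horoball {x y : H4} (hx : x ∈ horoball ((2 : ℝ) • idealVertex e))
    (hy : y ∈ horoball ((2 : ℝ) • idealVertex e)) :
    p x = p y ↔ ∃ g ∈ cuspGroup hlab e, g • x = y := by
  rw [H.eq_iff]
  constructor
  · rintro ⟨g, hg, rfl⟩
    obtain ⟨σ, h1, -⟩ := hg.1
    refine ⟨g, ⟨hg, ?_⟩, rfl⟩
    exact ((isPrimitiveNull_idealVertex e).smul hlab h1).eq_of_mem_horoball
      (isPrimitiveNull_idealVertex e) (smul_mem_horoball.2 hx) hy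
  · rintro ⟨g, hg, rfl⟩
    exact ⟨g, hg.1, rfl⟩

theorem apply_horoPoint_eq_iff {t : ℝ} (ht : t ∈ Ioo (0 : ℝ) 1)
    {B : (Fin 3 → ℝ) ≃ₗ[ℝ] (Fin 3 → ℝ)}
    (hB : ∀ x, B x ∈ cuspLattice hlab e ↔ ∃ n : Fin 3 → ℤ, ∀ i, x i = n i) (x y : Fin 3 → ℝ) :
    p (horoPoint e (half_pos ht.1) (B x)) = p (horoPoint e (half_pos ht.1) (B y)) ↔
      ∃ n : Fin 3 → ℤ, ∀ i, y i = x i + n i := by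
  have hmem : ∀ Y, horoPoint e (half_pos ht.1) Y ∈ horoball ((2 : ℝ) • idealVertex e) := fun Y => by
    rw [mem_horoball_idealVertex, level_horoPoint]
    linarith [ht.2]
  have key : (∃ n : Fin 3 → ℤ, ∀ i, y i = x i + n i) ↔ B (y - x) ∈ cuspLattice hlab e := by
    rw [hB]
    simp only [Pi.sub_apply, sub_eq_iff_eq_add']
  rw [apply_eq_iff_of_mem_horoball H e (hmem _) (hmem _), key, mem_cuspLattice]
  refine exists_congr fun g => and_congr_right fun hg => ?_
  obtain ⟨n, hn⟩ := exists_isTranslation_of_mem hlab e hg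
  have h1 : g • horoPoint e (half_pos ht.1) (B x) =
      horoPoint e (half_pos ht.1) (B x + fun i => (n i : ℝ)) :=
    Subtype.ext (hn.apply_horo (half_pos ht.1))
  rw [h1, map_sub]
  constructor
  · intro h
    have := horo_injective (half_pos ht.1) (congrArg Subtype.val h)
    rwa [← this, add_sub_cancel_left]
  · intro h
    rw [hn.eq h, add_sub_cancel]

/-- The cusp at an ideal vertex. -/
noncomputable def cusp : Cusp A where
  -- The factor 2 makes the horoball the region of level below 1/2, where disjointness holds.
  centre := (2 : ℝ) • idealVertex e
  null := by
    rw [lor_smul_left, lor_smul_right, (isPrimitiveNull_idealVertex e).2.1, mul_zero, mul_zero]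
  future := by
    rw [← ht_apply, map_smul, ht_idealVertex]
    norm_num
  Γ := (cuspGroup hlab e).map hypIso.subtype
  isHypIso := by
    rintro _ ⟨g, -, rfl⟩
    exact g.2
  fixes := by
    rintro _ ⟨g, hg, rfl⟩
    exact (map_smul g.1 _ _).trans (congrArg _ hg.2)
  param := p
  localIsometry x _ := by
    obtain ⟨φ, hφ, hx, h1, -⟩ := H.exists_chart x 1
    refine ⟨φ, hφ, 1, (1 : hypIso).2, ?_⟩
    filter_upwards [h1, H.isLocalHomeomorph.continuous.continuousAt (φ.open_source.mem_nhds hx)]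
      with y hy hys
    exact ⟨hys, by rw [hy]; rfl⟩
  fibres x hx y hy := by
    rw [apply_eq_iff_of_mem_horoball H e hx hy]
    constructor
    · rintro ⟨g, hg, rfl⟩
      exact ⟨g.1, ⟨g, hg, rfl⟩, rfl⟩
    · rintro ⟨_, ⟨g, hg, rfl⟩, h⟩
      exact ⟨g, hg, Subtype.ext h⟩
  compactSections t ht := by
    obtain ⟨B, hB⟩ := exists_basis_cuspLattice hlab e
    rw [image_horosphere e p ht.1 B]
    have hc : Continuous fun x => p (horoPoint e (half_pos ht.1) (B x)) :=
      H.isLocalHomeomorph.continuous.comp ((continuous_horoPoint e _).comp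
        B.toContinuousLinearEquiv.continuous)
    have hcube := (isCompact_univ_pi fun _ : Fin 3 => isCompact_Icc (a := (0 : ℝ)) (b := 1)).image hc
    convert hcube using 1
    refine Subset.antisymm ?_ (image_subset_range _ _)
    rintro _ ⟨x, rfl⟩
    -- Modulo the lattice every point lies in the unit cube, so the section is the image of a
    -- compact set.
    refine ⟨fun i => Int.fract (x i), fun i _ => ⟨Int.fract_nonneg _, (Int.fract_lt_one _).le⟩, ?_⟩
    exact (apply_horoPoint_eq_iff H e ht hB _ _).2 ⟨fun i => ⌊x i⌋, fun i => by simp⟩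

theorem isOpen_region_cusp : IsOpen (cusp H e).region := by
  refine H.isLocalHomeomorph.isOpenMap _ ?_
  have : horoball ((2 : ℝ) • idealVertex e) = {x : H4 | level e (x : E5) < 1 / 2} :=
    ext fun x => mem_horoball_idealVertex e
  change IsOpen (horoball ((2 : ℝ) • idealVertex e))
  rw [this]
  exact isOpen_lt ((level e).continuous_of_finiteDimensional.comp continuous_subtype_val)
    continuous_const

theorem disjoint_region_cusp {e e' : Equiv.Perm (Fin 5)} (h : idealVertex e ≠ idealVertex e') :
    Disjoint (cusp H e).region (cusp H e').region := by
  refine Set.disjoint_left.2 ?_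
  rintro _ ⟨y, hy, rfl⟩ ⟨y', hy', hyy⟩
  obtain ⟨g, ⟨⟨σ, h1, -⟩, -⟩, rfl⟩ := (H.eq_iff _ _).1 hyy.symm
  refine h (idealVertex_eq_of_smul hlab h1 ?_)
  exact ((isPrimitiveNull_idealVertex e).smul hlab h1).eq_of_mem_horoball
    (isPrimitiveNull_idealVertex e') (smul_mem_horoball.2 hy) hy'

/-- The cusp sections are tori. -/
theorem isSmoothThreeTorus_crossSection {t : ℝ} (ht : t ∈ Ioo (0 : ℝ) 1) :
    IsSmoothThreeTorus A ((cusp H e).crossSection t) := by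
  obtain ⟨B, hB⟩ := exists_basis_cuspLattice hlab e
  refine ⟨fun x => p (horoPoint e (half_pos ht.1) (B x)), (image_horosphere e p ht.1 B).symm,
    apply_horoPoint_eq_iff H e ht hB, fun x => ?_⟩
  have hc : Continuous fun x => horoPoint e (half_pos ht.1) (B x) :=
    (continuous_horoPoint e _).comp B.toContinuousLinearEquiv.continuous
  obtain ⟨φ, hφ, hx, h1, -⟩ := H.exists_chart (horoPoint e (half_pos ht.1) (B x)) 1
  have heq : (fun y => (φ (p (horoPoint e (half_pos ht.1) (B y))) : E5)) =ᶠ[𝓝 x]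
      fun y => horo e (t / 2) (B y) := by
    filter_upwards [hc.continuousAt.eventually h1] with y hy
    rw [hy]
    rfl
  refine ⟨φ, hφ, (H.isLocalHomeomorph.continuous.comp hc).continuousAt (φ.open_source.mem_nhds hx),
    ?_, ?_⟩
  · refine ContDiffAt.congr_of_eventuallyEq ?_ heq
    exact ((contDiff_horo e _).comp B.toContinuousLinearEquiv.contDiff).contDiffAt
  · rw [heq.fderiv_eq]
    exact injective_fderiv_horo e (half_pos ht.1) B x

/-! ### The compact part -/

/-- The copies of the polytope in M are indexed by a tile and a sign of orientation: group elements
that carry the same tile to the base tile with the same sign give the same copy. -/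
theorem apply_smul_eq {k h : hypIso × Equiv.Perm Tile} (hk : k ∈ tileGroup hlab)
    (hh : h ∈ tileGroup hlab) {t : Tile} (hkt : k.2 t = 0) (hht : h.2 t = 0)
    (hdet : 0 < hypDet h.1 ↔ 0 < hypDet k.1) (x : H4) : p (k.1 • x) = p (h.1 • x) := by
  refine (H.eq_iff _ _).2 ⟨h.1 * k.1⁻¹, ⟨⟨h.2 * k.2⁻¹, mul_mem hh (inv_mem hk), ?_⟩, ?_⟩, ?_⟩
  · rw [Equiv.Perm.mul_apply, Equiv.Perm.inv_eq_iff_eq.2 hkt.symm, hht]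
  · change 0 < hypDet (h.1 * k.1⁻¹)
    rw [hypDet_mul_pos, hypDet_inv_pos, hdet]
  · rw [mul_smul, inv_smul_smul]

theorem exists_tile_apply_eq (z : N) : ∃ x ∈ polytope, ∃ k ∈ tileGroup hlab, ∃ t, k.2 t = 0 ∧
    p (k.1 • x) = z := by
  obtain ⟨y, rfl⟩ := H.surjective z
  obtain ⟨g, hg, hx⟩ := exists_tileGroup_smul_mem hlab y
  refine ⟨_, hx, g⁻¹, inv_mem hg, g.2 0, ?_, ?_⟩
  · rw [Prod.snd_inv, Equiv.Perm.inv_eq_iff_eq]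
  · rw [Prod.fst_inv, inv_smul_smul]

theorem isCompact_compl_regions {ι : Type*} (c : ι → Equiv.Perm (Fin 5))
    (hc : ∀ i j, i ≠ j → ∃ k, idealVertex (c k) = Pi.single i 1 + Pi.single j 1) :
    IsCompact (⋃ k, (cusp H (c k)).region)ᶜ := by
  classical
  choose k hk1 hk2 hk3 using fun t (b : Bool) => exists_parabolic_cuspLetters hlab 1 t (b = true)
  have hK : IsCompact (⋃ q : Tile × Bool,
      (fun x : H4 => p ((k q.1 q.2).1 • x)) '' {x : H4 | ht (x : E5) ≤ 24}) :=
    isCompact_iUnion fun q => (isCompact_ht_le 24).image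
      (H.isLocalHomeomorph.continuous.comp (continuous_const_smul _))
  refine hK.of_isClosed_subset (isOpen_iUnion fun i => isOpen_region_cusp H _).isClosed_compl ?_
  intro z hz
  obtain ⟨x, hx, g, hg, t, hgt, rfl⟩ := exists_tile_apply_eq H z
  by_cases hxC : ht (x : E5) ≤ 24
  · refine mem_iUnion.2 ⟨(t, decide (0 < hypDet g.1)), x, hxC, ?_⟩
    refine apply_smul_eq H (parabolic_le hlab _ (hk1 _ _)) hg (hk2 _ _) hgt ?_ x
    rw [hk3]
    simp
  · refine absurd ?_ hz
    obtain ⟨i, j, hij, h1⟩ := exists_mem_horoball_of_ht hx (not_le.1 hxC)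
    obtain ⟨l, hl⟩ := hc i j hij
    -- The element g may be replaced by s, with the same tile and sign, which fixes the ideal
    -- vertex. So all corners of this type lie in one and the same cusp.
    obtain ⟨s, hs1, hs2, hs3⟩ := exists_parabolic_cuspLetters hlab (c l) t (0 < hypDet g.1)
    refine mem_iUnion.2 ⟨l, s.1 • x, ?_, apply_smul_eq H (parabolic_le hlab _ hs1) hg hs2 hgt
      hs3.symm x⟩
    have h2 := parabolic_fixes_idealVertex hlab (c l) hs1
    have h3 : x ∈ horoball ((2 : ℝ) • idealVertex (c l)) := by
      rw [horoball_two_smul, hl]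
      exact h1
    have h4 := (smul_mem_horoball (g := s.1)).2 h3
    rwa [h2] at h4

theorem hasExactlyTorusCusps : HasExactlyTorusCusps A 10 := by
  have hpair : ∀ s : Finset.powersetCard 2 (Finset.univ : Finset (Fin 5)),
      ∃ e : Equiv.Perm (Fin 5), s.1 = {e 0, e 1} := by
    rintro ⟨s, hs⟩
    obtain ⟨i, j, hij, rfl⟩ := Finset.card_eq_two.1 (Finset.mem_powersetCard.1 hs).2
    obtain ⟨e, rfl, rfl⟩ := exists_perm_idealVertex hij
    exact ⟨e, rfl⟩
  choose e he using hpair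
  let q : Fin 10 ≃ Finset.powersetCard 2 (Finset.univ : Finset (Fin 5)) :=
    (Finset.equivFinOfCardEq (by rw [Finset.card_powersetCard]; rfl)).symm
  -- The ideal vertices are the midpoints of the edges of the simplex; the two coordinates equal to
  -- 1 recover the edge, so there are 5 choose 2 of them.
  have hv : ∀ s i, i ∈ s.1 ↔ idealVertex (e s) i = 1 := by
    intro s i
    obtain ⟨n, rfl⟩ := (e s).surjective i
    conv_lhs => rw [he s]
    rw [idealVertex_apply, Finset.mem_insert, Finset.mem_singleton, (e s).injective.eq_iff,
      (e s).injective.eq_iff]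
    split_ifs with h <;> simp [h]
  refine ⟨fun k => cusp H (e (q k)), fun k l hkl => disjoint_region_cusp H fun h => hkl ?_,
    isCompact_compl_regions H (fun k => e (q k)) fun i j hij => ?_,
    fun k t ht => isSmoothThreeTorus_crossSection H _ ht⟩
  · refine q.injective (Subtype.ext (Finset.ext fun i => ?_))
    rw [hv, hv, h]
  · have hs : ({i, j} : Finset (Fin 5)) ∈ Finset.powersetCard 2 (Finset.univ : Finset (Fin 5)) :=
      Finset.mem_powersetCard.2 ⟨Finset.subset_univ _, Finset.card_pair hij⟩
    refine ⟨q.symm ⟨_, hs⟩, ?_⟩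
    rw [q.apply_symm_apply]
    have h2 := he ⟨_, hs⟩
    rw [idealVertex, ← Finset.sum_pair (f := fun i => (Pi.single i 1 : E5))
      (fun h => by simpa using (e ⟨_, hs⟩).injective h), ← h2, Finset.sum_pair hij]

end

end Rectified

theorem mainTheorem5 (lab : Sym2 (Fin 6) → Fin 5) (hlab : Rectified.IsProperLabelling lab) :
    Rectified.IsCompleteHyperbolicManifold (Rectified.MPrime.atlas lab) ∧
    ¬ Rectified.IsOrientable (Rectified.MPrime.atlas lab) ∧
    IsCoveringMap (fun z : Rectified.MCover lab => z.point) ∧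
    (∀ x : Rectified.MPrime lab, {z : Rectified.MCover lab | z.point = x}.ncard = 2) ∧
    Rectified.IsCompleteHyperbolicManifold (Rectified.MCover.atlas lab) ∧
    Rectified.IsOrientable (Rectified.MCover.atlas lab) ∧
    Rectified.HasExactlyTorusCusps (Rectified.MCover.atlas lab) 10 := by
  obtain ⟨g, hg, hg0⟩ := Rectified.exists_deckGroup_not_pos hlab
  have H := Rectified.isDeveloping_mPrime hlab
  have H' := H.isDeveloping_lift hg hg0
  exact ⟨H.isCompleteHyperbolicManifold, H.not_isOrientable hg hg0, H.isCoveringMap, H.ncard_fibre,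
    H'.isCompleteHyperbolicManifold, H'.isOrientable fun _ h => h.2,
    Rectified.hasExactlyTorusCusps H'⟩
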